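/- **Setting.** Let $\Omega=\mathbb R\times(-1,1)$, $\Omega_+=\mathbb R\times(0,1)$, $\Omega_-=\mathbb R\times(-1,0)$, with coordinates $x=(x_1,x_2)$. Let $g>0$, $\mu_\pm>0$ and $\rho_+>\rho_->0$ be constants, put $[\rho]=\rho_+-\rho_-$, and let $\rho,\mu$ denote the functions equal to $\rho_\pm,\mu_\pm$ on $\Omega_\pm$. For a function $f$ on $\Omega_+\cup\Omega_-$ let $\llbracket f\rrbracket=f_+|_{x_2=0}-f_-|_{x_2=0}$ be its jump (in the sense of traces). For a constant vector $\bar B\in\mathbb R^2$ consider the linearized system $$\partial_t\eta=v,\qquad \rho\,\partial_tv+\nabla q-\mu\Delta v-\bar B_l\bar B_m\partial_l\partial_m\eta=0,\qquad \operatorname{div}v=0\qquad\text{in }\Omega_\pm,$$ $$\llbracket v\rrbracket=0,\qquad \llbracket-\mu(Dv+Dv^T)+qI\rrbracket e_2=g[\rho]\,\eta_2e_2+\bar B_2\bar B_l\llbracket\partial_l\eta\rrbracket\quad\text{on }\{x_2=0\},\qquad v=0\ \text{ on }\{x_2=\pm1\}.$$ By a solution on $[0,T]$, $T>0$, we mean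 real-valued $(v,\eta,q)$ such that $v\in C^1([0,T];L^2(\Omega))\cap C([0,T];H^1(\Omega))$, $\eta\in C^1([0,T];L^2(\Omega))$, for every $t\in[0,T]$ the restrictions of $v(t),\eta(t)$ to $\Omega_\pm$ are in $H^2(\Omega_\pm)$, $\eta(t)\in H^1(\Omega)$, $q(t)$ has a locally integrable weak gradient in $\Omega_\pm$, $\partial_t\eta=v$ holds in $L^2(\Omega)$, and for every $t\in[0,T]$ the remaining equations hold almost everywhere and the jump and boundary conditions hold in the sense of traces. (Thus $\partial_tv(0)$ is determined by the initial data through the second equation.) The critical magnetic number $|B|_c\ge 0$ is defined by $$|B|_c^2=\sup_{0\ne\psi\in H^1_0((-1,1))}\frac{g[\rho]\,\psi(0)^2}{\int_{-1}^1|\psi'|^2\,dy}.$$ **Theorem 2.4.** Let $|B|>|B|_c$. There is a constant $C$, depending only on $g,\rho_\pm,\mu_\pm$ and $B$, such that for every $T>0$ the following holds; all norms are over $\Omega$. (i) Let $\bar B=(0,B)$. Every solution on $[0,T]$ satisfies, for all $t\in[0,T]$, $$\|\partial_tv(t)\|_{L^2}^2+\|v(t)\|_{L^2}^2+\|\partial_2v(t)\|_{L^2}^2+\int_0^t\|\partial_tv(s)\|_{H^1}^2\,ds\le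 C\big(\|\partial_tv(0)\|_{L^2}^2+\|v(0)\|_{L^2}^2+\|\partial_2v(0)\|_{L^2}^2\big).$$ If in addition $\eta(0,x_1,-1)=\eta(0,x_1,1)=0$, then for all $t\in[0,T]$ $$\|v(t)\|_{L^2}^2+\|\eta(t)\|_{L^2}^2+\|\partial_2\eta(t)\|_{L^2}^2+\int_0^t\|v(s)\|_{H^1}^2\,ds\le C\big(\|v(0)\|_{L^2}^2+\|\eta(0)\|_{L^2}^2+\|\partial_2\eta(0)\|_{L^2}^2\big).$$ (ii) Let $\bar B=(B,0)$. Every solution on $[0,T]$ satisfies, for all $t\in[0,T]$, $$\|\partial_tv(t)\|_{L^2}^2+\|\partial_1v_1(t)\|_{L^2}^2+\|v_2(t)\|_{H^1}^2+\int_0^t\|\partial_tv(s)\|_{H^1}^2\,ds\le C\big(\|\partial_tv(0)\|_{L^2}^2+\|\partial_1v_1(0)\|_{L^2}^2+\|v_2(0)\|_{H^1}^2\big).$$ If in addition $(\partial_1\eta_1+\partial_2\eta_2)(0)=0$, then for all $t\in[0,T]$ $$\|v(t)\|_{L^2}^2+\|\partial_1\eta_1(t)\|_{L^2}^2+\|\eta_2(t)\|_{H^1}^2+\int_0^t\|v(s)\|_{H^1}^2\,ds\le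 C\big(\|v(0)\|_{L^2}^2+\|\partial_1\eta_1(0)\|_{L^2}^2+\|\eta_2(0)\|_{H^1}^2\big).$$ -/

import Mathlib

open MeasureTheory Set
open scoped ContDiff ENNReal NNReal

noncomputable section

namespace RayleighTaylorMHD

/-- The horizontal strip `ℝ × (a, b)`; points are `x = (x₁, x₂)`, and the coordinate indices
`1, 2` of the mathematics are `0, 1 : Fin 2` below. -/
def strip (a b : ℝ) : Set (ℝ × ℝ) := Set.univ ×ˢ Set.Ioo a b

/-- `Ω = ℝ × (-1, 1)`. -/
def slab : Set (ℝ × ℝ) := strip (-1) 1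

/-- `Ω₊ = ℝ × (0, 1)`, occupied by the upper fluid. -/
def upper : Set (ℝ × ℝ) := strip 0 1

/-- `Ω₋ = ℝ × (-1, 0)`, occupied by the lower fluid. -/
def lower : Set (ℝ × ℝ) := strip (-1) 0

/-- The Hilbert space `L²(Ω)` of real functions. -/
abbrev L2 : Type := Lp ℝ 2 (volume.restrict slab)

/-- The coordinate directions `e₁ = (1, 0)`, `e₂ = (0, 1)`. -/
def dir (j : Fin 2) : ℝ × ℝ := if j = 0 then (1, 0) else (0, 1)

/-- The classical partial derivative `∂ⱼφ` (used for test functions). -/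
def classicalPartial (j : Fin 2) (φ : ℝ × ℝ → ℝ) (x : ℝ × ℝ) : ℝ := fderiv ℝ φ x (dir j)

/-- `φ` is smooth with compact support inside `V`. -/
structure IsTest (V : Set (ℝ × ℝ)) (φ : ℝ × ℝ → ℝ) : Prop where
  smooth : ContDiff ℝ ∞ φ
  compact : HasCompactSupport φ
  support : tsupport φ ⊆ V

/-- `g` is the weak partial derivative `∂ⱼf` on the open set `U`. -/
def HasWeakPartial (U : Set (ℝ × ℝ)) (j : Fin 2) (f g : ℝ × ℝ → ℝ) : Prop :=
  LocallyIntegrableOn f U ∧ LocallyIntegrableOn g U ∧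
    ∀ φ, IsTest U φ → ∫ x in U, f x * classicalPartial j φ x = -∫ x in U, g x * φ x

open Classical in
/-- The weak partial derivative `∂ⱼf` on `U`, which is unique almost everywhere in `U`
(and is used only where it exists). -/
def weakPartial (U : Set (ℝ × ℝ)) (j : Fin 2) (f : ℝ × ℝ → ℝ) : ℝ × ℝ → ℝ :=
  if h : ∃ g, HasWeakPartial U j f g then h.choose else 0

/-- `f ∈ H¹(U)`. -/
def MemH1 (U : Set (ℝ × ℝ)) (f : ℝ × ℝ → ℝ) : Prop :=
  MemLp f 2 (volume.restrict U) ∧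
    ∀ j, ∃ g, HasWeakPartial U j f g ∧ MemLp g 2 (volume.restrict U)

/-- `f ∈ H²(U)`. -/
def MemH2 (U : Set (ℝ × ℝ)) (f : ℝ × ℝ → ℝ) : Prop :=
  MemH1 U f ∧ ∀ j, MemH1 U (weakPartial U j f)

/-- `τ` is the trace on the lower side `{x₂ = a}` of the function `f` on the strip `ℝ × (a, b)`:
`f` and `∂₂f` are integrable up to the boundary, locally in `x₁`, and Green's formula with boundary
values `τ` holds against smooth functions that vanish near the upper side. -/
def HasLowerTrace (a b : ℝ) (f : ℝ × ℝ → ℝ) (τ : ℝ → ℝ) : Prop :=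
  LocallyIntegrable τ ∧ LocallyIntegrable f (volume.restrict (strip a b)) ∧
    ∃ g, HasWeakPartial (strip a b) 1 f g ∧ LocallyIntegrable g (volume.restrict (strip a b)) ∧
      ∀ φ, IsTest (Set.univ ×ˢ Set.Iio b) φ →
        ∫ x in strip a b, (f x * classicalPartial 1 φ x + g x * φ x) = -∫ s, τ s * φ (s, a)

/-- `τ` is the trace on the upper side `{x₂ = b}` of the function `f` on the strip `ℝ × (a, b)`. -/
def HasUpperTrace (a b : ℝ) (f : ℝ × ℝ → ℝ) (τ : ℝ → ℝ) : Prop :=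
  LocallyIntegrable τ ∧ LocallyIntegrable f (volume.restrict (strip a b)) ∧
    ∃ g, HasWeakPartial (strip a b) 1 f g ∧ LocallyIntegrable g (volume.restrict (strip a b)) ∧
      ∀ φ, IsTest (Set.univ ×ˢ Set.Ioi a) φ →
        ∫ x in strip a b, (f x * classicalPartial 1 φ x + g x * φ x) = ∫ s, τ s * φ (s, b)

/-- The interfacial jump: `J = f₊|_{x₂=0} - f₋|_{x₂=0}` almost everywhere on the interface, where
`f₊` is a function on `Ω₊` and `f₋` a function on `Ω₋`, both having a trace. -/
def HasJump (fp fm : ℝ × ℝ → ℝ) (J : ℝ → ℝ) : Prop :=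
  ∃ τp τm : ℝ → ℝ, HasLowerTrace 0 1 fp τp ∧ HasUpperTrace (-1) 0 fm τm ∧
    ∀ᵐ s : ℝ, J s = τp s - τm s

/-- The physical coefficients: gravity, the densities and the viscosities of the upper (`p`) and the
lower (`m`) fluid; all are positive and the upper fluid is the heavier one. -/
structure Coeffs where
  g : ℝ
  ρp : ℝ
  ρm : ℝ
  μp : ℝ
  μm : ℝ
  g_pos : 0 < g
  ρm_pos : 0 < ρm
  ρm_lt_ρp : ρm < ρp
  μp_pos : 0 < μp
  μm_pos : 0 < μm

/-- `g [ρ] = g (ρ₊ - ρ₋)`. -/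
def Coeffs.gJump (c : Coeffs) : ℝ := c.g * (c.ρp - c.ρm)

/-- `ψ ∈ H₀¹((-1, 1))` with weak derivative `dψ`: `ψ` is the primitive of a square integrable
function and vanishes at both end points. -/
structure IsH10 (ψ dψ : ℝ → ℝ) : Prop where
  memLp : MemLp dψ 2 (volume.restrict (Set.Ioo (-1) 1))
  primitive : ∀ y ∈ Set.Icc (-1 : ℝ) 1, ψ y = ∫ z in (-1 : ℝ)..y, dψ z
  right_end : ψ 1 = 0

/-- The critical magnetic number `|B|_c`, with
`|B|_c² = sup { g[ρ] ψ(0)² / ∫_{-1}^1 |ψ'|² : 0 ≠ ψ ∈ H₀¹((-1, 1)) }`. -/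
def criticalNumber (c : Coeffs) : ℝ :=
  Real.sqrt (sSup {r : ℝ | ∃ ψ dψ : ℝ → ℝ, IsH10 ψ dψ ∧
    (∃ y ∈ Set.Icc (-1 : ℝ) 1, ψ y ≠ 0) ∧
    r = c.gJump * ψ 0 ^ 2 / ∫ y in (-1 : ℝ)..1, dψ y ^ 2})

/-- The momentum equation
`ρ ∂ₜv + ∇q - μ Δv - B̄ₗ B̄ₘ ∂ₗ∂ₘ η = 0` almost everywhere in the phase `U` with constants `ρ, μ`. -/
def Momentum (U : Set (ℝ × ℝ)) (ρ μ : ℝ) (B : Fin 2 → ℝ) (vt v η : Fin 2 → ℝ × ℝ → ℝ)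
    (q : ℝ × ℝ → ℝ) : Prop :=
  ∀ i, ∀ᵐ x ∂(volume.restrict U),
    ρ * vt i x + weakPartial U i q x
      - μ * ∑ j, weakPartial U j (weakPartial U j (v i)) x
      - ∑ l, ∑ m, B l * B m * weakPartial U l (weakPartial U m (η i)) x = 0

/-- The `i`-th component of `(-μ (Dv + Dvᵀ) + q I) e₂` in the phase `U`. -/
def normalStress (U : Set (ℝ × ℝ)) (μ : ℝ) (v : Fin 2 → ℝ × ℝ → ℝ) (q : ℝ × ℝ → ℝ) (i : Fin 2) :
    ℝ × ℝ → ℝ :=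
  fun x => -μ * (weakPartial U 1 (v i) x + weakPartial U i (v 1) x) + (if i = 1 then q x else 0)

/-- The stress jump condition on the interface,
`⟦-μ (Dv + Dvᵀ) + q I⟧ e₂ = g[ρ] η₂ e₂ + B̄₂ B̄ₗ ⟦∂ₗη⟧`. -/
def StressJump (c : Coeffs) (B : Fin 2 → ℝ) (v η : Fin 2 → ℝ × ℝ → ℝ) (q : ℝ × ℝ → ℝ) : Prop :=
  ∃ e : ℝ → ℝ, HasLowerTrace 0 1 (η 1) e ∧
    ∀ i, ∃ J : Fin 2 → ℝ → ℝ,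
      (∀ l, HasJump (weakPartial upper l (η i)) (weakPartial lower l (η i)) (J l)) ∧
      HasJump (normalStress upper c.μp v q i) (normalStress lower c.μm v q i)
        (fun s => (if i = 1 then c.gJump * e s else 0) + B 1 * ∑ l, B l * J l s)

/-- The linearized system on `Ω` and the time interval `[0, T]`, with constant magnetic vector `B`,
for the velocity `v`, its time derivative `vt`, the (linearized) flow map `η` and the
pressure `q`. At all times `v` and `η` belong to `H¹(Ω)` and to `H²(Ω₊)`, `H²(Ω₋)`; the pressure has
weak gradients in `Ω₊` and in `Ω₋`, and no decay of `q` is asked for; in time,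
`v ∈ C¹([0, T]; L²(Ω)) ∩ C([0, T]; H¹(Ω))` and `η ∈ C¹([0, T]; L²(Ω))`. -/
structure IsSolution (c : Coeffs) (B : Fin 2 → ℝ) (T : ℝ) (v vt η : ℝ → Fin 2 → L2)
    (q : ℝ → ℝ × ℝ → ℝ) : Prop where
  /-- `vt = ∂ₜv` in `L²(Ω)` (one-sided at the ends), and it is continuous in time -/
  deriv_v : ∀ i, ∀ t ∈ Set.Icc 0 T,
    HasDerivWithinAt (fun s => v s i) (vt t i) (Set.Icc 0 T) t
  cont_vt : ∀ i, ContinuousOn (fun s => vt s i) (Set.Icc 0 T)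
  /-- `∂ₜη = v` -/
  deriv_η : ∀ i, ∀ t ∈ Set.Icc 0 T,
    HasDerivWithinAt (fun s => η s i) (v t i) (Set.Icc 0 T) t
  /-- `v ∈ C([0, T]; H¹(Ω))` -/
  grad_v : ∀ i j, ∃ D : ℝ → L2, ContinuousOn D (Set.Icc 0 T) ∧
    ∀ t ∈ Set.Icc 0 T, HasWeakPartial slab j (v t i) (D t)
  η_H1 : ∀ i, ∀ t ∈ Set.Icc 0 T, MemH1 slab (η t i)
  v_H2 : ∀ i, ∀ t ∈ Set.Icc 0 T, MemH2 upper (v t i) ∧ MemH2 lower (v t i)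
  η_H2 : ∀ i, ∀ t ∈ Set.Icc 0 T, MemH2 upper (η t i) ∧ MemH2 lower (η t i)
  grad_q : ∀ j, ∀ t ∈ Set.Icc 0 T,
    (∃ G, HasWeakPartial upper j (q t) G) ∧ (∃ G, HasWeakPartial lower j (q t) G)
  momentum : ∀ t ∈ Set.Icc 0 T,
    Momentum upper c.ρp c.μp B (fun i => vt t i) (fun i => v t i) (fun i => η t i) (q t) ∧
    Momentum lower c.ρm c.μm B (fun i => vt t i) (fun i => v t i) (fun i => η t i) (q t)
  /-- `div v = 0` -/
  div_v : ∀ t ∈ Set.Icc 0 T, ∀ᵐ x ∂(volume.restrict slab),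
    weakPartial slab 0 (v t 0) x + weakPartial slab 1 (v t 1) x = 0
  /-- `⟦v⟧ = 0` -/
  jump_v : ∀ i, ∀ t ∈ Set.Icc 0 T, HasJump (v t i) (v t i) 0
  jump_stress : ∀ t ∈ Set.Icc 0 T,
    StressJump c B (fun i => v t i) (fun i => η t i) (q t)
  /-- no slip at `x₂ = -1` and at `x₂ = 1` -/
  no_slip : ∀ i, ∀ t ∈ Set.Icc 0 T,
    HasLowerTrace (-1) 1 (v t i) 0 ∧ HasUpperTrace (-1) 1 (v t i) 0

/-- `‖f‖²_{L²(Ω)}`. -/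
def l2Sq (f : ℝ × ℝ → ℝ) : ℝ≥0∞ := eLpNorm f 2 (volume.restrict slab) ^ 2

open Classical in
/-- `‖∂ⱼf‖²_{L²(Ω)}`, infinite if `f` has no weak derivative `∂ⱼf` on `Ω`. -/
def partialSq (j : Fin 2) (f : ℝ × ℝ → ℝ) : ℝ≥0∞ :=
  if ∃ g, HasWeakPartial slab j f g then l2Sq (weakPartial slab j f) else ⊤

/-- `‖f‖²_{H¹(Ω)} = ‖f‖²_{L²} + ‖∂₁f‖²_{L²} + ‖∂₂f‖²_{L²}`, infinite if `f ∉ H¹(Ω)`. -/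
def h1Sq (f : ℝ × ℝ → ℝ) : ℝ≥0∞ := l2Sq f + ∑ j, partialSq j f

/-- The quantity `‖w‖²_{L²} + ‖u‖²_{L²} + ‖∂₂u‖²_{L²}` for vector fields `w, u`. -/
def verticalEnergy (w u : Fin 2 → L2) : ℝ≥0∞ :=
  ∑ i, l2Sq (w i) + ∑ i, l2Sq (u i) + ∑ i, partialSq 1 (u i)

/-- The quantity `‖w‖²_{L²} + ‖∂₁u₁‖²_{L²} + ‖u₂‖²_{H¹}` for vector fields `w, u`. -/
def horizontalEnergy (w u : Fin 2 → L2) : ℝ≥0∞ :=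
  ∑ i, l2Sq (w i) + partialSq 0 (u 0) + h1Sq (u 1)

/-- `∫₀ᵗ ‖w(s)‖²_{H¹(Ω)} ds` for a time dependent vector field `w`. -/
def dissipation (w : ℝ → Fin 2 → L2) (t : ℝ) : ℝ≥0∞ :=
  ∫⁻ s in Set.Icc 0 t, ∑ i, h1Sq (w s i)

end RayleighTaylorMHD

end

/-!
Test the momentum equation with `curl ψ`: the pressure disappears, the stress jump produces the
interfacial gravity term, and one obtains `m(∂ₜv, w) + a(v, w) + k(η, w) = 0` with the inertia
form `m`, the viscous form `a` and the potential
`k(η, w) = ∫ (B · ∇η) · (B · ∇w) - g[ρ] ∫ η₂ w₂ dx₁`. By density it holds for all `w` in the `H¹`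
closure of the curls, which contains every divergence free field with zero trace, so that one may
take `w = v`. If `|B|` exceeds the critical number, then `k` is coercive there for the seminorm in
the asserted energy.

The displacement need not lie in that closure, but its increment `η(t) - η(0)` does, being the time
integral of `v`. Hence the conserved balance `½ m(v, v) + ½ k(η, η) + ∫ a(v, v)` controls
`η(t) - η(0)`, and then `η(t)`, by the data. Difference quotients in time of a solution satisfy the
same weak form, so the same bound holds for them and passes to the limit `(∂ₜv, v)`.
-/

open MeasureTheory Set Filter Topology
open scoped ContDiff ENNReal NNReal Convolution

noncomputable section

namespace RayleighTaylorMHD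

lemma isOpen_strip (a b : ℝ) : IsOpen (strip a b) := isOpen_univ.prod isOpen_Ioo

lemma measurableSet_strip (a b : ℝ) : MeasurableSet (strip a b) := (isOpen_strip a b).measurableSet

lemma mem_strip {a b : ℝ} {x : ℝ × ℝ} : x ∈ strip a b ↔ a < x.2 ∧ x.2 < b := by
  simp [strip]

lemma upper_subset_slab : upper ⊆ slab := fun x hx => by
  have := mem_strip.1 hx
  exact mem_strip.2 ⟨by linarith, by linarith⟩

lemma lower_subset_slab : lower ⊆ slab := fun x hx => by
  have := mem_strip.1 hx
  exact mem_strip.2 ⟨by linarith, by linarith⟩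

lemma measurableSet_slab : MeasurableSet slab := measurableSet_strip _ _

lemma IsTest.mono {U V : Set (ℝ × ℝ)} {φ : ℝ × ℝ → ℝ} (h : IsTest U φ) (hUV : U ⊆ V) :
    IsTest V φ := ⟨h.smooth, h.compact, h.support.trans hUV⟩

lemma contDiff_classicalPartial {φ : ℝ × ℝ → ℝ} (h : ContDiff ℝ ∞ φ) (j : Fin 2) :
    ContDiff ℝ ∞ (classicalPartial j φ) := by
  unfold classicalPartial
  exact (h.fderiv_right (m := ∞) (by simp)).clm_apply contDiff_const

lemma tsupport_classicalPartial_subset (φ : ℝ × ℝ → ℝ) (j : Fin 2) :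
    tsupport (classicalPartial j φ) ⊆ tsupport φ := by
  unfold classicalPartial
  exact tsupport_fderiv_apply_subset ℝ _

lemma IsTest.partial {U : Set (ℝ × ℝ)} {φ : ℝ × ℝ → ℝ} (h : IsTest U φ) (j : Fin 2) :
    IsTest U (classicalPartial j φ) where
  smooth := contDiff_classicalPartial h.smooth j
  compact := h.compact.of_isClosed_subset (isClosed_tsupport _)
    (tsupport_classicalPartial_subset φ j)
  support := (tsupport_classicalPartial_subset φ j).trans h.support

lemma IsTest.neg {U : Set (ℝ × ℝ)} {φ : ℝ × ℝ → ℝ} (h : IsTest U φ) :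
    IsTest U (fun x => -φ x) := by
  refine ⟨h.smooth.neg, h.compact.neg, ?_⟩
  have : tsupport (fun x => -φ x) = tsupport φ := by
    simp [tsupport]
  rw [this]; exact h.support

lemma IsTest.add {U : Set (ℝ × ℝ)} {φ ψ : ℝ × ℝ → ℝ} (h : IsTest U φ) (h' : IsTest U ψ) :
    IsTest U (fun x => φ x + ψ x) :=
  ⟨h.smooth.add h'.smooth, h.compact.add h'.compact,
    (tsupport_add φ ψ).trans (union_subset h.support h'.support)⟩

lemma IsTest.const_mul {U : Set (ℝ × ℝ)} {φ : ℝ × ℝ → ℝ} (h : IsTest U φ) (c : ℝ) :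
    IsTest U (fun x => c * φ x) :=
  ⟨contDiff_const.mul h.smooth, h.compact.mul_left,
    (tsupport_mul_subset_right (f := fun _ => c) (g := φ)).trans h.support⟩

lemma isTest_zero (U : Set (ℝ × ℝ)) : IsTest U (fun _ => 0) where
  smooth := contDiff_const
  compact := HasCompactSupport.zero
  support := by simp [tsupport, Function.support_fun_zero]

lemma IsTest.mul_left {U V : Set (ℝ × ℝ)} {χ φ : ℝ × ℝ → ℝ} (h : IsTest U φ)
    (hχ : ContDiff ℝ ∞ χ) (hV : U ∩ tsupport χ ⊆ V) : IsTest V (fun x => χ x * φ x) := by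
  refine ⟨hχ.mul h.smooth, h.compact.mul_left, fun x hx => hV ⟨?_, ?_⟩⟩
  · exact h.support (tsupport_mul_subset_right (f := χ) (g := φ) hx)
  · exact tsupport_mul_subset_left (f := χ) (g := φ) hx

lemma classicalPartial_comm {φ : ℝ × ℝ → ℝ} (h : ContDiff ℝ ∞ φ) (i j : Fin 2) (x : ℝ × ℝ) :
    classicalPartial i (classicalPartial j φ) x = classicalPartial j (classicalPartial i φ) x := by
  have hd : Differentiable ℝ (fderiv ℝ φ) :=
    (h.fderiv_right (m := ∞) (by simp)).differentiable (by simp)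
  have key : ∀ i j, classicalPartial i (classicalPartial j φ) x
      = fderiv ℝ (fderiv ℝ φ) x (dir i) (dir j) := by
    intro i j
    have : fderiv ℝ (fun y => fderiv ℝ φ y (dir j)) x
        = (fderiv ℝ (fderiv ℝ φ) x).flip (dir j) := by
      rw [fderiv_clm_apply (hd x) (differentiableAt_const _)]
      simp
    simp only [classicalPartial]
    change fderiv ℝ (fun y => fderiv ℝ φ y (dir j)) x (dir i) = _
    rw [this]; rfl
  rw [key, key]
  have hs : IsSymmSndFDerivAt ℝ φ x :=
    h.contDiffAt.isSymmSndFDerivAt (by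
      rw [minSmoothness_of_isRCLikeNormedField]
      exact WithTop.coe_le_coe.2 (le_top : (2 : ℕ∞) ≤ ⊤))
  exact hs.eq _ _

lemma classicalPartial_mul {f g : ℝ × ℝ → ℝ} {x : ℝ × ℝ} (hf : DifferentiableAt ℝ f x)
    (hg : DifferentiableAt ℝ g x) (j : Fin 2) :
    classicalPartial j (fun y => f y * g y) x
      = f x * classicalPartial j g x + classicalPartial j f x * g x := by
  simp only [classicalPartial]
  rw [fderiv_fun_mul hf hg]
  simp [mul_comm]

lemma classicalPartial_add {f g : ℝ × ℝ → ℝ} {x : ℝ × ℝ} (hf : DifferentiableAt ℝ f x)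
    (hg : DifferentiableAt ℝ g x) (j : Fin 2) :
    classicalPartial j (fun y => f y + g y) x
      = classicalPartial j f x + classicalPartial j g x := by
  simp only [classicalPartial]
  rw [fderiv_fun_add hf hg]
  simp

lemma classicalPartial_neg (f : ℝ × ℝ → ℝ) (x : ℝ × ℝ) (j : Fin 2) :
    classicalPartial j (fun y => -f y) x = -classicalPartial j f x := by
  simp only [classicalPartial]
  rw [fderiv_fun_neg]
  simp

lemma classicalPartial_const_mul (c : ℝ) {f : ℝ × ℝ → ℝ} {x : ℝ × ℝ}
    (hf : DifferentiableAt ℝ f x) (j : Fin 2) :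
    classicalPartial j (fun y => c * f y) x = c * classicalPartial j f x := by
  simp only [classicalPartial]
  rw [fderiv_const_mul hf]
  simp

lemma classicalPartial_snd {χ : ℝ → ℝ} (hχ : Differentiable ℝ χ) (x : ℝ × ℝ) (j : Fin 2) :
    classicalPartial j (fun y => χ y.2) x = if j = 0 then 0 else deriv χ x.2 := by
  have h : HasFDerivAt (fun y : ℝ × ℝ => χ y.2)
      ((ContinuousLinearMap.toSpanSingleton ℝ (deriv χ x.2)).comp
        (ContinuousLinearMap.snd ℝ ℝ ℝ)) x :=
    (hχ x.2).hasDerivAt.hasFDerivAt.comp x hasFDerivAt_snd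
  simp only [classicalPartial, h.fderiv]
  fin_cases j <;> simp [dir]

/-! ### Integrability against test functions -/

lemma IsTest.integrable_mul {V : Set (ℝ × ℝ)} {φ : ℝ × ℝ → ℝ} (h : IsTest V φ)
    {μ : Measure (ℝ × ℝ)} {f : ℝ × ℝ → ℝ} (hf : LocallyIntegrable f μ) :
    Integrable (fun x => f x * φ x) μ := by
  have := hf.integrable_smul_left_of_hasCompactSupport h.smooth.continuous h.compact
  simpa [mul_comm] using this

lemma IsTest.integrable_mul_on {U : Set (ℝ × ℝ)} {φ : ℝ × ℝ → ℝ} (h : IsTest U φ)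
    {f : ℝ × ℝ → ℝ} (hf : LocallyIntegrableOn f U) :
    IntegrableOn (fun x => f x * φ x) U := by
  have h1 : IntegrableOn (fun x => f x * φ x) (tsupport φ) :=
    (hf.integrableOn_compact_subset h.support h.compact).mul_continuousOn
      h.smooth.continuous.continuousOn h.compact
  have h2 : IntegrableOn (fun x => f x * φ x) univ :=
    h1.of_forall_sdiff_eq_zero MeasurableSet.univ (fun x hx => by
      rw [image_eq_zero_of_notMem_tsupport hx.2, mul_zero])
  exact h2.mono_set (subset_univ _)

lemma IsTest.memLp {V : Set (ℝ × ℝ)} {φ : ℝ × ℝ → ℝ} (h : IsTest V φ) (p : ℝ≥0∞)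
    (μ : Measure (ℝ × ℝ)) [IsFiniteMeasureOnCompacts μ] : MemLp φ p μ :=
  h.smooth.continuous.memLp_of_hasCompactSupport h.compact

lemma locallyIntegrableOn_of_restrict {f : ℝ × ℝ → ℝ} {U : Set (ℝ × ℝ)} (hU : IsOpen U)
    (hf : LocallyIntegrable f (volume.restrict U)) : LocallyIntegrableOn f U := by
  rw [locallyIntegrableOn_iff hU.isLocallyClosed]
  intro k hkU hk
  have := hf.integrableOn_isCompact hk
  rwa [IntegrableOn, Measure.restrict_restrict hk.measurableSet,
    inter_eq_left.2 hkU] at this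

/-! ### Weak derivatives -/

lemma HasWeakPartial.unique {U : Set (ℝ × ℝ)} (hU : IsOpen U) {j : Fin 2}
    {f g g' : ℝ × ℝ → ℝ} (h : HasWeakPartial U j f g) (h' : HasWeakPartial U j f g') :
    g =ᵐ[volume.restrict U] g' := by
  have hl : LocallyIntegrableOn (fun x => g x - g' x) U := h.2.1.sub h'.2.1
  have := hU.ae_eq_zero_of_integral_contDiff_smul_eq_zero hl (fun φ h1 h2 h3 => by
    have ht : IsTest U φ := ⟨h1, h2, h3⟩
    have e1 := h.2.2 φ ht
    have e2 := h'.2.2 φ ht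
    have i1 := ht.integrable_mul_on h.2.1
    have i2 := ht.integrable_mul_on h'.2.1
    have e3 : ∫ x in U, (g x * φ x - g' x * φ x) = 0 := by
      rw [integral_sub i1 i2]; linarith
    rw [← e3, ← setIntegral_eq_integral_of_forall_compl_eq_zero (s := U)]
    · congr 1; ext x; simp; ring
    · intro x hx
      rw [image_eq_zero_of_notMem_tsupport (fun hx' => hx (h3 hx')), zero_smul])
  rw [EventuallyEq, ae_restrict_iff' hU.measurableSet]
  filter_upwards [this] with x hx hxU
  have := hx hxU; linarith

lemma locallyIntegrableOn_congr_ae {U : Set (ℝ × ℝ)} {u u' : ℝ × ℝ → ℝ}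
    (hu : LocallyIntegrableOn u U) (h : u =ᵐ[volume.restrict U] u') :
    LocallyIntegrableOn u' U := fun x hx => by
  obtain ⟨s, hs, hi⟩ := hu x hx
  refine ⟨s ∩ U, inter_mem hs self_mem_nhdsWithin, ?_⟩
  exact (hi.mono_set inter_subset_left).congr
    (ae_mono (Measure.restrict_mono inter_subset_right le_rfl) h)

lemma HasWeakPartial.congr {U : Set (ℝ × ℝ)} {j : Fin 2}
    {f f' g g' : ℝ × ℝ → ℝ} (h : HasWeakPartial U j f g)
    (hf : f =ᵐ[volume.restrict U] f') (hg : g =ᵐ[volume.restrict U] g') :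
    HasWeakPartial U j f' g' := by
  refine ⟨locallyIntegrableOn_congr_ae h.1 hf, locallyIntegrableOn_congr_ae h.2.1 hg,
    fun φ hφ => ?_⟩
  calc ∫ x in U, f' x * classicalPartial j φ x
      = ∫ x in U, f x * classicalPartial j φ x :=
        integral_congr_ae (hf.mono fun x hx => by simp only [hx])
    _ = -∫ x in U, g x * φ x := h.2.2 φ hφ
    _ = -∫ x in U, g' x * φ x :=
        congrArg Neg.neg (integral_congr_ae (hg.mono fun x hx => by simp only [hx]))

lemma HasWeakPartial.mono {U V : Set (ℝ × ℝ)} (hVU : V ⊆ U)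
    (hU : MeasurableSet U) {j : Fin 2}
    {f g : ℝ × ℝ → ℝ} (h : HasWeakPartial U j f g) : HasWeakPartial V j f g := by
  refine ⟨h.1.mono_set hVU, h.2.1.mono_set hVU, fun φ hφ => ?_⟩
  have e := h.2.2 φ (hφ.mono hVU)
  have hz : ∀ (u : ℝ × ℝ → ℝ) (χ : ℝ × ℝ → ℝ), IsTest V χ →
      ∫ x in V, u x * χ x = ∫ x in U, u x * χ x := by
    intro u χ hχ
    refine (setIntegral_eq_of_subset_of_forall_sdiff_eq_zero hU hVU fun x hx => ?_).symm
    rw [image_eq_zero_of_notMem_tsupport (fun hx' => hx.2 (hχ.support hx')), mul_zero]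
  rw [hz f _ (hφ.partial j), hz g _ hφ, e]

lemma HasWeakPartial.spec {U : Set (ℝ × ℝ)} {j : Fin 2} {f g : ℝ × ℝ → ℝ}
    (h : HasWeakPartial U j f g) : HasWeakPartial U j f (weakPartial U j f) := by
  have hex : ∃ g, HasWeakPartial U j f g := ⟨g, h⟩
  unfold weakPartial
  rw [dif_pos hex]
  exact hex.choose_spec

lemma HasWeakPartial.weakPartial_ae {U : Set (ℝ × ℝ)} (hU : IsOpen U) {j : Fin 2}
    {f g : ℝ × ℝ → ℝ} (h : HasWeakPartial U j f g) :
    weakPartial U j f =ᵐ[volume.restrict U] g := h.spec.unique hU h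

lemma MemH1.hasWeakPartial {U : Set (ℝ × ℝ)} {f : ℝ × ℝ → ℝ} (h : MemH1 U f) (j : Fin 2) :
    HasWeakPartial U j f (weakPartial U j f) := by
  obtain ⟨g, hg, -⟩ := h.2 j
  exact hg.spec

lemma MemH1.memLp_weakPartial {U : Set (ℝ × ℝ)} (hU : IsOpen U) {f : ℝ × ℝ → ℝ}
    (h : MemH1 U f) (j : Fin 2) : MemLp (weakPartial U j f) 2 (volume.restrict U) := by
  obtain ⟨g, hg, hg2⟩ := h.2 j
  exact (memLp_congr_ae (hg.weakPartial_ae hU)).2 hg2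

lemma HasWeakPartial.add {U : Set (ℝ × ℝ)} {j : Fin 2}
    {f g f' g' : ℝ × ℝ → ℝ}
    (h : HasWeakPartial U j f g) (h' : HasWeakPartial U j f' g') :
    HasWeakPartial U j (fun x => f x + f' x) (fun x => g x + g' x) := by
  refine ⟨h.1.add h'.1, h.2.1.add h'.2.1, fun φ hφ => ?_⟩
  simp only [add_mul]
  rw [integral_add ((hφ.partial j).integrable_mul_on h.1)
      ((hφ.partial j).integrable_mul_on h'.1),
    integral_add (hφ.integrable_mul_on h.2.1) (hφ.integrable_mul_on h'.2.1),
    h.2.2 φ hφ, h'.2.2 φ hφ]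
  ring

lemma HasWeakPartial.const_mul {U : Set (ℝ × ℝ)} (c : ℝ) {j : Fin 2} {f g : ℝ × ℝ → ℝ}
    (h : HasWeakPartial U j f g) : HasWeakPartial U j (fun x => c * f x) (fun x => c * g x) := by
  refine ⟨h.1.smul c, h.2.1.smul c, fun φ hφ => ?_⟩
  simp only [mul_assoc, integral_const_mul, h.2.2 φ hφ, mul_neg]

lemma HasWeakPartial.comm {U : Set (ℝ × ℝ)} {i j : Fin 2} {f fi fj g : ℝ × ℝ → ℝ}
    (hi : HasWeakPartial U i f fi) (hj : HasWeakPartial U j f fj)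
    (hg : HasWeakPartial U j fi g) : HasWeakPartial U i fj g := by
  refine ⟨hj.2.1, hg.2.1, fun φ hφ => ?_⟩
  rw [← hg.2.2 φ hφ]
  have e1 := hi.2.2 _ (hφ.partial j)
  have e2 := hj.2.2 _ (hφ.partial i)
  have e3 : ∫ x in U, f x * classicalPartial i (classicalPartial j φ) x
      = ∫ x in U, f x * classicalPartial j (classicalPartial i φ) x := by
    simp only [classicalPartial_comm hφ.smooth i j]
  linarith

/-! ### Testing horizontal derivatives up to the horizontal boundary -/

lemma exists_seq_contDiff_tendsto_one {a b : ℝ} (hab : a < b) :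
    ∃ χ : ℕ → ℝ → ℝ, (∀ n, ContDiff ℝ ∞ (χ n)) ∧ (∀ n, tsupport (χ n) ⊆ Ioo a b) ∧
      (∀ n y, |χ n y| ≤ 1) ∧ ∀ y ∈ Ioo a b, Tendsto (fun n => χ n y) atTop (𝓝 1) := by
  set r : ℝ := (b - a) / 2 with hr
  have hr0 : 0 < r := by rw [hr]; linarith
  have hn : ∀ n : ℕ, (0 : ℝ) < 1 / ((n : ℝ) + 3) := fun n => by positivity
  have hn1 : ∀ n : ℕ, 1 / ((n : ℝ) + 3) ≤ 1 / 3 := fun n => by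
    apply one_div_le_one_div_of_le <;> linarith [n.cast_nonneg (α := ℝ)]
  have ball_eq : Metric.ball ((a + b) / 2) r = Ioo a b := by
    rw [Real.ball_eq_Ioo]; congr 1 <;> rw [hr] <;> ring
  let β : ℕ → ContDiffBump ((a + b) / 2) := fun n =>
    { rIn := r * (1 - 2 * (1 / ((n : ℝ) + 3)))
      rOut := r * (1 - 1 / ((n : ℝ) + 3))
      rIn_pos := mul_pos hr0 (by linarith [hn1 n])
      rIn_lt_rOut := mul_lt_mul_of_pos_left (by linarith [hn n]) hr0 }
  refine ⟨fun n => β n, fun n => (β n).contDiff, fun n => ?_, fun n y => ?_, fun y hy => ?_⟩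
  · rw [(β n).tsupport_eq, ← ball_eq]
    refine Metric.closedBall_subset_ball ?_
    change r * (1 - 1 / ((n : ℝ) + 3)) < r
    nlinarith [hn n]
  · rw [abs_of_nonneg (β n).nonneg]
    exact (β n).le_one
  · have hlim : Tendsto (fun n : ℕ => r * (1 - 2 * (1 / ((n : ℝ) + 3)))) atTop
        (𝓝 (r * (1 - 2 * 0))) := by
      have : Tendsto (fun n : ℕ => 1 / ((n : ℝ) + 3)) atTop (𝓝 0) :=
        tendsto_const_nhds.div_atTop
          (tendsto_atTop_add_const_right _ _ tendsto_natCast_atTop_atTop)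
      exact (tendsto_const_nhds.sub (this.const_mul 2)).const_mul r
    rw [← ball_eq, Metric.mem_ball] at hy
    refine tendsto_const_nhds.congr' ?_
    filter_upwards [hlim.eventually (lt_mem_nhds (by simpa using hy))] with n hn'
    exact ((β n).one_of_mem_closedBall (Metric.mem_closedBall.2 hn'.le)).symm

lemma tendsto_integral_mul_of_tendsto_one {α : Type*} [MeasurableSpace α] {μ : Measure α}
    {f : α → ℝ} (hf : Integrable f μ) {χ : ℕ → α → ℝ} (hχ : ∀ n, AEStronglyMeasurable (χ n) μ)
    (hbound : ∀ n x, |χ n x| ≤ 1) (hlim : ∀ᵐ x ∂μ, Tendsto (fun n => χ n x) atTop (𝓝 1)) :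
    Tendsto (fun n => ∫ x, χ n x * f x ∂μ) atTop (𝓝 (∫ x, f x ∂μ)) := by
  refine tendsto_integral_of_dominated_convergence (fun x => ‖f x‖)
    (fun n => (hχ n).mul hf.aestronglyMeasurable) hf.norm (fun n => ae_of_all _ fun x => ?_) ?_
  · rw [norm_mul]
    exact mul_le_of_le_one_left (norm_nonneg _) (hbound n x)
  · filter_upwards [hlim] with x hx
    simpa using hx.mul_const (f x)

lemma HasWeakPartial.integral_horizontal {a b : ℝ} (hab : a < b) {f g φ : ℝ × ℝ → ℝ}
    (h : HasWeakPartial (strip a b) 0 f g)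
    (hf : LocallyIntegrable f (volume.restrict (strip a b)))
    (hg : LocallyIntegrable g (volume.restrict (strip a b))) (hφ : IsTest univ φ) :
    ∫ x in strip a b, f x * classicalPartial 0 φ x = -∫ x in strip a b, g x * φ x := by
  obtain ⟨χ, hχs, hχt, hχ1, hχl⟩ := exists_seq_contDiff_tendsto_one hab
  have hcd : ∀ n, ContDiff ℝ ∞ (fun x : ℝ × ℝ => χ n x.2) := fun n => (hχs n).comp contDiff_snd
  have htest : ∀ n, IsTest (strip a b) (fun x => χ n x.2 * φ x) := fun n =>
    hφ.mul_left (hcd n) fun x hx =>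
      ⟨mem_univ _, hχt n (tsupport_comp_subset_preimage (χ n) continuous_snd hx.2)⟩
  have hpart : ∀ n x, classicalPartial 0 (fun x => χ n x.2 * φ x) x
      = χ n x.2 * classicalPartial 0 φ x := fun n x => by
    rw [classicalPartial_mul ((hcd n).differentiable (by simp) x)
      (hφ.smooth.differentiable (by simp) x),
      classicalPartial_snd ((hχs n).differentiable (by simp))]
    simp
  have hlim : ∀ {F : ℝ × ℝ → ℝ}, IntegrableOn F (strip a b) →
      Tendsto (fun n => ∫ x in strip a b, χ n x.2 * F x) atTop (𝓝 (∫ x in strip a b, F x)) :=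
    fun hF => tendsto_integral_mul_of_tendsto_one hF
      (fun n => (hcd n).continuous.aestronglyMeasurable) (fun n x => hχ1 n x.2)
      (by filter_upwards [ae_restrict_mem (measurableSet_strip a b)] with x hx
          exact hχl x.2 hx.2)
  refine tendsto_nhds_unique (hlim ((hφ.partial 0).integrable_mul hf))
    ((hlim (hφ.integrable_mul hg)).neg.congr fun n => ?_)
  have := h.2.2 _ (htest n)
  simp only [hpart, mul_left_comm _ (χ n _)] at this
  exact this.symm

/-! ### The weak form of the linearized system -/

/-- The pairing `∫_U f g`. -/
def pair (U : Set (ℝ × ℝ)) (f g : ℝ × ℝ → ℝ) : ℝ := ∫ x in U, f x * g x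

lemma pair_congr_left {U : Set (ℝ × ℝ)} {f f' : ℝ × ℝ → ℝ} (h : f =ᵐ[volume.restrict U] f')
    (g : ℝ × ℝ → ℝ) : pair U f g = pair U f' g :=
  integral_congr_ae (by filter_upwards [h] with x hx; rw [hx])

lemma pair_const_mul_left (U : Set (ℝ × ℝ)) (c : ℝ) (f g : ℝ × ℝ → ℝ) :
    pair U (fun x => c * f x) g = c * pair U f g := by
  simp [pair, mul_assoc, integral_const_mul]

lemma pair_add_left {U V : Set (ℝ × ℝ)} {f f' φ : ℝ × ℝ → ℝ} (hφ : IsTest V φ)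
    (hf : LocallyIntegrable f (volume.restrict U))
    (hf' : LocallyIntegrable f' (volume.restrict U)) :
    pair U (fun x => f x + f' x) φ = pair U f φ + pair U f' φ := by
  simp only [pair, add_mul]
  exact integral_add (hφ.integrable_mul hf) (hφ.integrable_mul hf')

lemma pair_sum_left {U V : Set (ℝ × ℝ)} {ι : Type*} (s : Finset ι) {f : ι → ℝ × ℝ → ℝ}
    {φ : ℝ × ℝ → ℝ} (hφ : IsTest V φ)
    (hf : ∀ i ∈ s, LocallyIntegrable (f i) (volume.restrict U)) :
    pair U (fun x => ∑ i ∈ s, f i x) φ = ∑ i ∈ s, pair U (f i) φ := by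
  simp only [pair, Finset.sum_mul]
  exact integral_finsetSum s fun i hi => hφ.integrable_mul (hf i hi)

lemma pair_weakPartial_congr {U V : Set (ℝ × ℝ)} (hU : IsOpen U) (hUV : U ⊆ V)
    (hV : MeasurableSet V) {j : Fin 2} {f g : ℝ × ℝ → ℝ} (h : HasWeakPartial V j f g)
    (φ : ℝ × ℝ → ℝ) : pair U (weakPartial U j f) φ = pair U g φ :=
  pair_congr_left ((h.mono hUV hV).weakPartial_ae hU) φ

/-- The stream function field `(∂₂ψ, -∂₁ψ)`, which is divergence free. -/
def curl (ψ : ℝ × ℝ → ℝ) : Fin 2 → ℝ × ℝ → ℝ :=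
  ![classicalPartial 1 ψ, fun x => -classicalPartial 0 ψ x]

lemma IsTest.curl {U : Set (ℝ × ℝ)} {ψ : ℝ × ℝ → ℝ} (h : IsTest U ψ) (i : Fin 2) :
    IsTest U (curl ψ i) := by
  fin_cases i
  · exact h.partial 1
  · exact (h.partial 0).neg

lemma div_curl {ψ : ℝ × ℝ → ℝ} (h : ContDiff ℝ ∞ ψ) (x : ℝ × ℝ) :
    classicalPartial 0 (curl ψ 0) x + classicalPartial 1 (curl ψ 1) x = 0 := by
  change classicalPartial 0 (classicalPartial 1 ψ) x
    + classicalPartial 1 (fun y => -classicalPartial 0 ψ y) x = 0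
  rw [classicalPartial_neg, classicalPartial_comm h]
  ring

/-- `f ∈ W^{1,1}` locally up to the boundary of `U`: this is the regularity under which Green's
formula on a strip makes sense without any decay at infinity. -/
structure MemW11Loc (U : Set (ℝ × ℝ)) (f : ℝ × ℝ → ℝ) : Prop where
  locallyIntegrable : LocallyIntegrable f (volume.restrict U)
  hasWeakPartial : ∀ j, HasWeakPartial U j f (weakPartial U j f)
  locallyIntegrable_partial : ∀ j, LocallyIntegrable (weakPartial U j f) (volume.restrict U)

lemma MemH1.memW11Loc {U : Set (ℝ × ℝ)} (hU : IsOpen U) {f : ℝ × ℝ → ℝ} (h : MemH1 U f) :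
    MemW11Loc U f where
  locallyIntegrable := h.1.locallyIntegrable one_le_two
  hasWeakPartial := h.hasWeakPartial
  locallyIntegrable_partial j := (h.memLp_weakPartial hU j).locallyIntegrable one_le_two

lemma MemW11Loc.add {U : Set (ℝ × ℝ)} (hU : IsOpen U) {f f' : ℝ × ℝ → ℝ} (h : MemW11Loc U f)
    (h' : MemW11Loc U f') : MemW11Loc U (fun x => f x + f' x) where
  locallyIntegrable := h.locallyIntegrable.add h'.locallyIntegrable
  hasWeakPartial j := ((h.hasWeakPartial j).add (h'.hasWeakPartial j)).spec
  locallyIntegrable_partial j :=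
    ((h.locallyIntegrable_partial j).add (h'.locallyIntegrable_partial j)).congr
      (((h.hasWeakPartial j).add (h'.hasWeakPartial j)).weakPartial_ae hU).symm

lemma MemW11Loc.const_mul {U : Set (ℝ × ℝ)} (hU : IsOpen U) (c : ℝ) {f : ℝ × ℝ → ℝ}
    (h : MemW11Loc U f) : MemW11Loc U (fun x => c * f x) where
  locallyIntegrable := h.locallyIntegrable.smul c
  hasWeakPartial j := ((h.hasWeakPartial j).const_mul c).spec
  locallyIntegrable_partial j := ((h.locallyIntegrable_partial j).smul c).congr
    (((h.hasWeakPartial j).const_mul c).weakPartial_ae hU).symm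

/-- The boundary functional `∫_U (f ∂₂φ + ∂₂f φ)`, that is `∫_{∂U} f φ n₂` with the outer normal
`n`. The traces of the statement are characterised through it. -/
def boundaryTerm (U : Set (ℝ × ℝ)) (f φ : ℝ × ℝ → ℝ) : ℝ :=
  pair U f (classicalPartial 1 φ) + pair U (weakPartial U 1 f) φ

lemma boundaryTerm_add {U V : Set (ℝ × ℝ)} (hU : IsOpen U) {f f' φ : ℝ × ℝ → ℝ}
    (hφ : IsTest V φ) (hf : MemW11Loc U f) (hf' : MemW11Loc U f') :
    boundaryTerm U (fun x => f x + f' x) φ = boundaryTerm U f φ + boundaryTerm U f' φ := by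
  rw [boundaryTerm, pair_add_left (hφ.partial 1) hf.locallyIntegrable hf'.locallyIntegrable,
    pair_congr_left (((hf.hasWeakPartial 1).add (hf'.hasWeakPartial 1)).weakPartial_ae hU),
    pair_add_left hφ (hf.locallyIntegrable_partial 1) (hf'.locallyIntegrable_partial 1),
    boundaryTerm, boundaryTerm]
  ring

lemma boundaryTerm_const_mul {U : Set (ℝ × ℝ)} (hU : IsOpen U) (c : ℝ) {f : ℝ × ℝ → ℝ}
    (hf : MemW11Loc U f) (φ : ℝ × ℝ → ℝ) :
    boundaryTerm U (fun x => c * f x) φ = c * boundaryTerm U f φ := by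
  rw [boundaryTerm, pair_const_mul_left,
    pair_congr_left (((hf.hasWeakPartial 1).const_mul c).weakPartial_ae hU),
    pair_const_mul_left, boundaryTerm]
  ring

lemma MemW11Loc.pair_weakPartial {a b : ℝ} (hab : a < b) {f φ : ℝ × ℝ → ℝ}
    (hf : MemW11Loc (strip a b) f) (hφ : IsTest univ φ) (j : Fin 2) :
    pair (strip a b) (weakPartial (strip a b) j f) φ
      = (if j = 1 then boundaryTerm (strip a b) f φ else 0)
        - pair (strip a b) f (classicalPartial j φ) := by
  fin_cases j
  · have : pair (strip a b) f (classicalPartial 0 φ)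
        = -pair (strip a b) (weakPartial (strip a b) 0 f) φ :=
      (hf.hasWeakPartial 0).integral_horizontal hab hf.locallyIntegrable
        (hf.locallyIntegrable_partial 0) hφ
    simp [this]
  · simp [boundaryTerm]

lemma HasLowerTrace.boundaryTerm_eq {a b : ℝ} {f φ : ℝ × ℝ → ℝ} {τ : ℝ → ℝ}
    (h : HasLowerTrace a b f τ) (hφ : IsTest (univ ×ˢ Iio b) φ) :
    boundaryTerm (strip a b) f φ = -∫ s, τ s * φ (s, a) := by
  obtain ⟨-, hf, g, hg, hgl, hgreen⟩ := h
  rw [boundaryTerm, pair_congr_left (hg.weakPartial_ae (isOpen_strip a b)), ← hgreen φ hφ]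
  exact (integral_add ((hφ.partial 1).integrable_mul hf) (hφ.integrable_mul hgl)).symm

lemma HasUpperTrace.boundaryTerm_eq {a b : ℝ} {f φ : ℝ × ℝ → ℝ} {τ : ℝ → ℝ}
    (h : HasUpperTrace a b f τ) (hφ : IsTest (univ ×ˢ Ioi a) φ) :
    boundaryTerm (strip a b) f φ = ∫ s, τ s * φ (s, b) := by
  obtain ⟨-, hf, g, hg, hgl, hgreen⟩ := h
  rw [boundaryTerm, pair_congr_left (hg.weakPartial_ae (isOpen_strip a b)), ← hgreen φ hφ]
  exact (integral_add ((hφ.partial 1).integrable_mul hf) (hφ.integrable_mul hgl)).symm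

/-- The equations satisfied in one phase `U` at a fixed time, with the regularity needed to
integrate them by parts; no condition is imposed on the boundary of `U`. -/
structure IsPhase (U : Set (ℝ × ℝ)) (ρ μ : ℝ) (B : Fin 2 → ℝ) (vt v η : Fin 2 → ℝ × ℝ → ℝ)
    (q : ℝ × ℝ → ℝ) : Prop where
  vt_L2 : ∀ i, MemLp (vt i) 2 (volume.restrict U)
  v_H2 : ∀ i, MemH2 U (v i)
  η_H2 : ∀ i, MemH2 U (η i)
  locallyIntegrable_q : LocallyIntegrable q (volume.restrict U)
  grad_q : ∀ j, ∃ G, HasWeakPartial U j q G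
  momentum : Momentum U ρ μ B vt v η q
  div_v : ∀ᵐ x ∂(volume.restrict U), weakPartial U 0 (v 0) x + weakPartial U 1 (v 1) x = 0

section Phase

variable {U : Set (ℝ × ℝ)} {ρ μ : ℝ} {B : Fin 2 → ℝ} {vt v η : Fin 2 → ℝ × ℝ → ℝ}
  {q : ℝ × ℝ → ℝ}

lemma locallyIntegrable_pressure (hU : IsOpen U) (hv : MemH1 U (v 1))
    (hσ : LocallyIntegrable (normalStress U μ v q 1) (volume.restrict U)) :
    LocallyIntegrable q (volume.restrict U) := by
  have hDv := (hv.memW11Loc hU).locallyIntegrable_partial 1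
  refine (hσ.add (hDv.smul (2 * μ))).congr (Eventually.of_forall fun x => ?_)
  simp only [normalStress, if_true, Pi.add_apply, Pi.smul_apply, smul_eq_mul]
  ring

lemma IsPhase.memW11Loc_q (hU : IsOpen U) (h : IsPhase U ρ μ B vt v η q) : MemW11Loc U q where
  locallyIntegrable := h.locallyIntegrable_q
  hasWeakPartial j := (h.grad_q j).choose_spec.spec
  locallyIntegrable_partial i := by
    have hmem : MemLp (fun x => -(ρ * vt i x) + (μ * ∑ j, weakPartial U j (weakPartial U j (v i)) x
        + ∑ l, ∑ m, B l * B m * weakPartial U l (weakPartial U m (η i)) x)) 2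
        (volume.restrict U) := by
      refine ((h.vt_L2 i).const_mul ρ).neg.add (MemLp.add (MemLp.const_mul ?_ μ) ?_)
      · exact memLp_finsetSum _ fun j _ => ((h.v_H2 i).2 j).memLp_weakPartial hU j
      · exact memLp_finsetSum _ fun l _ => memLp_finsetSum _ fun m _ =>
          (((h.η_H2 i).2 m).memLp_weakPartial hU l).const_mul _
    refine (hmem.locallyIntegrable one_le_two).congr ?_
    filter_upwards [h.momentum i] with x hx
    linarith

lemma IsPhase.pair_momentum (hU : IsOpen U) (h : IsPhase U ρ μ B vt v η q) (i : Fin 2)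
    {φ : ℝ × ℝ → ℝ} (hφ : IsTest univ φ) :
    ρ * pair U (vt i) φ + pair U (weakPartial U i q) φ
      = μ * ∑ j, pair U (weakPartial U j (weakPartial U j (v i))) φ
        + ∑ l, ∑ m, B l * B m * pair U (weakPartial U l (weakPartial U m (η i))) φ := by
  have hvt : LocallyIntegrable (fun x => ρ * vt i x) (volume.restrict U) :=
    ((h.vt_L2 i).const_mul ρ).locallyIntegrable one_le_two
  have hDq := (h.memW11Loc_q hU).locallyIntegrable_partial i
  have hv := fun j => (((h.v_H2 i).2 j).memW11Loc hU).locallyIntegrable_partial j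
  have hη := fun m l => (((h.η_H2 i).2 m).memW11Loc hU).locallyIntegrable_partial l
  have hvisc : LocallyIntegrable (fun x => μ * ∑ j, weakPartial U j (weakPartial U j (v i)) x)
      (volume.restrict U) := (locallyIntegrable_finsetSum _ fun j _ => hv j).smul μ
  have hmag₁ : ∀ l m, LocallyIntegrable
      (fun x => B l * B m * weakPartial U l (weakPartial U m (η i)) x) (volume.restrict U) :=
    fun l m => (hη m l).smul (B l * B m)
  have hmag₂ : ∀ l, LocallyIntegrable
      (fun x => ∑ m, B l * B m * weakPartial U l (weakPartial U m (η i)) x)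
      (volume.restrict U) := fun l => locallyIntegrable_finsetSum _ fun m _ => hmag₁ l m
  calc ρ * pair U (vt i) φ + pair U (weakPartial U i q) φ
      = pair U (fun x => ρ * vt i x + weakPartial U i q x) φ := by
        rw [pair_add_left hφ hvt hDq, pair_const_mul_left]
    _ = pair U (fun x => μ * ∑ j, weakPartial U j (weakPartial U j (v i)) x
          + ∑ l, ∑ m, B l * B m * weakPartial U l (weakPartial U m (η i)) x) φ :=
        pair_congr_left (by filter_upwards [h.momentum i] with x hx; linarith) φ
    _ = _ := by
        rw [pair_add_left hφ hvisc (locallyIntegrable_finsetSum _ fun l _ => hmag₂ l),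
          pair_const_mul_left, pair_sum_left _ hφ fun j _ => hv j,
          pair_sum_left _ hφ fun l _ => hmag₂ l]
        simp only [pair_sum_left _ hφ fun m _ => hmag₁ _ m, pair_const_mul_left]

lemma IsPhase.sum_pair_partial_transpose (hU : IsOpen U) (h : IsPhase U ρ μ B vt v η q)
    (i : Fin 2) {φ : ℝ × ℝ → ℝ} (hφ : IsTest univ φ) :
    ∑ j, pair U (weakPartial U j (weakPartial U i (v j))) φ = 0 := by
  have hmixed : ∀ j, HasWeakPartial U i (weakPartial U j (v j))
      (weakPartial U j (weakPartial U i (v j))) := fun j =>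
    ((h.v_H2 j).1.hasWeakPartial i).comm ((h.v_H2 j).1.hasWeakPartial j)
      (((h.v_H2 j).2 i).hasWeakPartial j)
  have hzero : HasWeakPartial U i (fun _ => 0) (fun _ => 0) :=
    ⟨locallyIntegrable_zero.locallyIntegrableOn U, locallyIntegrable_zero.locallyIntegrableOn U,
      fun φ _ => by simp⟩
  have hdiv : (fun x => ∑ j, weakPartial U j (weakPartial U i (v j)) x)
      =ᵐ[volume.restrict U] fun _ => 0 := by
    simp only [Fin.sum_univ_two]
    exact (((hmixed 0).add (hmixed 1)).congr h.div_v (ae_eq_refl _)).unique hU hzero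
  rw [← pair_sum_left _ hφ fun j _ => (((h.v_H2 j).2 i).memW11Loc hU).locallyIntegrable_partial j,
    pair_congr_left hdiv]
  simp [pair]

lemma IsPhase.boundaryTerm_normalStress (hU : IsOpen U) (h : IsPhase U ρ μ B vt v η q)
    (i : Fin 2) {φ : ℝ × ℝ → ℝ} (hφ : IsTest univ φ) :
    boundaryTerm U (normalStress U μ v q i) φ
      = -μ * (boundaryTerm U (weakPartial U 1 (v i)) φ + boundaryTerm U (weakPartial U i (v 1)) φ)
        + if i = 1 then boundaryTerm U q φ else 0 := by
  have hD := fun i j => ((h.v_H2 i).2 j).memW11Loc hU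
  have hsum := (hD i 1).add hU (hD 1 i)
  have hvisc := boundaryTerm_const_mul hU (-μ) hsum φ
  rw [boundaryTerm_add hU hφ (hD i 1) (hD 1 i)] at hvisc
  rw [← hvisc]
  unfold normalStress
  by_cases hi : i = 1
  · simp only [hi, if_true] at hsum ⊢
    exact boundaryTerm_add hU hφ (hsum.const_mul hU (-μ)) (h.memW11Loc_q hU)
  · simp only [hi, if_false, add_zero]

lemma IsPhase.green {a b : ℝ} (hab : a < b) (h : IsPhase (strip a b) ρ μ B vt v η q)
    (i : Fin 2) {φ : ℝ × ℝ → ℝ} (hφ : IsTest univ φ) :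
    ρ * pair (strip a b) (vt i) φ
      + μ * ∑ j, (pair (strip a b) (weakPartial (strip a b) j (v i)) (classicalPartial j φ)
          + pair (strip a b) (weakPartial (strip a b) i (v j)) (classicalPartial j φ))
      + ∑ l, ∑ m, B l * B m *
          pair (strip a b) (weakPartial (strip a b) m (η i)) (classicalPartial l φ)
      + (boundaryTerm (strip a b) (normalStress (strip a b) μ v q i) φ
        - B 1 * ∑ m, B m * boundaryTerm (strip a b) (weakPartial (strip a b) m (η i)) φ)
      = pair (strip a b) q (classicalPartial i φ) := by
  have hU := isOpen_strip a b
  have hv := fun i j k => (((h.v_H2 i).2 j).memW11Loc hU).pair_weakPartial hab hφ k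
  have hη := fun m l => (((h.η_H2 i).2 m).memW11Loc hU).pair_weakPartial hab hφ l
  have hmom := h.pair_momentum hU i hφ
  have hdiv := h.sum_pair_partial_transpose hU i hφ
  rw [(h.memW11Loc_q hU).pair_weakPartial hab hφ i] at hmom
  rw [h.boundaryTerm_normalStress hU i hφ]
  simp only [hv, hη, Fin.sum_univ_two, zero_ne_one, if_false, if_true] at hmom hdiv ⊢
  linear_combination hmom - μ * hdiv

/-- The pressure drops out because the test field is divergence free. -/
lemma IsPhase.sum_green {a b : ℝ} (hab : a < b) (h : IsPhase (strip a b) ρ μ B vt v η q)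
    {ψ : ℝ × ℝ → ℝ} (hψ : IsTest univ ψ) :
    ρ * ∑ i, pair (strip a b) (vt i) (curl ψ i)
      + μ * ∑ i, ∑ j,
        (pair (strip a b) (weakPartial (strip a b) j (v i)) (classicalPartial j (curl ψ i))
          + pair (strip a b) (weakPartial (strip a b) i (v j)) (classicalPartial j (curl ψ i)))
      + ∑ i, ∑ l, ∑ m, B l * B m *
          pair (strip a b) (weakPartial (strip a b) m (η i)) (classicalPartial l (curl ψ i))
      + ∑ i, (boundaryTerm (strip a b) (normalStress (strip a b) μ v q i) (curl ψ i)
        - B 1 * ∑ m, B m * boundaryTerm (strip a b) (weakPartial (strip a b) m (η i)) (curl ψ i))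
      = 0 := by
  have hpressure : ∑ i, pair (strip a b) q (classicalPartial i (curl ψ i)) = 0 := by
    rw [Fin.sum_univ_two, pair, pair, ← integral_add
      (((hψ.curl 0).partial 0).integrable_mul h.locallyIntegrable_q)
      (((hψ.curl 1).partial 1).integrable_mul h.locallyIntegrable_q)]
    simp only [← mul_add, div_curl hψ.smooth, mul_zero, integral_zero]
  rw [← hpressure, ← Finset.sum_congr rfl fun i _ => h.green hab i (hψ.curl i)]
  simp only [Finset.sum_add_distrib, Finset.mul_sum, mul_add]

end Phase

lemma IsTest.integrable_mul_slice {V : Set (ℝ × ℝ)} {φ : ℝ × ℝ → ℝ} (hφ : IsTest V φ) (y : ℝ)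
    {τ : ℝ → ℝ} (hτ : LocallyIntegrable τ) : Integrable (fun s => τ s * φ (s, y)) := by
  have hcont : Continuous fun s : ℝ => φ (s, y) := hφ.smooth.continuous.comp (by fun_prop)
  have hembed : Topology.IsClosedEmbedding (fun s : ℝ => (s, y)) :=
    (Isometry.of_dist_eq fun s t => by simp [Prod.dist_eq]).isClosedEmbedding
  simpa [mul_comm] using hτ.integrable_smul_left_of_hasCompactSupport hcont
    (hφ.compact.comp_isClosedEmbedding hembed)

lemma HasJump.locallyIntegrable {fp fm : ℝ × ℝ → ℝ} {J : ℝ → ℝ} (h : HasJump fp fm J) :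
    LocallyIntegrable J := by
  obtain ⟨τp, τm, hp, hm, hJ⟩ := h
  exact (hp.1.sub hm.1).congr (hJ.mono fun s hs => hs.symm)

lemma HasJump.boundaryTerm_add {fp fm φ : ℝ × ℝ → ℝ} {J : ℝ → ℝ} (h : HasJump fp fm J)
    (hφ : IsTest slab φ) :
    boundaryTerm upper fp φ + boundaryTerm lower fm φ = -∫ s, J s * φ (s, 0) := by
  obtain ⟨τp, τm, hp, hm, hJ⟩ := h
  have hup : boundaryTerm upper fp φ = -∫ s, τp s * φ (s, 0) :=
    hp.boundaryTerm_eq (hφ.mono fun _ hx => ⟨mem_univ _, (mem_strip.1 hx).2⟩)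
  have hlow : boundaryTerm lower fm φ = ∫ s, τm s * φ (s, 0) :=
    hm.boundaryTerm_eq (hφ.mono fun _ hx => ⟨mem_univ _, (mem_strip.1 hx).1⟩)
  have hsub : ∫ s, J s * φ (s, 0) = ∫ s, (τp s * φ (s, 0) - τm s * φ (s, 0)) :=
    integral_congr_ae (hJ.mono fun s hs => by simp only [hs, sub_mul])
  rw [hup, hlow, hsub, integral_sub (hφ.integrable_mul_slice 0 hp.1)
    (hφ.integrable_mul_slice 0 hm.1)]
  ring

lemma StressJump.boundaryTerm_add {c : Coeffs} {B : Fin 2 → ℝ} {v η : Fin 2 → ℝ × ℝ → ℝ}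
    {q φ : ℝ × ℝ → ℝ} (h : StressJump c B v η q) (hφ : IsTest slab φ) (i : Fin 2) :
    boundaryTerm upper (normalStress upper c.μp v q i) φ
        + boundaryTerm lower (normalStress lower c.μm v q i) φ
      = (if i = 1 then c.gJump * boundaryTerm upper (η 1) φ else 0)
        + B 1 * ∑ l, B l * (boundaryTerm upper (weakPartial upper l (η i)) φ
          + boundaryTerm lower (weakPartial lower l (η i)) φ) := by
  obtain ⟨e, he, hJ⟩ := h
  obtain ⟨J, hη, hσ⟩ := hJ i
  have hgravity : boundaryTerm upper (η 1) φ = -∫ s, e s * φ (s, 0) :=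
    he.boundaryTerm_eq (hφ.mono fun _ hx => ⟨mem_univ _, (mem_strip.1 hx).2⟩)
  have hi_e := (hφ.integrable_mul_slice 0 he.1).const_mul (if i = 1 then c.gJump else 0)
  have hi_J := fun l => (hφ.integrable_mul_slice 0 (hη l).locallyIntegrable).const_mul (B 1 * B l)
  have hsplit : ∀ s, ((if i = 1 then c.gJump * e s else 0) + B 1 * ∑ l, B l * J l s) * φ (s, 0)
      = (if i = 1 then c.gJump else 0) * (e s * φ (s, 0))
        + ∑ l, B 1 * B l * (J l s * φ (s, 0)) := fun s => by
    simp only [Fin.sum_univ_two]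
    split_ifs <;> ring
  rw [hσ.boundaryTerm_add hφ]
  simp only [(hη _).boundaryTerm_add hφ, hgravity, hsplit]
  rw [integral_add hi_e (integrable_finsetSum _ fun l _ => hi_J l),
    integral_finsetSum _ fun l _ => hi_J l]
  simp only [integral_const_mul, Fin.sum_univ_two]
  split_ifs <;> ring

lemma IsPhase.of_slab {U : Set (ℝ × ℝ)} (hU : IsOpen U) (hUs : U ⊆ slab) {ρ μ : ℝ} {B : Fin 2 → ℝ}
    {vt v η : Fin 2 → L2} {q : ℝ × ℝ → ℝ} {DV : Fin 2 → Fin 2 → L2}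
    (hDV : ∀ i j, HasWeakPartial slab j (v i) (DV i j))
    (hdiv : ∀ᵐ x ∂(volume.restrict slab), DV 0 0 x + DV 1 1 x = 0)
    (hv : ∀ i, MemH2 U (v i)) (hη : ∀ i, MemH2 U (η i))
    (hq : LocallyIntegrable q (volume.restrict U)) (hDq : ∀ j, ∃ G, HasWeakPartial U j q G)
    (hmom : Momentum U ρ μ B (fun i => vt i) (fun i => v i) (fun i => η i) q) :
    IsPhase U ρ μ B (fun i => vt i) (fun i => v i) (fun i => η i) q where
  vt_L2 i := (Lp.memLp (vt i)).mono_measure (Measure.restrict_mono hUs le_rfl)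
  v_H2 := hv
  η_H2 := hη
  locallyIntegrable_q := hq
  grad_q := hDq
  momentum := hmom
  div_v := by
    have hD := fun i j => ((hDV i j).mono hUs measurableSet_slab).weakPartial_ae hU
    filter_upwards [hD 0 0, hD 1 1, ae_mono (Measure.restrict_mono hUs le_rfl) hdiv]
      with x h0 h1 hx
    rw [h0, h1, hx]

/-- The interfacial gravity term is written as an integral over the upper phase, so that it is a
continuous function of `η` and `∇η` in `L²`. -/
lemma weak_form_curl {c : Coeffs} {B : Fin 2 → ℝ} {vt v η : Fin 2 → L2} {q : ℝ × ℝ → ℝ}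
    {DV DN : Fin 2 → Fin 2 → L2}
    (hDN : ∀ i j, HasWeakPartial slab j (η i) (DN i j))
    (hDV : ∀ i j, HasWeakPartial slab j (v i) (DV i j))
    (hu : IsPhase upper c.ρp c.μp B (fun i => vt i) (fun i => v i) (fun i => η i) q)
    (hl : IsPhase lower c.ρm c.μm B (fun i => vt i) (fun i => v i) (fun i => η i) q)
    (hjump : StressJump c B (fun i => v i) (fun i => η i) q)
    {ψ : ℝ × ℝ → ℝ} (hψ : IsTest slab ψ) :
    (c.ρp * ∑ i, pair upper (vt i) (curl ψ i)
        + c.ρm * ∑ i, pair lower (vt i) (curl ψ i))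
      + (c.μp * ∑ i, ∑ j, (pair upper (DV i j) (classicalPartial j (curl ψ i))
          + pair upper (DV j i) (classicalPartial j (curl ψ i)))
        + c.μm * ∑ i, ∑ j, (pair lower (DV i j) (classicalPartial j (curl ψ i))
          + pair lower (DV j i) (classicalPartial j (curl ψ i))))
      + (∑ i, ∑ l, ∑ m, B l * B m * (pair upper (DN i m) (classicalPartial l (curl ψ i))
          + pair lower (DN i m) (classicalPartial l (curl ψ i)))
        + c.gJump * (pair upper (η 1) (classicalPartial 1 (curl ψ 1))
          + pair upper (DN 1 1) (curl ψ 1))) = 0 := by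
  have hou : IsOpen upper := isOpen_strip _ _
  have hol : IsOpen lower := isOpen_strip _ _
  have gu := hu.sum_green one_pos (hψ.mono (subset_univ _))
  have gl := hl.sum_green (neg_lt_zero.2 one_pos) (hψ.mono (subset_univ _))
  rw [show strip 0 1 = upper from rfl] at gu
  rw [show strip (-1) 0 = lower from rfl] at gl
  have hj := fun i => hjump.boundaryTerm_add (hψ.curl i) i
  have hgravity : boundaryTerm upper (η 1) (curl ψ 1)
      = pair upper (η 1) (classicalPartial 1 (curl ψ 1)) + pair upper (DN 1 1) (curl ψ 1) := by
    rw [boundaryTerm, pair_weakPartial_congr hou upper_subset_slab measurableSet_slab (hDN 1 1)]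
  have j0 := hj 0
  have j1 := hj 1
  simp only [hgravity, Fin.sum_univ_two, if_true, zero_ne_one, if_false] at j0 j1
  simp only [pair_weakPartial_congr hou upper_subset_slab measurableSet_slab (hDV _ _),
    pair_weakPartial_congr hou upper_subset_slab measurableSet_slab (hDN _ _),
    Fin.sum_univ_two] at gu
  simp only [pair_weakPartial_congr hol lower_subset_slab measurableSet_slab (hDV _ _),
    pair_weakPartial_congr hol lower_subset_slab measurableSet_slab (hDN _ _),
    Fin.sum_univ_two] at gl
  simp only [Fin.sum_univ_two]
  linear_combination gu + gl - j0 - j1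

/-! ### One-dimensional inequalities and the critical number -/

lemma sq_intervalIntegral_le {a b : ℝ} (hab : a ≤ b) {f : ℝ → ℝ}
    (hf : IntervalIntegrable f volume a b)
    (hf2 : IntervalIntegrable (fun y => f y ^ 2) volume a b) :
    (∫ y in a..b, f y) ^ 2 ≤ (b - a) * ∫ y in a..b, f y ^ 2 := by
  rcases hab.eq_or_lt with rfl | hlt
  · simp
  set m := ∫ y in a..b, f y with hm
  have hvariance : 0 ≤ ∫ y in a..b, ((b - a) ^ 2 * f y ^ 2 - 2 * (b - a) * m * f y + m ^ 2) :=
    intervalIntegral.integral_nonneg hab fun y _ => by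
      nlinarith [sq_nonneg ((b - a) * f y - m)]
  rw [intervalIntegral.integral_add ((hf2.const_mul _).sub (hf.const_mul _)) (by simp),
    intervalIntegral.integral_sub (hf2.const_mul _) (hf.const_mul _),
    intervalIntegral.integral_const_mul, intervalIntegral.integral_const_mul, ← hm] at hvariance
  simp only [intervalIntegral.integral_const, smul_eq_mul] at hvariance
  have hmul : 0 ≤ (b - a) * ((b - a) * (∫ y in a..b, f y ^ 2) - m ^ 2) := by nlinarith
  linarith [nonneg_of_mul_nonneg_right hmul (sub_pos.2 hlt)]

lemma Coeffs.gJump_pos (c : Coeffs) : 0 < c.gJump :=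
  mul_pos c.g_pos (sub_pos.2 c.ρm_lt_ρp)

lemma IsH10.sq_apply_zero_le {ψ dψ : ℝ → ℝ} (h : IsH10 ψ dψ) :
    ψ 0 ^ 2 ≤ ∫ y in (-1 : ℝ)..1, dψ y ^ 2 := by
  have hL2 : MemLp dψ 2 (volume.restrict (Ioc (-1) 1)) := by
    rw [← Measure.restrict_congr_set Ioo_ae_eq_Ioc]
    exact h.memLp
  have hint : IntervalIntegrable dψ volume (-1) 1 :=
    (intervalIntegrable_iff_integrableOn_Ioc_of_le (by norm_num)).2 (hL2.integrable one_le_two)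
  have hint2 : IntervalIntegrable (fun y => dψ y ^ 2) volume (-1) 1 :=
    (intervalIntegrable_iff_integrableOn_Ioc_of_le (by norm_num)).2 hL2.integrable_sq
  have hsub : uIcc (-1 : ℝ) 0 ⊆ uIcc (-1) 1 := uIcc_subset_uIcc_left (by simp)
  have hCS := sq_intervalIntegral_le (by norm_num) (hint.mono_set hsub) (hint2.mono_set hsub)
  rw [← h.primitive 0 (by norm_num), sub_neg_eq_add, zero_add, one_mul] at hCS
  exact hCS.trans (intervalIntegral.integral_mono_interval le_rfl (by norm_num) (by norm_num)
    (Eventually.of_forall fun y => sq_nonneg (dψ y)) hint2)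

/-- The derivative of the tent function `1 - |y|`, which maximises the quotient
`ψ(0)² / ∫ |ψ'|²` that defines the critical number. -/
def tentDeriv (y : ℝ) : ℝ := if y ≤ 0 then 1 else -1

lemma tentDeriv_sq (y : ℝ) : tentDeriv y ^ 2 = 1 := by
  unfold tentDeriv
  split_ifs <;> norm_num

lemma measurable_tentDeriv : Measurable tentDeriv :=
  Measurable.ite measurableSet_Iic measurable_const measurable_const

lemma norm_tentDeriv_le (y : ℝ) : ‖tentDeriv y‖ ≤ 1 := by
  unfold tentDeriv
  split_ifs <;> simp

lemma intervalIntegrable_tentDeriv (a b : ℝ) : IntervalIntegrable tentDeriv volume a b :=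
  (intervalIntegrable_const (c := (1 : ℝ))).mono_fun measurable_tentDeriv.aestronglyMeasurable
    (Eventually.of_forall fun y => by simpa using norm_tentDeriv_le y)

lemma integral_tentDeriv_left : ∫ z in (-1 : ℝ)..0, tentDeriv z = 1 := by
  rw [intervalIntegral.integral_congr (g := fun _ => (1 : ℝ)) fun z hz => ?_]
  · norm_num
  · rw [uIcc_of_le (by norm_num)] at hz
    exact if_pos hz.2

lemma integral_tentDeriv_right : ∫ z in (0 : ℝ)..1, tentDeriv z = -1 := by
  rw [intervalIntegral.integral_congr_ae (g := fun _ => (-1 : ℝ))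
    (Eventually.of_forall fun z hz => ?_)]
  · norm_num
  · rw [uIoc_of_le (by norm_num)] at hz
    exact if_neg (not_le.2 hz.1)

lemma isH10_tent : IsH10 (fun y => ∫ z in (-1 : ℝ)..y, tentDeriv z) tentDeriv where
  memLp := MemLp.of_bound measurable_tentDeriv.aestronglyMeasurable 1
    (Eventually.of_forall norm_tentDeriv_le)
  primitive _ _ := rfl
  right_end := by
    rw [← intervalIntegral.integral_add_adjacent_intervals (intervalIntegrable_tentDeriv (-1) 0)
      (intervalIntegrable_tentDeriv 0 1), integral_tentDeriv_left, integral_tentDeriv_right]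
    norm_num

lemma half_gJump_le_criticalNumber_sq (c : Coeffs) : c.gJump / 2 ≤ criticalNumber c ^ 2 := by
  set S := {r : ℝ | ∃ ψ dψ : ℝ → ℝ, IsH10 ψ dψ ∧
    (∃ y ∈ Set.Icc (-1 : ℝ) 1, ψ y ≠ 0) ∧
    r = c.gJump * ψ 0 ^ 2 / ∫ y in (-1 : ℝ)..1, dψ y ^ 2}
  have hg := c.gJump_pos
  have hbdd : BddAbove S := by
    refine ⟨c.gJump, ?_⟩
    rintro _ ⟨ψ, dψ, h, -, rfl⟩
    exact div_le_of_le_mul₀ ((sq_nonneg _).trans h.sq_apply_zero_le) hg.le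
      (mul_le_mul_of_nonneg_left h.sq_apply_zero_le hg.le)
  have hmem : c.gJump / 2 ∈ S := by
    refine ⟨_, _, isH10_tent, ⟨0, by norm_num, ?_⟩, ?_⟩
    · simp only [integral_tentDeriv_left]
      exact one_ne_zero
    · simp only [integral_tentDeriv_left, tentDeriv_sq]
      norm_num
  have hle : c.gJump / 2 ≤ sSup S := le_csSup hbdd hmem
  exact hle.trans_eq (Real.sq_sqrt (by linarith)).symm

lemma half_gJump_lt_sq {c : Coeffs} {B : ℝ} (hB : criticalNumber c < |B|) :
    c.gJump / 2 < B ^ 2 := by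
  rw [← sq_abs B]
  exact (half_gJump_le_criticalNumber_sq c).trans_lt
    (pow_lt_pow_left₀ hB (Real.sqrt_nonneg _) two_ne_zero)

-- The left side is `h 0 ^ 2`, and `h 0` is the integral of `h'` over `(-1, 0)` and that of `-h'`
-- over `(0, 1)`.
lemma neg_two_mul_integral_mul_deriv_le {h h' : ℝ → ℝ} (hd : ∀ y, HasDerivAt h (h' y) y)
    (hc : Continuous h') (h1 : h 1 = 0) (hm1 : h (-1) = 0) :
    -2 * ∫ y in Ioo (0 : ℝ) 1, h y * h' y ≤ (1 / 2) * ∫ y in Ioo (-1 : ℝ) 1, h' y ^ 2 := by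
  have hi : ∀ a b, IntervalIntegrable h' volume a b := fun a b => hc.intervalIntegrable a b
  have hi2 : ∀ a b, IntervalIntegrable (fun y => h' y ^ 2) volume a b :=
    fun a b => (hc.pow 2).intervalIntegrable a b
  have hcont : Continuous h := continuous_iff_continuousAt.2 fun y => (hd y).continuousAt
  have hright : h 0 ^ 2 ≤ ∫ y in (0 : ℝ)..1, h' y ^ 2 := by
    have := sq_intervalIntegral_le (by norm_num) (hi 0 1) (hi2 0 1)
    rw [intervalIntegral.integral_eq_sub_of_hasDerivAt (fun y _ => hd y) (hi _ _), h1] at this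
    linarith
  have hleft : h 0 ^ 2 ≤ ∫ y in (-1 : ℝ)..0, h' y ^ 2 := by
    have := sq_intervalIntegral_le (by norm_num) (hi (-1) 0) (hi2 (-1) 0)
    rw [intervalIntegral.integral_eq_sub_of_hasDerivAt (fun y _ => hd y) (hi _ _), hm1] at this
    linarith
  have hprod : ∫ y in (0 : ℝ)..1, h y * h' y = -(h 0 ^ 2 / 2) := by
    rw [intervalIntegral.integral_eq_sub_of_hasDerivAt (f := fun y => h y ^ 2 / 2)
      (f' := fun y => h y * h' y) (fun y _ => ?_) ((hcont.mul hc).intervalIntegrable _ _), h1]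
    · ring
    · refine (((hd y).pow 2).div_const 2).congr_deriv ?_
      push_cast
      ring
  rw [← integral_Ioc_eq_integral_Ioo, ← integral_Ioc_eq_integral_Ioo,
    ← intervalIntegral.integral_of_le (by norm_num),
    ← intervalIntegral.integral_of_le (by norm_num),
    ← intervalIntegral.integral_add_adjacent_intervals (hi2 (-1) 0) (hi2 0 1), hprod]
  linarith

/-! ### Inequalities for test functions -/

lemma IsTest.eq_zero {U : Set (ℝ × ℝ)} {φ : ℝ × ℝ → ℝ} (h : IsTest U φ) {x : ℝ × ℝ}
    (hx : x ∉ U) : φ x = 0 := image_eq_zero_of_notMem_tsupport fun h' => hx (h.support h')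

lemma IsTest.pair_eq_integral {U : Set (ℝ × ℝ)} {f : ℝ × ℝ → ℝ} (hf : IsTest U f)
    (g : ℝ × ℝ → ℝ) : pair U f g = ∫ x, f x * g x :=
  setIntegral_eq_integral_of_forall_compl_eq_zero fun x hx => by rw [hf.eq_zero hx, zero_mul]

lemma IsTest.integrable_mul_test {U V : Set (ℝ × ℝ)} {f g : ℝ × ℝ → ℝ} (hf : IsTest U f)
    (hg : IsTest V g) : Integrable fun x => f x * g x :=
  hg.integrable_mul hf.smooth.continuous.locallyIntegrable

lemma IsTest.integral_by_parts {U V : Set (ℝ × ℝ)} {f g : ℝ × ℝ → ℝ} (hf : IsTest U f)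
    (hg : IsTest V g) (j : Fin 2) :
    ∫ x, f x * classicalPartial j g x = -∫ x, classicalPartial j f x * g x :=
  integral_mul_fderiv_eq_neg_fderiv_mul_of_integrable ((hf.partial j).integrable_mul_test hg)
    (hf.integrable_mul_test (hg.partial j)) (hf.integrable_mul_test hg)
    (fun x _ => hf.smooth.differentiable (by simp) x)
    (fun x _ => hg.smooth.differentiable (by simp) x)

lemma IsTest.integral_sq_eq {U : Set (ℝ × ℝ)} {f : ℝ × ℝ → ℝ} (hf : IsTest U f) :
    ∫ x, f x * f x = -2 * ∫ x, classicalPartial 1 f x * (x.2 * f x) := by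
  have hy : IsTest U fun x => x.2 * f x := hf.mul_left contDiff_snd inter_subset_left
  have hderiv : ∀ x, classicalPartial 1 (fun x : ℝ × ℝ => x.2 * f x) x
      = x.2 * classicalPartial 1 f x + f x := fun x => by
    have hone : classicalPartial 1 (fun y : ℝ × ℝ => y.2) x = 1 := by
      simpa using classicalPartial_snd (χ := fun y => y) differentiable_id x 1
    rw [classicalPartial_mul differentiableAt_snd (hf.smooth.differentiable (by simp) x), hone,
      one_mul]
  have hparts := hf.integral_by_parts hy 1
  have hexpand : ∫ x, f x * classicalPartial 1 (fun x : ℝ × ℝ => x.2 * f x) x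
      = (∫ x, classicalPartial 1 f x * (x.2 * f x)) + ∫ x, f x * f x := by
    rw [← integral_add ((hf.partial 1).integrable_mul_test hy) (hf.integrable_mul_test hf)]
    refine integral_congr_ae (Eventually.of_forall fun x => ?_)
    simp only [hderiv]
    ring
  linarith

lemma IsTest.poincare {f : ℝ × ℝ → ℝ} (hf : IsTest slab f) :
    pair slab f f ≤ 4 * pair slab (classicalPartial 1 f) (classicalPartial 1 f) := by
  have hf1 := hf.partial 1
  have hy : IsTest slab fun x => x.2 * f x := hf.mul_left contDiff_snd inter_subset_left
  have hi := hf.integrable_mul_test hf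
  have hi1 := hf1.integrable_mul_test hf1
  have hpointwise : ∀ x, -2 * (classicalPartial 1 f x * (x.2 * f x))
      ≤ (1 / 2) * (f x * f x) + 2 * (classicalPartial 1 f x * classicalPartial 1 f x) := fun x => by
    by_cases hx : x ∈ slab
    · have hx2 := mem_strip.1 hx
      have hsq : x.2 ^ 2 ≤ 1 := by nlinarith
      nlinarith [sq_nonneg (f x + 2 * (x.2 * classicalPartial 1 f x)),
        mul_nonneg (sub_nonneg.2 hsq) (sq_nonneg (classicalPartial 1 f x))]
    · rw [hf.eq_zero hx]
      nlinarith [mul_self_nonneg (classicalPartial 1 f x)]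
  have hmono := integral_mono ((hf1.integrable_mul_test hy).const_mul (-2))
    ((hi.const_mul _).add (hi1.const_mul _)) hpointwise
  rw [integral_const_mul, ← hf.integral_sq_eq, integral_add' (hi.const_mul _) (hi1.const_mul _),
    integral_const_mul, integral_const_mul] at hmono
  rw [hf.pair_eq_integral, hf1.pair_eq_integral]
  linarith

lemma setIntegral_strip {a b : ℝ} {F : ℝ × ℝ → ℝ} (hF : Integrable F) :
    ∫ x in strip a b, F x = ∫ s, ∫ y in Ioo a b, F (s, y) := by
  rw [strip, Measure.volume_eq_prod, setIntegral_prod _ (by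
    rw [← Measure.volume_eq_prod]; exact hF.integrableOn)]
  simp

lemma integrable_setIntegral_strip {a b : ℝ} {F : ℝ × ℝ → ℝ} (hF : Integrable F) :
    Integrable fun s => ∫ y in Ioo a b, F (s, y) := by
  have h : Integrable F ((volume : Measure ℝ).prod (volume.restrict (Ioo a b))) := by
    refine hF.mono_measure ?_
    rw [Measure.volume_eq_prod]
    exact Measure.prod_mono le_rfl Measure.restrict_le_self
  exact h.integral_prod_left

lemma IsTest.trace_inequality {f : ℝ × ℝ → ℝ} (hf : IsTest slab f) :
    -2 * pair upper f (classicalPartial 1 f)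
      ≤ (1 / 2) * pair slab (classicalPartial 1 f) (classicalPartial 1 f) := by
  have hf1 := hf.partial 1
  have hi := hf.integrable_mul_test hf1
  have hi1 := hf1.integrable_mul_test hf1
  unfold pair upper slab
  rw [setIntegral_strip hi, setIntegral_strip hi1, ← integral_const_mul, ← integral_const_mul]
  refine integral_mono ((integrable_setIntegral_strip hi).const_mul _)
    ((integrable_setIntegral_strip hi1).const_mul _) fun s => ?_
  have hd : ∀ y, HasDerivAt (fun y => f (s, y)) (classicalPartial 1 f (s, y)) y := fun y =>
    (hf.smooth.differentiable (by simp) (s, y)).hasFDerivAt.comp_hasDerivAt y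
      ((hasDerivAt_const y s).prodMk (hasDerivAt_id y))
  have hslice := neg_two_mul_integral_mul_deriv_le hd (hf1.smooth.continuous.comp (by fun_prop))
    (hf.eq_zero fun h => by simpa using (mem_strip.1 h).2)
    (hf.eq_zero fun h => by simpa using (mem_strip.1 h).1)
  simpa only [pow_two] using hslice

lemma integral_sum_transpose_curl {ψ : ℝ × ℝ → ℝ} (hψ : IsTest slab ψ) :
    ∑ i, ∑ j, pair slab (classicalPartial i (curl ψ j)) (classicalPartial j (curl ψ i)) = 0 := by
  have hD := fun i j => (hψ.curl i).partial j
  have hmixed : ∫ x, classicalPartial 0 (curl ψ 1) x * classicalPartial 1 (curl ψ 0) x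
      = ∫ x, classicalPartial 0 (curl ψ 0) x * classicalPartial 1 (curl ψ 1) x := by
    have h01 := (hD 0 1).integral_by_parts (hψ.curl 1) 0
    have h00 := (hD 0 0).integral_by_parts (hψ.curl 1) 1
    simp only [classicalPartial_comm (hψ.curl 0).smooth 0 1] at h01
    rw [h00, ← h01]
    simp only [mul_comm]
  have hdiv0 : (∫ x, classicalPartial 0 (curl ψ 0) x * classicalPartial 0 (curl ψ 0) x)
      + ∫ x, classicalPartial 0 (curl ψ 0) x * classicalPartial 1 (curl ψ 1) x = 0 := by
    rw [← integral_add ((hD 0 0).integrable_mul_test (hD 0 0))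
      ((hD 0 0).integrable_mul_test (hD 1 1))]
    simp only [← mul_add, div_curl hψ.smooth, mul_zero, integral_zero]
  have hdiv1 : (∫ x, classicalPartial 0 (curl ψ 0) x * classicalPartial 1 (curl ψ 1) x)
      + ∫ x, classicalPartial 1 (curl ψ 1) x * classicalPartial 1 (curl ψ 1) x = 0 := by
    rw [← integral_add ((hD 0 0).integrable_mul_test (hD 1 1))
      ((hD 1 1).integrable_mul_test (hD 1 1))]
    simp only [← add_mul, div_curl hψ.smooth, zero_mul, integral_zero]
  have hmixed' : ∫ x, classicalPartial 1 (curl ψ 0) x * classicalPartial 0 (curl ψ 1) x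
      = ∫ x, classicalPartial 0 (curl ψ 0) x * classicalPartial 1 (curl ψ 1) x := by
    rw [← hmixed]
    simp only [mul_comm]
  simp only [Fin.sum_univ_two, fun i j => (hD i j).pair_eq_integral]
  linarith

/-! ### Pairings on `L²(Ω)` -/

lemma measurableSet_upper : MeasurableSet upper := measurableSet_strip _ _

lemma measurableSet_lower : MeasurableSet lower := measurableSet_strip _ _

/-- The bounded bilinear form `(f, g) ↦ ∫_{U ∩ Ω} f g` on `L²(Ω)`, as the inner product of the
restrictions to `U`. -/
def pairCLM (U : Set (ℝ × ℝ)) : L2 →L[ℝ] L2 →L[ℝ] ℝ :=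
  (innerSL ℝ).bilinearComp (LpToLpRestrictCLM (ℝ × ℝ) ℝ ℝ (volume.restrict slab) 2 U)
    (LpToLpRestrictCLM (ℝ × ℝ) ℝ ℝ (volume.restrict slab) 2 U)

lemma pairCLM_eq_inner (U : Set (ℝ × ℝ)) (f g : L2) : pairCLM U f g =
    inner ℝ (LpToLpRestrictCLM (ℝ × ℝ) ℝ ℝ (volume.restrict slab) 2 U f)
      (LpToLpRestrictCLM (ℝ × ℝ) ℝ ℝ (volume.restrict slab) 2 U g) := rfl

lemma pairCLM_apply {U : Set (ℝ × ℝ)} (hU : MeasurableSet U) (hUs : U ⊆ slab) (f g : L2) :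
    pairCLM U f g = pair U f g := by
  have hμ : (volume.restrict slab).restrict U = volume.restrict U := by
    rw [Measure.restrict_restrict hU, inter_eq_left.2 hUs]
  rw [pairCLM_eq_inner, L2.inner_def, pair, ← hμ]
  refine integral_congr_ae ?_
  filter_upwards [LpToLpRestrictCLM_coeFn ℝ U f, LpToLpRestrictCLM_coeFn ℝ U g] with x hf hg
  rw [hf, hg]
  simp [mul_comm]

lemma pairCLM_comm (U : Set (ℝ × ℝ)) (f g : L2) : pairCLM U f g = pairCLM U g f := by
  rw [pairCLM_eq_inner, pairCLM_eq_inner, real_inner_comm]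

lemma pairCLM_self_nonneg (U : Set (ℝ × ℝ)) (f : L2) : 0 ≤ pairCLM U f f := by
  rw [pairCLM_eq_inner]
  exact real_inner_self_nonneg

lemma abs_pairCLM_le (U : Set (ℝ × ℝ)) (f g : L2) : |pairCLM U f g| ≤ ‖f‖ * ‖g‖ :=
  (abs_real_inner_le_norm _ _).trans (mul_le_mul (norm_Lp_toLp_restrict_le U f)
    (norm_Lp_toLp_restrict_le U g) (norm_nonneg _) (norm_nonneg _))

lemma upper_union_lower_ae : (upper ∪ lower : Set (ℝ × ℝ)) =ᵐ[volume] slab := by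
  have hnull : volume ((univ : Set ℝ) ×ˢ ({0} : Set ℝ)) = 0 := by
    rw [Measure.volume_eq_prod, Measure.prod_prod]
    simp
  filter_upwards [measure_eq_zero_iff_ae_notMem.1 hnull] with x hx
  have hx2 : x.2 ≠ 0 := fun h => hx ⟨mem_univ _, h⟩
  refine propext ⟨fun h => h.elim (fun h => upper_subset_slab h) fun h => lower_subset_slab h,
    fun h => ?_⟩
  rcases lt_or_gt_of_ne hx2 with hneg | hpos
  · exact Or.inr (mem_strip.2 ⟨(mem_strip.1 h).1, hneg⟩)
  · exact Or.inl (mem_strip.2 ⟨hpos, (mem_strip.1 h).2⟩)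

lemma pairCLM_slab (f g : L2) : pairCLM slab f g = inner ℝ f g := by
  rw [pairCLM_apply measurableSet_slab le_rfl, L2.inner_def]
  refine integral_congr_ae (Eventually.of_forall fun x => ?_)
  simp [mul_comm]

lemma pairCLM_upper_add_lower (f g : L2) :
    pairCLM upper f g + pairCLM lower f g = inner ℝ f g := by
  have hdisj : Disjoint upper lower := Set.disjoint_left.2 fun x hu hl =>
    (mem_strip.1 hu).1.not_gt (mem_strip.1 hl).2
  have hi : IntegrableOn (fun x => f x * g x) slab := (Lp.memLp f).integrable_mul (Lp.memLp g)
  rw [← pairCLM_slab, pairCLM_apply measurableSet_upper upper_subset_slab,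
    pairCLM_apply measurableSet_lower lower_subset_slab, pairCLM_apply measurableSet_slab le_rfl,
    pair, pair, pair, ← setIntegral_union hdisj measurableSet_lower (hi.mono_set upper_subset_slab)
    (hi.mono_set lower_subset_slab), setIntegral_congr_set upper_union_lower_ae]

/-- The form `∫ ν f g` on `L²(Ω)` for the coefficient `ν` equal to `α` in `Ω₊` and to `β` in
`Ω₋`. -/
def phasePair (α β : ℝ) : L2 →L[ℝ] L2 →L[ℝ] ℝ := α • pairCLM upper + β • pairCLM lower

lemma phasePair_apply (α β : ℝ) (f g : L2) :
    phasePair α β f g = α * pairCLM upper f g + β * pairCLM lower f g := rfl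

lemma phasePair_comm (α β : ℝ) (f g : L2) : phasePair α β f g = phasePair α β g f := by
  simp only [phasePair_apply, pairCLM_comm _ f g]

lemma min_mul_sq_norm_le_phasePair (α β : ℝ) (f : L2) :
    min α β * ‖f‖ ^ 2 ≤ phasePair α β f f := by
  rw [phasePair_apply, ← real_inner_self_eq_norm_sq, ← pairCLM_upper_add_lower, mul_add]
  exact add_le_add (mul_le_mul_of_nonneg_right (min_le_left _ _) (pairCLM_self_nonneg _ _))
    (mul_le_mul_of_nonneg_right (min_le_right _ _) (pairCLM_self_nonneg _ _))

lemma phasePair_self_le_max (α β : ℝ) (f : L2) :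
    phasePair α β f f ≤ max α β * ‖f‖ ^ 2 := by
  rw [phasePair_apply, ← real_inner_self_eq_norm_sq, ← pairCLM_upper_add_lower, mul_add]
  exact add_le_add (mul_le_mul_of_nonneg_right (le_max_left _ _) (pairCLM_self_nonneg _ _))
    (mul_le_mul_of_nonneg_right (le_max_right _ _) (pairCLM_self_nonneg _ _))

/-! ### Solenoidal fields -/

/-- Pairs `(u, ∇u)`; the entry `(i, j)` of the second component stands for `∂ⱼuᵢ`. -/
abbrev GradField : Type := (Fin 2 → L2) × (Fin 2 → Fin 2 → L2)

/-- The component `uᵢ` of `(u, ∇u)`. -/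
def fieldValue (i : Fin 2) : GradField →L[ℝ] L2 :=
  (ContinuousLinearMap.proj i).comp (ContinuousLinearMap.fst ℝ (Fin 2 → L2) (Fin 2 → Fin 2 → L2))

/-- The component `∂ⱼuᵢ` of `(u, ∇u)`. -/
def fieldPartial (i j : Fin 2) : GradField →L[ℝ] L2 :=
  ((ContinuousLinearMap.proj (R := ℝ) (φ := fun _ : Fin 2 => L2) j).comp
    (ContinuousLinearMap.proj (R := ℝ) (φ := fun _ : Fin 2 => Fin 2 → L2) i)).comp
    (ContinuousLinearMap.snd ℝ (Fin 2 → L2) (Fin 2 → Fin 2 → L2))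

@[simp] lemma fieldValue_apply (i : Fin 2) (x : GradField) : fieldValue i x = x.1 i := rfl

@[simp] lemma fieldPartial_apply (i j : Fin 2) (x : GradField) : fieldPartial i j x = x.2 i j := rfl

/-- The smooth functions with compact support in `U`, as a vector space. -/
def testFunctions (U : Set (ℝ × ℝ)) : Submodule ℝ (ℝ × ℝ → ℝ) where
  carrier := {φ | IsTest U φ}
  add_mem' h h' := h.add h'
  zero_mem' := isTest_zero U
  smul_mem' r _ h := h.const_mul r

/-- The class of a test function in `L²(Ω)`. -/
def IsTest.toL2 {U : Set (ℝ × ℝ)} {φ : ℝ × ℝ → ℝ} (h : IsTest U φ) : L2 :=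
  (h.memLp 2 (volume.restrict slab)).toLp φ

lemma IsTest.coe_toL2 {U : Set (ℝ × ℝ)} {φ : ℝ × ℝ → ℝ} (h : IsTest U φ) :
    h.toL2 =ᵐ[volume.restrict slab] φ := MemLp.coeFn_toLp _

/-- The inclusion of the test functions into `L²(Ω)`. -/
def testToL2 (U : Set (ℝ × ℝ)) : testFunctions U →ₗ[ℝ] L2 where
  toFun φ := φ.2.toL2
  map_add' _ _ := rfl
  map_smul' _ _ := rfl

/-- The partial derivative `∂ⱼ` on test functions. -/
def testPartial (U : Set (ℝ × ℝ)) (j : Fin 2) : testFunctions U →ₗ[ℝ] testFunctions U where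
  toFun φ := ⟨classicalPartial j φ.1, φ.2.partial j⟩
  map_add' φ χ := Subtype.ext <| funext fun x =>
    classicalPartial_add (φ.2.smooth.differentiable (by simp) x)
      (χ.2.smooth.differentiable (by simp) x) j
  map_smul' r φ := Subtype.ext <| funext fun x =>
    classicalPartial_const_mul r (φ.2.smooth.differentiable (by simp) x) j

/-- The component `i` of the curl of a test function. -/
def testCurl (U : Set (ℝ × ℝ)) (i : Fin 2) : testFunctions U →ₗ[ℝ] testFunctions U :=
  (![testPartial U 1, -testPartial U 0] : Fin 2 → testFunctions U →ₗ[ℝ] testFunctions U) i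

/-- The field `(curl ψ, ∇ curl ψ)`. -/
def streamField : testFunctions slab →ₗ[ℝ] GradField :=
  (LinearMap.pi fun i => testToL2 slab ∘ₗ testCurl slab i).prod
    (LinearMap.pi fun i => LinearMap.pi fun j => testToL2 slab ∘ₗ testPartial slab j ∘ₗ
      testCurl slab i)

lemma streamField_value {ψ : ℝ × ℝ → ℝ} (hψ : IsTest slab ψ) (i : Fin 2) :
    (streamField ⟨ψ, hψ⟩).1 i = (hψ.curl i).toL2 := by
  fin_cases i <;> rfl

lemma streamField_partial {ψ : ℝ × ℝ → ℝ} (hψ : IsTest slab ψ) (i j : Fin 2) :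
    (streamField ⟨ψ, hψ⟩).2 i j = ((hψ.curl i).partial j).toL2 := by
  fin_cases i <;> rfl

/-- The closure in `H¹` of the fields `curl ψ` with `ψ` a test function on `Ω`: divergence free
fields that vanish on the two walls. -/
def solenoidal : Submodule ℝ GradField := (LinearMap.range streamField).topologicalClosure

lemma isClosed_solenoidal : IsClosed (solenoidal : Set GradField) :=
  Submodule.isClosed_topologicalClosure _

lemma solenoidal_induction {P : GradField → Prop} (hclosed : IsClosed {x | P x})
    (h : ∀ ψ (hψ : IsTest slab ψ), P (streamField ⟨ψ, hψ⟩)) {x : GradField}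
    (hx : x ∈ solenoidal) : P x :=
  closure_minimal (by rintro _ ⟨ψ, rfl⟩; exact h ψ.1 ψ.2) hclosed hx

lemma pairCLM_toL2_right {U W : Set (ℝ × ℝ)} (hU : MeasurableSet U) (hUs : U ⊆ slab)
    {χ : ℝ × ℝ → ℝ} (f : L2) (hχ : IsTest W χ) :
    pairCLM U f hχ.toL2 = pair U f χ := by
  rw [pairCLM_apply hU hUs]
  refine integral_congr_ae ?_
  filter_upwards [ae_mono (Measure.restrict_mono hUs le_rfl) hχ.coe_toL2] with x hx
  rw [hx]

lemma pairCLM_toL2 {U V W : Set (ℝ × ℝ)} (hU : MeasurableSet U) (hUs : U ⊆ slab)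
    {φ χ : ℝ × ℝ → ℝ} (hφ : IsTest V φ) (hχ : IsTest W χ) :
    pairCLM U hφ.toL2 hχ.toL2 = pair U φ χ := by
  rw [pairCLM_toL2_right hU hUs]
  exact pair_congr_left (ae_mono (Measure.restrict_mono hUs le_rfl) hφ.coe_toL2) χ

lemma IsTest.norm_toL2_sq {U : Set (ℝ × ℝ)} {φ : ℝ × ℝ → ℝ} (h : IsTest U φ) :
    ‖h.toL2‖ ^ 2 = pair slab φ φ := by
  rw [← real_inner_self_eq_norm_sq, ← pairCLM_slab, pairCLM_toL2 measurableSet_slab le_rfl]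

lemma continuous_pairCLM (U : Set (ℝ × ℝ)) {X : Type*} [TopologicalSpace X] {f g : X → L2}
    (hf : Continuous f) (hg : Continuous g) : Continuous fun x => pairCLM U (f x) (g x) :=
  ((pairCLM U).continuous.comp hf).clm_apply hg

lemma solenoidal_div {x : GradField} (hx : x ∈ solenoidal) : x.2 0 0 + x.2 1 1 = 0 := by
  refine solenoidal_induction (P := fun x => x.2 0 0 + x.2 1 1 = 0)
    (isClosed_eq (by fun_prop) continuous_const) (fun ψ hψ => ?_) hx
  rw [streamField_partial, streamField_partial]
  refine Lp.ext ?_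
  filter_upwards [Lp.coeFn_add ((hψ.curl 0).partial 0).toL2 ((hψ.curl 1).partial 1).toL2,
    ((hψ.curl 0).partial 0).coe_toL2, ((hψ.curl 1).partial 1).coe_toL2,
    Lp.coeFn_zero ℝ 2 (volume.restrict slab)] with x hadd h0 h1 hzero
  rw [hadd, hzero, Pi.add_apply, h0, h1, div_curl hψ.smooth, Pi.zero_apply]

lemma solenoidal_poincare {x : GradField} (hx : x ∈ solenoidal) (i : Fin 2) :
    ‖x.1 i‖ ^ 2 ≤ 4 * ‖x.2 i 1‖ ^ 2 := by
  refine solenoidal_induction (P := fun x => ‖x.1 i‖ ^ 2 ≤ 4 * ‖x.2 i 1‖ ^ 2)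
    (isClosed_le (by fun_prop) (by fun_prop)) (fun ψ hψ => ?_) hx
  rw [streamField_value, streamField_partial, IsTest.norm_toL2_sq, IsTest.norm_toL2_sq]
  exact (hψ.curl i).poincare

lemma solenoidal_trace {x : GradField} (hx : x ∈ solenoidal) :
    -2 * pairCLM upper (x.1 1) (x.2 1 1) ≤ (1 / 2) * ‖x.2 1 1‖ ^ 2 := by
  refine solenoidal_induction
    (P := fun x => -2 * pairCLM upper (x.1 1) (x.2 1 1) ≤ (1 / 2) * ‖x.2 1 1‖ ^ 2)
    (isClosed_le ((continuous_pairCLM _ (by fun_prop) (by fun_prop)).const_mul _) (by fun_prop))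
    (fun ψ hψ => ?_) hx
  rw [streamField_value, streamField_partial, IsTest.norm_toL2_sq,
    pairCLM_toL2 measurableSet_upper upper_subset_slab]
  exact (hψ.curl 1).trace_inequality

lemma solenoidal_transpose {x : GradField} (hx : x ∈ solenoidal) :
    ∑ i, ∑ j, inner ℝ (x.2 j i) (x.2 i j) = 0 := by
  simp only [← pairCLM_slab]
  refine solenoidal_induction (P := fun x => ∑ i, ∑ j, pairCLM slab (x.2 j i) (x.2 i j) = 0)
    (isClosed_eq (continuous_finsetSum _ fun i _ => continuous_finsetSum _ fun j _ =>
      continuous_pairCLM _ (by fun_prop) (by fun_prop)) continuous_const) (fun ψ hψ => ?_) hx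
  simp only [streamField_partial, pairCLM_toL2 measurableSet_slab le_rfl]
  exact integral_sum_transpose_curl hψ

/-! ### The forms of the weak formulation -/

/-- The form `∫ ρ u · w`. -/
def inertia (c : Coeffs) : (Fin 2 → L2) →L[ℝ] (Fin 2 → L2) →L[ℝ] ℝ :=
  ∑ i, (phasePair c.ρp c.ρm).bilinearComp (ContinuousLinearMap.proj i) (ContinuousLinearMap.proj i)

/-- The viscous form `∑ᵢⱼ ∫ μ (∂ⱼuᵢ + ∂ᵢuⱼ) ∂ⱼwᵢ`. -/
def viscous (c : Coeffs) : GradField →L[ℝ] GradField →L[ℝ] ℝ :=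
  ∑ i, ∑ j, (phasePair c.μp c.μm).bilinearComp (fieldPartial i j + fieldPartial j i)
    (fieldPartial i j)

/-- The form `∫ (B · ∇u) · (B · ∇w) - g[ρ] ∫ u₂ w₂ dx₁`, the latter integral being over the
interface and written as an integral over the upper phase. -/
def potential (c : Coeffs) (B : Fin 2 → ℝ) : GradField →L[ℝ] GradField →L[ℝ] ℝ :=
  (∑ i, ∑ l, ∑ m, (B l * B m) • (pairCLM slab).bilinearComp (fieldPartial i m) (fieldPartial i l))
  + c.gJump • ((pairCLM upper).bilinearComp (fieldValue 1) (fieldPartial 1 1)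
    + (pairCLM upper).bilinearComp (fieldPartial 1 1) (fieldValue 1))

lemma inertia_apply (c : Coeffs) (u w : Fin 2 → L2) :
    inertia c u w = ∑ i, phasePair c.ρp c.ρm (u i) (w i) := by
  simp [inertia]

lemma viscous_apply (c : Coeffs) (x y : GradField) :
    viscous c x y = ∑ i, ∑ j, phasePair c.μp c.μm (x.2 i j + x.2 j i) (y.2 i j) := by
  simp [viscous]

lemma potential_apply (c : Coeffs) (B : Fin 2 → ℝ) (x y : GradField) :
    potential c B x y
      = ∑ i, ∑ l, ∑ m, B l * B m * inner ℝ (x.2 i m) (y.2 i l)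
      + c.gJump * (pairCLM upper (x.1 1) (y.2 1 1) + pairCLM upper (x.2 1 1) (y.1 1)) := by
  simp [potential, pairCLM_slab, mul_add]

lemma inertia_comm (c : Coeffs) (u w : Fin 2 → L2) : inertia c u w = inertia c w u := by
  simp only [inertia_apply, phasePair_comm _ _ (u _)]

lemma potential_comm (c : Coeffs) (B : Fin 2 → ℝ) (x y : GradField) :
    potential c B x y = potential c B y x := by
  simp only [potential_apply, Fin.sum_univ_two, pairCLM_comm upper (x.1 1),
    pairCLM_comm upper (x.2 1 1), real_inner_comm (y.2 _ _)]
  ring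

lemma le_inertia_self (c : Coeffs) (u : Fin 2 → L2) :
    c.ρm * ∑ i, ‖u i‖ ^ 2 ≤ inertia c u u := by
  rw [inertia_apply, Finset.mul_sum]
  refine Finset.sum_le_sum fun i _ => ?_
  simpa only [min_eq_right c.ρm_lt_ρp.le] using min_mul_sq_norm_le_phasePair c.ρp c.ρm (u i)

lemma inertia_self_le (c : Coeffs) (u : Fin 2 → L2) :
    inertia c u u ≤ c.ρp * ∑ i, ‖u i‖ ^ 2 := by
  rw [inertia_apply, Finset.mul_sum]
  refine Finset.sum_le_sum fun i _ => ?_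
  simpa only [max_eq_left c.ρm_lt_ρp.le] using phasePair_self_le_max c.ρp c.ρm (u i)

lemma korn (c : Coeffs) {x : GradField} (hx : x ∈ solenoidal) :
    min c.μp c.μm * ∑ i, ∑ j, ‖x.2 i j‖ ^ 2 ≤ viscous c x x := by
  have hsymm : viscous c x x
      = (1 / 2) * ∑ i, ∑ j, phasePair c.μp c.μm (x.2 i j + x.2 j i) (x.2 i j + x.2 j i) := by
    simp only [viscous_apply, Fin.sum_univ_two, map_add, add_apply,
      phasePair_comm _ _ (x.2 1 0) (x.2 0 1)]
    ring
  have hnorm : ∑ i, ∑ j, ‖x.2 i j + x.2 j i‖ ^ 2 = 2 * ∑ i, ∑ j, ‖x.2 i j‖ ^ 2 := by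
    have htranspose := solenoidal_transpose hx
    simp only [Fin.sum_univ_two, norm_add_sq_real, real_inner_self_eq_norm_sq] at htranspose ⊢
    rw [real_inner_comm (x.2 0 1) (x.2 1 0)] at htranspose ⊢
    linarith
  calc min c.μp c.μm * ∑ i, ∑ j, ‖x.2 i j‖ ^ 2
      = (1 / 2) * ∑ i, ∑ j, min c.μp c.μm * ‖x.2 i j + x.2 j i‖ ^ 2 := by
        simp only [← Finset.mul_sum, hnorm]
        ring
    _ ≤ viscous c x x := by
        rw [hsymm]
        gcongr with i _ j _
        exact min_mul_sq_norm_le_phasePair _ _ _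

lemma weak_form_solenoidal {c : Coeffs} {B : Fin 2 → ℝ} {vt v η : Fin 2 → L2} {q : ℝ × ℝ → ℝ}
    {DV DN : Fin 2 → Fin 2 → L2}
    (hDN : ∀ i j, HasWeakPartial slab j (η i) (DN i j))
    (hDV : ∀ i j, HasWeakPartial slab j (v i) (DV i j))
    (hu : IsPhase upper c.ρp c.μp B (fun i => vt i) (fun i => v i) (fun i => η i) q)
    (hl : IsPhase lower c.ρm c.μm B (fun i => vt i) (fun i => v i) (fun i => η i) q)
    (hjump : StressJump c B (fun i => v i) (fun i => η i) q)
    {x : GradField} (hx : x ∈ solenoidal) :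
    inertia c vt x.1 + viscous c (v, DV) x + potential c B (η, DN) x = 0 := by
  refine solenoidal_induction
    (P := fun x => inertia c vt x.1 + viscous c (v, DV) x + potential c B (η, DN) x = 0)
    (isClosed_eq (by fun_prop) continuous_const) (fun ψ hψ => ?_) hx
  rw [← weak_form_curl hDN hDV hu hl hjump hψ]
  simp only [inertia_apply, viscous_apply, potential_apply, phasePair_apply, streamField_value,
    streamField_partial, ← pairCLM_upper_add_lower, map_add, add_apply,
    pairCLM_toL2_right measurableSet_upper upper_subset_slab,
    pairCLM_toL2_right measurableSet_lower lower_subset_slab, Fin.sum_univ_two]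
  ring

/-! ### Mollification and dilation -/

lemma tendsto_eLpNorm_sub_of_dominated {α G : Type*} [MeasurableSpace α] [NormedAddCommGroup G]
    {μ : Measure α} {p : ℝ≥0∞} (hp₀ : p ≠ 0) (hp : p ≠ ⊤) {F : ℕ → α → G} {f : α → G} {b : α → ℝ}
    (hF : ∀ n, AEStronglyMeasurable (F n) μ) (hf : AEStronglyMeasurable f μ) (hb : MemLp b p μ)
    (hbound : ∀ n, ∀ᵐ x ∂μ, ‖F n x - f x‖ ≤ ‖b x‖)
    (hlim : ∀ᵐ x ∂μ, Tendsto (fun n => F n x) atTop (𝓝 (f x))) :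
    Tendsto (fun n => eLpNorm (fun x => F n x - f x) p μ) atTop (𝓝 0) := by
  have hp' : 0 < p.toReal := ENNReal.toReal_pos hp₀ hp
  have hlintegral : Tendsto (fun n => ∫⁻ x, ‖F n x - f x‖ₑ ^ p.toReal ∂μ) atTop
      (𝓝 (∫⁻ _, 0 ∂μ)) := by
    refine tendsto_lintegral_of_dominated_convergence' (fun x => ‖b x‖ₑ ^ p.toReal)
      (fun n => ((hF n).sub hf).enorm.pow_const _) (fun n => ?_)
      (lintegral_rpow_enorm_lt_top_of_eLpNorm_lt_top hp₀ hp hb.2).ne ?_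
    · filter_upwards [hbound n] with x hx
      exact ENNReal.rpow_le_rpow (enorm_le_iff_norm_le.2 hx) hp'.le
    · filter_upwards [hlim] with x hx
      have h₀ : Tendsto (fun n => ‖F n x - f x‖ₑ) atTop (𝓝 0) := by
        simpa using (hx.sub_const (f x)).enorm
      simpa [ENNReal.zero_rpow_of_pos hp', Function.comp_def] using
        ((ENNReal.continuous_rpow_const (y := p.toReal)).tendsto 0).comp h₀
  rw [lintegral_zero] at hlintegral
  simp only [eLpNorm_eq_lintegral_rpow_enorm_toReal hp₀ hp]
  rw [← ENNReal.zero_rpow_of_pos (one_div_pos.2 hp')]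
  exact ((ENNReal.continuous_rpow_const (y := 1 / p.toReal)).tendsto 0).comp hlintegral

section Mollify

variable {E : Type*} [NormedAddCommGroup E] [NormedSpace ℝ E] [FiniteDimensional ℝ E]
  [MeasureSpace E]

/-- The convolution of `f` with the normalized bump function `ρ`, evaluated at `r x`. Dilating
by `r > 1` shrinks the support, which makes room for the mollification. -/
def dilatedMollify (ρ : ContDiffBump (0 : E)) (r : ℝ) (f : E → ℝ) (x : E) : ℝ :=
  (ρ.normed volume ⋆[ContinuousLinearMap.lsmul ℝ ℝ, volume] f) (r • x)

lemma dilatedMollify_eq_integral (ρ : ContDiffBump (0 : E)) (r : ℝ) (f : E → ℝ) (x : E) :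
    dilatedMollify ρ r f x = ∫ t, ρ.normed volume t * f (r • x - t) := rfl

variable [BorelSpace E] [(volume : Measure E).IsAddHaarMeasure]

lemma integrable_normed_mul_sub (ρ : ContDiffBump (0 : E)) {f : E → ℝ} (hf : LocallyIntegrable f)
    (x : E) : Integrable fun t => ρ.normed volume t * f (x - t) :=
  ρ.hasCompactSupport_normed.convolutionExists_left (ContinuousLinearMap.lsmul ℝ ℝ)
    ρ.continuous_normed hf x

lemma dilatedMollify_add (ρ : ContDiffBump (0 : E)) (r : ℝ) {f g : E → ℝ}
    (hf : LocallyIntegrable f) (hg : LocallyIntegrable g) :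
    dilatedMollify ρ r (f + g) = dilatedMollify ρ r f + dilatedMollify ρ r g := by
  ext x
  simp only [Pi.add_apply, dilatedMollify_eq_integral, mul_add]
  exact integral_add (integrable_normed_mul_sub ρ hf _) (integrable_normed_mul_sub ρ hg _)

lemma dilatedMollify_congr (ρ : ContDiffBump (0 : E)) (r : ℝ) {f g : E → ℝ}
    (hfg : f =ᵐ[volume] g) : dilatedMollify ρ r f = dilatedMollify ρ r g := by
  ext x
  refine integral_congr_ae ?_
  filter_upwards [(quasiMeasurePreserving_sub_left volume (r • x)).ae hfg] with t ht
  simp only [ht]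

lemma dilatedMollify_eq_zero (ρ : ContDiffBump (0 : E)) {r : ℝ} {f : E → ℝ} {x : E}
    (hf : ∀ y, dist y (r • x) < ρ.rOut → f y = 0) : dilatedMollify ρ r f x = 0 := by
  have h₀ : f (r • x) = 0 := hf _ (by simpa using ρ.rOut_pos)
  exact (ρ.normed_convolution_eq_right fun y hy => (hf y hy).trans h₀.symm).trans h₀

lemma contDiff_dilatedMollify (ρ : ContDiffBump (0 : E)) (r : ℝ) {f : E → ℝ}
    (hf : LocallyIntegrable f) : ContDiff ℝ ∞ (dilatedMollify ρ r f) :=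
  (ρ.hasCompactSupport_normed.contDiff_convolution_left _ ρ.contDiff_normed hf).comp
    (contDiff_id.const_smul r)

lemma eLpNorm_convolution_normed_le (ρ : ContDiffBump (0 : E)) {p : ℝ≥0∞} (hp₁ : 1 ≤ p)
    (hp : p ≠ ⊤) {f : E → ℝ} (hf : Measurable f) :
    eLpNorm (ρ.normed volume ⋆[ContinuousLinearMap.lsmul ℝ ℝ, volume] f) p volume
      ≤ eLpNorm f p volume := by
  lift p to ℝ≥0 using hp
  have hp₀ : p ≠ 0 := fun h => by simp [h] at hp₁
  have hρ : Measurable fun t => ENNReal.ofReal (ρ.normed volume t) :=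
    ρ.continuous_normed.measurable.ennreal_ofReal
  set ν : Measure E := volume.withDensity fun t => ENNReal.ofReal (ρ.normed volume t) with hν
  have : IsProbabilityMeasure ν := ⟨by
    rw [hν, withDensity_apply _ MeasurableSet.univ, Measure.restrict_univ,
      ← ofReal_integral_eq_lintegral_ofReal ρ.integrable_normed
      (Eventually.of_forall ρ.nonneg_normed), ρ.integral_normed, ENNReal.ofReal_one]⟩
  have jensen : ∀ x, ‖(ρ.normed volume ⋆[ContinuousLinearMap.lsmul ℝ ℝ, volume] f) x‖ₑ ^ (p : ℝ)
      ≤ ∫⁻ t, ‖f (x - t)‖ₑ ^ (p : ℝ) ∂ν := fun x => by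
    have hm : Measurable fun t => f (x - t) := hf.comp (measurable_const.sub measurable_id)
    rw [← eLpNorm_nnreal_pow_eq_lintegral hp₀]
    refine ENNReal.rpow_le_rpow (le_trans ?_ (eLpNorm_le_eLpNorm_of_exponent_le hp₁
      hm.aestronglyMeasurable)) p.2
    rw [eLpNorm_one_eq_lintegral_enorm, hν,
      lintegral_withDensity_eq_lintegral_mul _ hρ hm.enorm]
    refine (enorm_integral_le_lintegral_enorm _).trans (lintegral_mono fun t => ?_)
    simp [Real.enorm_of_nonneg (ρ.nonneg_normed t)]
  refine (ENNReal.rpow_le_rpow_iff (NNReal.coe_pos.2 (pos_iff_ne_zero.2 hp₀))).1 ?_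
  rw [eLpNorm_nnreal_pow_eq_lintegral hp₀, eLpNorm_nnreal_pow_eq_lintegral hp₀]
  calc _ ≤ ∫⁻ x, ∫⁻ t, ‖f (x - t)‖ₑ ^ (p : ℝ) ∂ν := lintegral_mono jensen
    _ = ∫⁻ t, (∫⁻ x, ‖f (x - t)‖ₑ ^ (p : ℝ)) ∂ν :=
        lintegral_lintegral_swap
          ((hf.comp (measurable_fst.sub measurable_snd)).enorm.pow_const _).aemeasurable
    _ = ∫⁻ _, (∫⁻ x, ‖f x‖ₑ ^ (p : ℝ)) ∂ν :=
        lintegral_congr fun t => lintegral_sub_right_eq_self (fun x => ‖f x‖ₑ ^ (p : ℝ)) t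
    _ = _ := by simp

lemma eLpNorm_comp_smul_le {f : E → ℝ} (hf : Measurable f) (p : ℝ≥0∞) {r : ℝ} (hr : 1 ≤ r) :
    eLpNorm (fun x => f (r • x)) p volume ≤ eLpNorm f p volume := by
  have hr₀ : r ≠ 0 := by positivity
  have hc : ENNReal.ofReal |(r ^ Module.finrank ℝ E)⁻¹| ≤ 1 := by
    rw [abs_of_nonneg (by positivity), ENNReal.ofReal_le_one]
    exact inv_le_one_of_one_le₀ (one_le_pow₀ hr)
  calc eLpNorm (fun x => f (r • x)) p volume
      = eLpNorm f p (Measure.map (fun x : E => r • x) volume) :=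
        (eLpNorm_map_measure hf.aestronglyMeasurable (measurable_const_smul r).aemeasurable).symm
    _ ≤ eLpNorm f p volume := by
        rw [Measure.map_addHaar_smul _ hr₀]
        refine eLpNorm_mono_measure _ (Measure.le_iff.2 fun s _ => ?_)
        exact mul_le_of_le_one_left zero_le hc

lemma eLpNorm_dilatedMollify_le (ρ : ContDiffBump (0 : E)) {r : ℝ} (hr : 1 ≤ r) {p : ℝ≥0∞}
    (hp₁ : 1 ≤ p) (hp : p ≠ ⊤) {f : E → ℝ} (hfm : Measurable f) (hf : LocallyIntegrable f) :
    eLpNorm (dilatedMollify ρ r f) p volume ≤ eLpNorm f p volume :=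
  (eLpNorm_comp_smul_le (ρ.hasCompactSupport_normed.contDiff_convolution_left (n := 0) _
    ρ.contDiff_normed hf).continuous.measurable p hr).trans
      (eLpNorm_convolution_normed_le ρ hp₁ hp hfm)

section Limit

variable {ρ : ℕ → ContDiffBump (0 : E)} {r : ℕ → ℝ}
  (hρ : Tendsto (fun n => (ρ n).rOut) atTop (𝓝 0)) (hρ₁ : ∀ n, (ρ n).rOut ≤ 1)
  (hr : Tendsto r atTop (𝓝 1)) (hr₁ : ∀ n, 1 ≤ r n) {p : ℝ≥0∞} (hp₁ : 1 ≤ p) (hp : p ≠ ⊤)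
  {f : E → ℝ}

include hρ hρ₁ hr hr₁ hp₁ hp

lemma tendsto_dilatedMollify_of_hasCompactSupport (hf : Continuous f) (hfc : HasCompactSupport f) :
    Tendsto (fun n => eLpNorm (fun x => dilatedMollify (ρ n) (r n) f x - f x) p volume)
      atTop (𝓝 0) := by
  obtain ⟨M, hM⟩ := hfc.exists_bound_of_continuous hf
  obtain ⟨R, hR⟩ := hfc.isBounded.subset_closedBall (0 : E)
  have hzero : ∀ y, R < ‖y‖ → f y = 0 := fun y hy =>
    image_eq_zero_of_notMem_tsupport fun h => (mem_closedBall_zero_iff.1 (hR h)).not_gt hy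
  have hbound : ∀ n x, ‖dilatedMollify (ρ n) (r n) f x - f x‖ ≤ 4 * M := fun n x => by
    have hdist : ∀ y z, dist (f y) (f z) ≤ 2 * M := fun y z => by
      rw [two_mul, dist_eq_norm]
      exact (norm_sub_le _ _).trans (add_le_add (hM y) (hM z))
    have h₁ : dist (dilatedMollify (ρ n) (r n) f x) (f (r n • x)) ≤ 2 * M :=
      ContDiffBump.dist_normed_convolution_le hf.aestronglyMeasurable fun y _ => hdist _ _
    rw [← dist_eq_norm]
    linarith [dist_triangle (dilatedMollify (ρ n) (r n) f x) (f (r n • x)) (f x),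
      hdist (r n • x) x]
  have houtside : ∀ n x, R + 1 < ‖x‖ → dilatedMollify (ρ n) (r n) f x = 0 := fun n x hx => by
    refine dilatedMollify_eq_zero _ fun y hy => hzero y ?_
    have h₁ : ‖x‖ ≤ ‖r n • x‖ := by
      rw [norm_smul, Real.norm_of_nonneg (zero_le_one.trans (hr₁ n))]
      exact le_mul_of_one_le_left (norm_nonneg x) (hr₁ n)
    rw [dist_comm, dist_eq_norm] at hy
    linarith [norm_sub_norm_le (r n • x) y, hρ₁ n]
  refine tendsto_eLpNorm_sub_of_dominated (zero_lt_one.trans_le hp₁).ne' hp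
    (b := (Metric.closedBall (0 : E) (R + 1)).indicator fun _ => 4 * M)
    (fun n => (contDiff_dilatedMollify _ _
      hf.locallyIntegrable).continuous.aestronglyMeasurable) hf.aestronglyMeasurable
    (memLp_indicator_const p Metric.isClosed_closedBall.measurableSet _
      (Or.inr (isCompact_closedBall _ _).measure_lt_top.ne))
    (fun n => Eventually.of_forall fun x => ?_) (Eventually.of_forall fun x => ?_)
  · by_cases hx : ‖x‖ ≤ R + 1
    · rw [indicator_of_mem (mem_closedBall_zero_iff.2 hx)]
      exact (hbound n x).trans (le_abs_self _)
    · simp [houtside n x (not_le.1 hx), hzero x (by linarith)]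
  · exact ContDiffBump.convolution_tendsto_right (g := fun _ => f) hρ
      (Eventually.of_forall fun _ => hf.aestronglyMeasurable)
      ((hf.tendsto x).comp tendsto_snd) (by simpa using hr.smul_const x)

lemma tendsto_dilatedMollify (hfm : Measurable f) (hf : MemLp f p volume) :
    Tendsto (fun n => eLpNorm (fun x => dilatedMollify (ρ n) (r n) f x - f x) p volume)
      atTop (𝓝 0) := by
  rw [ENNReal.tendsto_nhds_zero]
  intro ε hε
  have hε₃ : ε / 3 ≠ 0 := (ENNReal.div_pos hε.ne' (by norm_num)).ne'
  obtain ⟨g, hgc, hgε, hg, -⟩ := hf.exists_hasCompactSupport_eLpNorm_sub_le hp hε₃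
  have hgl : LocallyIntegrable g := hg.locallyIntegrable
  have hd : Measurable (f - g) := hfm.sub hg.measurable
  have hdl : LocallyIntegrable (f - g) := (hf.locallyIntegrable hp₁).sub hgl
  have hlim := ENNReal.tendsto_nhds_zero.1 (tendsto_dilatedMollify_of_hasCompactSupport hρ hρ₁ hr
    hr₁ hp₁ hp hg hgc) (ε / 3) (pos_iff_ne_zero.2 hε₃)
  filter_upwards [hlim] with n hn
  have hsplit : (fun x => dilatedMollify (ρ n) (r n) f x - f x)
      = (dilatedMollify (ρ n) (r n) (f - g) + fun x => dilatedMollify (ρ n) (r n) g x - g x)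
        - (f - g) := by
    have h := dilatedMollify_add (ρ n) (r n) hdl hgl
    rw [sub_add_cancel] at h
    ext x
    simp only [h, Pi.add_apply, Pi.sub_apply]
    ring
  have hmd := (contDiff_dilatedMollify (ρ n) (r n) hdl).continuous.aestronglyMeasurable
    (μ := volume)
  have hmg : AEStronglyMeasurable (fun x => dilatedMollify (ρ n) (r n) g x - g x) volume :=
    ((contDiff_dilatedMollify (ρ n) (r n) hgl).continuous.sub hg).aestronglyMeasurable
  rw [hsplit]
  calc _ ≤ _ := eLpNorm_sub_le (hmd.add hmg) hd.aestronglyMeasurable hp₁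
    _ ≤ (ε / 3 + ε / 3) + ε / 3 := by
        gcongr
        refine (eLpNorm_add_le hmd hmg hp₁).trans (add_le_add ?_ hn)
        exact (eLpNorm_dilatedMollify_le (ρ n) (hr₁ n) hp₁ hp hd hdl).trans hgε
    _ = ε := ENNReal.add_thirds ε

end Limit

end Mollify

/-! ### Stream functions -/

lemma fderiv_eq_sum_classicalPartial (f : ℝ × ℝ → ℝ) (x y : ℝ × ℝ) :
    fderiv ℝ f x y = y.1 * classicalPartial 0 f x + y.2 * classicalPartial 1 f x := by
  have hy : y = y.1 • dir 0 + y.2 • dir 1 := by ext <;> simp [dir]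
  conv_lhs => rw [hy]
  simp [classicalPartial]

lemma exists_curl_eq {w : Fin 2 → ℝ × ℝ → ℝ} (hw : ∀ i, ContDiff ℝ ∞ (w i))
    (hdiv : ∀ x, classicalPartial 0 (w 0) x + classicalPartial 1 (w 1) x = 0) (x₀ : ℝ × ℝ) :
    ∃ ψ : ℝ × ℝ → ℝ, ContDiff ℝ ∞ ψ ∧ ψ x₀ = 0 ∧ curl ψ = w := by
  set ξ : ℝ × ℝ → (ℝ × ℝ →L[ℝ] ℝ) := fun x =>
    w 0 x • ContinuousLinearMap.snd ℝ ℝ ℝ - w 1 x • ContinuousLinearMap.fst ℝ ℝ ℝ with hξ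
  have hξ_smooth : ContDiff ℝ ∞ ξ := ((hw 0).smul contDiff_const).sub ((hw 1).smul contDiff_const)
  have hd : ∀ i x, DifferentiableAt ℝ (w i) x := fun i x => (hw i).differentiable (by simp) x
  have hfderiv : ∀ a, fderiv ℝ ξ a = (fderiv ℝ (w 0) a).smulRight (ContinuousLinearMap.snd ℝ ℝ ℝ)
      - (fderiv ℝ (w 1) a).smulRight (ContinuousLinearMap.fst ℝ ℝ ℝ) := fun a =>
    (((hd 0 a).hasFDerivAt.smul_const _).sub ((hd 1 a).hasFDerivAt.smul_const _)).fderiv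
  obtain ⟨ψ, hψ⟩ := convex_univ.exists_forall_hasFDerivAt_of_fderiv_symmetric (s := univ)
    isOpen_univ (hξ_smooth.differentiable (by simp)).differentiableOn (fun a _ x y => by
      rw [hfderiv]
      simp only [sub_apply, ContinuousLinearMap.smulRight_apply, smul_apply,
        ContinuousLinearMap.coe_snd', ContinuousLinearMap.coe_fst', smul_eq_mul,
        fderiv_eq_sum_classicalPartial (w 0), fderiv_eq_sum_classicalPartial (w 1)]
      linear_combination (x.1 * y.2 - y.1 * x.2) * hdiv a)
  have hψ' : fderiv ℝ (fun x => ψ x - ψ x₀) = ξ := funext fun x =>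
    ((hψ x (mem_univ x)).sub_const _).fderiv
  refine ⟨fun x => ψ x - ψ x₀, ?_, sub_self _, ?_⟩
  · rw [contDiff_infty_iff_fderiv, hψ']
    exact ⟨fun x => (hψ x (mem_univ x)).differentiableAt.sub_const _, hξ_smooth⟩
  · ext i x
    fin_cases i <;> simp [curl, classicalPartial, hψ', hξ, dir]

lemma eq_of_curl_eq_zero {ψ : ℝ × ℝ → ℝ} (hψ : Differentiable ℝ ψ) {S : Set (ℝ × ℝ)}
    (hS : Convex ℝ S) (hcurl : ∀ x ∈ S, ∀ i, curl ψ i x = 0) {x y : ℝ × ℝ} (hx : x ∈ S)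
    (hy : y ∈ S) : ψ x = ψ y := by
  have hfderiv : ∀ z ∈ S, ‖fderiv ℝ ψ z‖ ≤ 0 := fun z hz => by
    have h0 : classicalPartial 0 ψ z = 0 := neg_eq_zero.1 (hcurl z hz 1)
    have h1 : classicalPartial 1 ψ z = 0 := hcurl z hz 0
    refine (norm_eq_zero.2 (ContinuousLinearMap.ext fun v => ?_)).le
    simp [fderiv_eq_sum_classicalPartial ψ, h0, h1]
  have h := hS.norm_image_sub_le_of_norm_fderiv_le (fun z _ => hψ z) hfderiv hy hx
  rw [zero_mul] at h
  exact sub_eq_zero.1 (norm_le_zero_iff.1 h)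

lemma hasDerivAt_vertical {f : ℝ × ℝ → ℝ} (hf : Differentiable ℝ f) (s y : ℝ) :
    HasDerivAt (fun y => f (s, y)) (classicalPartial 1 f (s, y)) y :=
  (hf (s, y)).hasFDerivAt.comp_hasDerivAt y ((hasDerivAt_const y s).prodMk (hasDerivAt_id y))

section VanishingBelow

variable {a b : ℝ} {f : ℝ × ℝ → ℝ}

lemma sq_le_mul_integral_vertical (hf : ContDiff ℝ ∞ f) {s y : ℝ} (h0 : f (s, a) = 0)
    (hy : y ∈ Icc a b) :
    f (s, y) ^ 2 ≤ (b - a) * ∫ z in Ioo a b, classicalPartial 1 f (s, z) ^ 2 := by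
  have hc : Continuous fun z => classicalPartial 1 f (s, z) :=
    (contDiff_classicalPartial hf 1).continuous.comp (by fun_prop)
  have hftc : ∫ z in a..y, classicalPartial 1 f (s, z) = f (s, y) := by
    rw [intervalIntegral.integral_eq_sub_of_hasDerivAt
      (fun z _ => hasDerivAt_vertical (hf.differentiable (by simp)) s z)
      (hc.intervalIntegrable _ _), h0, sub_zero]
  have hnonneg : 0 ≤ ∫ z in a..y, classicalPartial 1 f (s, z) ^ 2 :=
    intervalIntegral.integral_nonneg hy.1 fun z _ => sq_nonneg _
  calc f (s, y) ^ 2 ≤ (y - a) * ∫ z in a..y, classicalPartial 1 f (s, z) ^ 2 := by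
        rw [← hftc]
        exact sq_intervalIntegral_le hy.1 (hc.intervalIntegrable _ _)
          ((hc.pow 2).intervalIntegrable _ _)
    _ ≤ (b - a) * ∫ z in a..b, classicalPartial 1 f (s, z) ^ 2 :=
        mul_le_mul (by linarith [hy.2]) (intervalIntegral.integral_mono_interval le_rfl hy.1 hy.2
          (Eventually.of_forall fun z => sq_nonneg _) ((hc.pow 2).intervalIntegrable _ _))
          hnonneg (by linarith [hy.1, hy.2])
    _ = _ := by
        rw [intervalIntegral.integral_of_le (hy.1.trans hy.2), integral_Ioc_eq_integral_Ioo]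

lemma eq_zero_of_memLp_vertical (hab : a ≤ b) (hf : ContDiff ℝ ∞ f) (ha : ∀ s, f (s, a) = 0)
    (hL : MemLp (classicalPartial 1 f) 2 volume) {c : ℝ} (hb : ∀ s, f (s, b) = c) : c = 0 := by
  have hint : Integrable fun _ : ℝ => c ^ 2 := by
    refine ((integrable_setIntegral_strip (a := a) (b := b) hL.integrable_sq).const_mul
      (b - a)).mono' aestronglyMeasurable_const (Eventually.of_forall fun s => ?_)
    rw [Real.norm_of_nonneg (sq_nonneg _), ← hb s]
    exact sq_le_mul_integral_vertical hf (ha s) (right_mem_Icc.2 hab)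
  rcases integrable_const_iff.1 hint with h | h
  · exact pow_eq_zero_iff two_ne_zero |>.1 h
  · simpa using h.measure_univ_lt_top

lemma memLp_of_memLp_vertical (hf : ContDiff ℝ ∞ f) (ha : ∀ s, f (s, a) = 0)
    (hL : MemLp (classicalPartial 1 f) 2 volume) : MemLp f 2 (volume.restrict (strip a b)) := by
  rw [memLp_two_iff_integrable_sq hf.continuous.aestronglyMeasurable]
  have hrestrict : volume.restrict (strip a b)
      = (volume : Measure ℝ).prod (volume.restrict (Ioo a b)) := by
    rw [strip, Measure.volume_eq_prod, ← Measure.prod_restrict, Measure.restrict_univ]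
  have hint : Integrable (fun x : ℝ × ℝ => (b - a) *
      ∫ z in Ioo a b, classicalPartial 1 f (x.1, z) ^ 2) (volume.restrict (strip a b)) := by
    rw [hrestrict]
    exact ((integrable_setIntegral_strip hL.integrable_sq).const_mul (b - a)).comp_fst _
  refine hint.mono' (hf.continuous.pow 2).aestronglyMeasurable ?_
  filter_upwards [ae_restrict_mem (measurableSet_strip a b)] with x hx
  rw [Real.norm_of_nonneg (sq_nonneg _)]
  exact sq_le_mul_integral_vertical hf (ha x.1) ⟨(mem_strip.1 hx).1.le, (mem_strip.1 hx).2.le⟩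

end VanishingBelow

lemma tsupport_subset_slab {f : ℝ × ℝ → ℝ} {r : ℝ} (hr : r < 1)
    (hf : ∀ x, r ≤ |x.2| → f x = 0) : tsupport f ⊆ slab := by
  have h : tsupport f ⊆ {x | |x.2| ≤ r} :=
    closure_minimal (fun x hx => not_lt.1 fun hxr => hx (hf x hxr.le))
      (isClosed_le (by fun_prop) continuous_const)
  exact fun x hx => mem_strip.2 (abs_lt.1 ((h hx).trans_lt hr))

/-- Below the support of `w` the stream function can be normalized to vanish; above it, it is then
constant, and this constant must vanish since `w₁` is square integrable: there is no net flux. -/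
lemma exists_stream_of_strip {w : Fin 2 → ℝ × ℝ → ℝ} (hw : ∀ i, ContDiff ℝ ∞ (w i))
    (hdiv : ∀ x, classicalPartial 0 (w 0) x + classicalPartial 1 (w 1) x = 0) {r : ℝ}
    (hr : r < 1) (hsupp : ∀ i x, r ≤ |x.2| → w i x = 0) (hL : MemLp (w 0) 2 volume) :
    ∃ ψ : ℝ × ℝ → ℝ, ContDiff ℝ ∞ ψ ∧ curl ψ = w ∧ tsupport ψ ⊆ slab ∧
      MemLp ψ 2 (volume.restrict slab) := by
  obtain ⟨ψ, hψ, hψ0, rfl⟩ := exists_curl_eq hw hdiv (0, -1)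
  have hdiff : Differentiable ℝ ψ := hψ.differentiable (by simp)
  have hbelow : ∀ x : ℝ × ℝ, x.2 ≤ -r → ψ x = 0 := fun x hx =>
    (eq_of_curl_eq_zero hdiff (S := {x : ℝ × ℝ | x.2 ≤ -r})
      (convex_halfSpace_le (LinearMap.snd ℝ ℝ ℝ).isLinear (-r))
      (fun z (hz : z.2 ≤ -r) i => hsupp i z (le_abs.2 (.inr (by linarith)))) hx
      (show (-1 : ℝ) ≤ -r by linarith)).trans hψ0
  have hconst : ∀ x : ℝ × ℝ, r ≤ x.2 → ψ x = ψ (0, 1) := fun x hx =>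
    eq_of_curl_eq_zero hdiff (S := {x : ℝ × ℝ | r ≤ x.2})
      (convex_halfSpace_ge (LinearMap.snd ℝ ℝ ℝ).isLinear r)
      (fun z (hz : r ≤ z.2) i => hsupp i z (le_abs.2 (.inl hz))) hx hr.le
  have hbottom : ∀ s, ψ (s, -1) = 0 := fun s => hbelow _ (show (-1 : ℝ) ≤ -r by linarith)
  have hflux : ψ (0, 1) = 0 :=
    eq_zero_of_memLp_vertical (by norm_num) hψ hbottom hL fun s => hconst (s, 1) hr.le
  refine ⟨ψ, hψ, rfl, tsupport_subset_slab hr fun x hx => ?_,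
    memLp_of_memLp_vertical hψ hbottom hL⟩
  rcases le_abs.1 hx with h | h
  · rw [hconst x h, hflux]
  · exact hbelow x (by linarith)

/-! ### Divergence free fields as limits of test fields -/

/-- Convergence of the functions `g n`, uniformly bounded and pointwise, to the constant `ℓ`: the
mode of convergence of cutoff functions and of their derivatives. -/
structure BoundedTendsto {α : Type*} [TopologicalSpace α] (g : ℕ → α → ℝ) (ℓ : ℝ) : Prop where
  continuous : ∀ n, Continuous (g n)
  bounded : ∃ K, ∀ n x, |g n x| ≤ K
  tendsto : ∀ x, Tendsto (fun n => g n x) atTop (𝓝 ℓ)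

/-- Convergence `F n → f` in `L²(Ω)` of measurable functions, which need not be square integrable
themselves. -/
structure L2Tendsto (F : ℕ → ℝ × ℝ → ℝ) (f : ℝ × ℝ → ℝ) : Prop where
  aestronglyMeasurable : ∀ n, AEStronglyMeasurable (F n) (volume.restrict slab)
  aestronglyMeasurable_limit : AEStronglyMeasurable f (volume.restrict slab)
  tendsto : Tendsto (fun n => eLpNorm (fun x => F n x - f x) 2 (volume.restrict slab)) atTop (𝓝 0)

lemma L2Tendsto.add {F G : ℕ → ℝ × ℝ → ℝ} {f g : ℝ × ℝ → ℝ} (hF : L2Tendsto F f)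
    (hG : L2Tendsto G g) : L2Tendsto (fun n x => F n x + G n x) (fun x => f x + g x) where
  aestronglyMeasurable n := (hF.aestronglyMeasurable n).add (hG.aestronglyMeasurable n)
  aestronglyMeasurable_limit := hF.aestronglyMeasurable_limit.add hG.aestronglyMeasurable_limit
  tendsto := by
    have h := hF.tendsto.add hG.tendsto
    rw [add_zero] at h
    refine tendsto_of_tendsto_of_tendsto_of_le_of_le tendsto_const_nhds h (fun _ => zero_le)
      fun n => ?_
    have hsplit : (fun x => F n x + G n x - (f x + g x))
        = (fun x => F n x - f x) + fun x => G n x - g x :=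
      funext fun x => add_sub_add_comm _ _ _ _
    simp only [hsplit]
    exact eLpNorm_add_le ((hF.aestronglyMeasurable n).sub hF.aestronglyMeasurable_limit)
      ((hG.aestronglyMeasurable n).sub hG.aestronglyMeasurable_limit) one_le_two

lemma L2Tendsto.congr_limit {F : ℕ → ℝ × ℝ → ℝ} {f f' : ℝ × ℝ → ℝ} (hF : L2Tendsto F f)
    (h : f =ᵐ[volume.restrict slab] f') : L2Tendsto F f' where
  aestronglyMeasurable := hF.aestronglyMeasurable
  aestronglyMeasurable_limit := hF.aestronglyMeasurable_limit.congr h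
  tendsto := hF.tendsto.congr fun n => eLpNorm_congr_ae (by filter_upwards [h] with x hx; rw [hx])

lemma L2Tendsto.tendsto_toL2 {F : ℕ → ℝ × ℝ → ℝ} {f : L2} {U : Set (ℝ × ℝ)}
    (hF : L2Tendsto F f) (h : ∀ n, IsTest U (F n)) :
    Tendsto (fun n => (h n).toL2) atTop (𝓝 f) := by
  rw [Lp.tendsto_Lp_iff_tendsto_eLpNorm']
  refine hF.tendsto.congr fun n => eLpNorm_congr_ae ?_
  filter_upwards [(h n).coe_toL2] with x hx
  rw [Pi.sub_apply, hx]

lemma BoundedTendsto.l2Tendsto_mul {g : ℕ → ℝ × ℝ → ℝ} {ℓ : ℝ} (hg : BoundedTendsto g ℓ)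
    {f : ℝ × ℝ → ℝ} (hf : MemLp f 2 (volume.restrict slab)) :
    L2Tendsto (fun n x => g n x * f x) (fun x => ℓ * f x) := by
  obtain ⟨K, hK⟩ := hg.bounded
  have hm : ∀ n, AEStronglyMeasurable (fun x => g n x * f x) (volume.restrict slab) :=
    fun n => (hg.continuous n).aestronglyMeasurable.mul hf.1
  refine ⟨hm, hf.1.const_mul ℓ, tendsto_eLpNorm_sub_of_dominated two_ne_zero ENNReal.ofNat_ne_top hm
    (hf.1.const_mul ℓ) (hf.const_mul (K + |ℓ|)) (fun n => Eventually.of_forall fun x => ?_)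
    (Eventually.of_forall fun x => (hg.tendsto x).mul_const _)⟩
  rw [← sub_mul, norm_mul, norm_mul]
  gcongr
  calc ‖g n x - ℓ‖ ≤ |g n x| + |ℓ| := abs_sub _ _
    _ ≤ K + |ℓ| := by gcongr; exact hK n x
    _ ≤ ‖K + |ℓ|‖ := le_abs_self _

lemma BoundedTendsto.of_dilation {E : Type*} [NormedAddCommGroup E] [NormedSpace ℝ E] {f : E → ℝ}
    (hf : Continuous f) (hfc : HasCompactSupport f) {a b : ℕ → ℝ} {ℓ : ℝ}
    (ha : Tendsto a atTop (𝓝 0)) (hb : Tendsto b atTop (𝓝 ℓ)) :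
    BoundedTendsto (fun n x => b n * f (a n • x)) (ℓ * f 0) where
  continuous n := by fun_prop
  bounded := by
    obtain ⟨K, hK⟩ := hfc.exists_bound_of_continuous hf
    obtain ⟨M, hM⟩ := (Metric.isBounded_range_of_tendsto b hb).exists_norm_le
    refine ⟨M * K, fun n x => ?_⟩
    rw [abs_mul]
    exact mul_le_mul (hM _ ⟨n, rfl⟩) (hK _) (abs_nonneg _)
      ((norm_nonneg _).trans (hM _ ⟨n, rfl⟩))
  tendsto x := by
    have hax : Tendsto (fun n => a n • x) atTop (𝓝 0) := by simpa using ha.smul_const x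
    exact hb.mul ((hf.tendsto 0).comp hax)

lemma L2Tendsto.classicalPartial_mul {χ : ℕ → ℝ × ℝ → ℝ} {ℓ : ℝ} {f : ℝ × ℝ → ℝ} {j : Fin 2}
    (hχ : ∀ n, Differentiable ℝ (χ n)) (hf : Differentiable ℝ f) (hlim : BoundedTendsto χ ℓ)
    (hlim' : BoundedTendsto (fun n => classicalPartial j (χ n)) 0)
    (hfL : MemLp f 2 (volume.restrict slab))
    (hfL' : MemLp (classicalPartial j f) 2 (volume.restrict slab)) :
    L2Tendsto (fun n => classicalPartial j fun x => χ n x * f x)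
      (fun x => ℓ * classicalPartial j f x) := by
  have hprod : (fun n => classicalPartial j fun x => χ n x * f x)
      = fun n x => χ n x * classicalPartial j f x + classicalPartial j (χ n) x * f x := by
    ext n x
    exact RayleighTaylorMHD.classicalPartial_mul (hχ n x) (hf x) j
  rw [hprod]
  refine ((hlim.l2Tendsto_mul hfL').add (hlim'.l2Tendsto_mul hfL)).congr_limit
    (Eventually.of_forall fun x => ?_)
  simp only [zero_mul, add_zero]

lemma classicalPartial_comp_smul (j : Fin 2) (f : ℝ × ℝ → ℝ) (r : ℝ) :
    classicalPartial j (fun x => f (r • x)) = fun x => r * classicalPartial j f (r • x) := by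
  ext x
  simp only [classicalPartial, fderiv_comp_smul, smul_apply, smul_eq_mul]

lemma curl_comp_smul (i : Fin 2) (f : ℝ × ℝ → ℝ) (r : ℝ) :
    curl (fun x => f (r • x)) i = fun x => r * curl f i (r • x) := by
  fin_cases i
  · exact classicalPartial_comp_smul 1 f r
  · ext x
    simp [curl, classicalPartial_comp_smul]

lemma curl_mul {f g : ℝ × ℝ → ℝ} (hf : Differentiable ℝ f) (hg : Differentiable ℝ g) (i : Fin 2) :
    curl (fun x => f x * g x) i = fun x => f x * curl g i x + curl f i x * g x := by
  ext x
  fin_cases i <;> simp [curl, classicalPartial_mul (hf x) (hg x)]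
  ring

lemma contDiff_curl {ψ : ℝ × ℝ → ℝ} (hψ : ContDiff ℝ ∞ ψ) (i : Fin 2) :
    ContDiff ℝ ∞ (curl ψ i) := by
  fin_cases i
  · exact contDiff_classicalPartial hψ 1
  · exact (contDiff_classicalPartial hψ 0).neg

lemma exists_cutoff_plane : ∃ χ : ℕ → ℝ × ℝ → ℝ, (∀ n, IsTest univ (χ n)) ∧
    BoundedTendsto χ 1 ∧ (∀ j, BoundedTendsto (fun n => classicalPartial j (χ n)) 0) ∧
    (∀ i, BoundedTendsto (fun n => curl (χ n) i) 0) ∧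
    ∀ i j, BoundedTendsto (fun n => classicalPartial j (curl (χ n) i)) 0 := by
  let β : ContDiffBump (0 : ℝ × ℝ) := ⟨1, 2, one_pos, one_lt_two⟩
  have hβ : IsTest univ β := ⟨β.contDiff, β.hasCompactSupport, subset_univ _⟩
  let a : ℕ → ℝ := fun n => 1 / ((n : ℝ) + 1)
  have ha : Tendsto a atTop (𝓝 0) := tendsto_one_div_add_atTop_nhds_zero_nat
  have ha2 : Tendsto (fun n => a n * a n) atTop (𝓝 0) := by simpa using ha.mul ha
  have ha0 : ∀ n, a n ≠ 0 := fun n => one_div_ne_zero (by positivity)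
  have key : ∀ {f : ℝ × ℝ → ℝ} {b : ℕ → ℝ}, IsTest univ f → Tendsto b atTop (𝓝 0) →
      BoundedTendsto (fun n x => b n * f (a n • x)) 0 := fun {f b} hf hb => by
    simpa only [zero_mul] using BoundedTendsto.of_dilation hf.smooth.continuous hf.compact ha hb
  refine ⟨fun n x => β (a n • x), fun n => ⟨hβ.smooth.comp (contDiff_const_smul _),
    hβ.compact.comp_smul (ha0 n), subset_univ _⟩, ?_, fun j => ?_, fun i => ?_, fun i j => ?_⟩
  · have hβ0 : β 0 = 1 := β.one_of_mem_closedBall (by simp [β])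
    simpa [hβ0] using BoundedTendsto.of_dilation hβ.smooth.continuous hβ.compact ha
      (tendsto_const_nhds (x := (1 : ℝ)))
  · simpa only [classicalPartial_comp_smul] using key (hβ.partial j) ha
  · simpa only [curl_comp_smul] using key (hβ.curl i) ha
  · have hd : ∀ n, classicalPartial j (fun x => a n * curl β i (a n • x))
        = fun x => a n * a n * classicalPartial j (curl β i) (a n • x) := fun n => by
      ext x
      have hdiff : DifferentiableAt ℝ (fun x => curl β i (a n • x)) x :=
        ((hβ.curl i).smooth.comp (contDiff_const_smul _)).differentiable (by simp) x
      rw [classicalPartial_const_mul _ hdiff, classicalPartial_comp_smul, mul_assoc]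
    simpa only [curl_comp_smul, hd] using key ((hβ.curl i).partial j) ha2

lemma mem_solenoidal_of_tendsto {ψ : ℕ → ℝ × ℝ → ℝ} (hψ : ∀ n, IsTest slab (ψ n)) {X : GradField}
    (hvalue : ∀ i, L2Tendsto (fun n => curl (ψ n) i) (X.1 i))
    (hpartial : ∀ i j, L2Tendsto (fun n => classicalPartial j (curl (ψ n) i)) (X.2 i j)) :
    X ∈ solenoidal := by
  have hlim : Tendsto (fun n => streamField ⟨ψ n, hψ n⟩) atTop (𝓝 X) := by
    refine (Prod.tendsto_iff _ _).2 ⟨tendsto_pi_nhds.2 fun i => ?_,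
      tendsto_pi_nhds.2 fun i => tendsto_pi_nhds.2 fun j => ?_⟩
    · simp only [streamField_value]
      exact (hvalue i).tendsto_toL2 fun n => (hψ n).curl i
    · simp only [streamField_partial]
      exact (hpartial i j).tendsto_toL2 fun n => ((hψ n).curl i).partial j
  exact isClosed_solenoidal.mem_of_tendsto hlim (Eventually.of_forall fun n =>
    Submodule.le_topologicalClosure _ ⟨⟨ψ n, hψ n⟩, rfl⟩)

lemma mem_solenoidal_of_stream {ψ : ℝ × ℝ → ℝ} (hψ : ContDiff ℝ ∞ ψ) (hsupp : tsupport ψ ⊆ slab)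
    (hψL : MemLp ψ 2 (volume.restrict slab))
    (hL : ∀ i, MemLp (curl ψ i) 2 (volume.restrict slab))
    (hL' : ∀ i j, MemLp (classicalPartial j (curl ψ i)) 2 (volume.restrict slab)) {X : GradField}
    (hX : ∀ i, X.1 i =ᵐ[volume.restrict slab] curl ψ i)
    (hX' : ∀ i j, X.2 i j =ᵐ[volume.restrict slab] classicalPartial j (curl ψ i)) :
    X ∈ solenoidal := by
  obtain ⟨χ, hχ, hlim, hlim_partial, hlim_curl, hlim_partial_curl⟩ := exists_cutoff_plane
  have hχd : ∀ n, Differentiable ℝ (χ n) := fun n => (hχ n).smooth.differentiable (by simp)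
  have hχcd : ∀ n i, Differentiable ℝ (curl (χ n) i) := fun n i =>
    ((hχ n).curl i).smooth.differentiable (by simp)
  have hψd : Differentiable ℝ ψ := hψ.differentiable (by simp)
  have hcd : ∀ i, Differentiable ℝ (curl ψ i) := fun i =>
    (contDiff_curl hψ i).differentiable (by simp)
  have hψL' : ∀ j, MemLp (classicalPartial j ψ) 2 (volume.restrict slab) := fun j => by
    fin_cases j
    · exact (memLp_neg_iff (f := classicalPartial 0 ψ)).1 (hL 1)
    · exact hL 0
  have htest : ∀ n, IsTest slab fun x => χ n x * ψ x := fun n => by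
    simpa only [mul_comm] using (hχ n).mul_left hψ (inter_subset_right.trans hsupp)
  refine mem_solenoidal_of_tendsto htest (fun i => ?_) fun i j => ?_
  · simp only [curl_mul (hχd _) hψd]
    refine ((hlim.l2Tendsto_mul (hL i)).add ((hlim_curl i).l2Tendsto_mul hψL)).congr_limit ?_
    filter_upwards [hX i] with x hx
    rw [hx, one_mul, zero_mul, add_zero]
  · have hsum : ∀ n, classicalPartial j (curl (fun x => χ n x * ψ x) i)
        = fun x => classicalPartial j (fun x => χ n x * curl ψ i x) x
          + classicalPartial j (fun x => curl (χ n) i x * ψ x) x := fun n => by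
      ext x
      rw [curl_mul (hχd n) hψd]
      exact classicalPartial_add ((hχd n x).mul (hcd i x)) ((hχcd n i x).mul (hψd x)) j
    simp only [hsum]
    refine ((L2Tendsto.classicalPartial_mul hχd (hcd i) hlim (hlim_partial j) (hL i)
      (hL' i j)).add (L2Tendsto.classicalPartial_mul (fun n => hχcd n i) hψd (hlim_curl i)
      (hlim_partial_curl i j) hψL (hψL' j))).congr_limit ?_
    filter_upwards [hX' i j] with x hx
    rw [hx, one_mul, zero_mul, add_zero]

lemma mem_solenoidal_of_smooth {w : Fin 2 → ℝ × ℝ → ℝ} (hw : ∀ i, ContDiff ℝ ∞ (w i))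
    (hdiv : ∀ x, classicalPartial 0 (w 0) x + classicalPartial 1 (w 1) x = 0) {r : ℝ}
    (hr : r < 1) (hsupp : ∀ i x, r ≤ |x.2| → w i x = 0) (hL : ∀ i, MemLp (w i) 2 volume)
    (hL' : ∀ i j, MemLp (classicalPartial j (w i)) 2 volume) {X : GradField}
    (hX : ∀ i, X.1 i =ᵐ[volume.restrict slab] w i)
    (hX' : ∀ i j, X.2 i j =ᵐ[volume.restrict slab] classicalPartial j (w i)) :
    X ∈ solenoidal := by
  obtain ⟨ψ, hψ, rfl, hψ_supp, hψL⟩ := exists_stream_of_strip hw hdiv hr hsupp (hL 0)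
  exact mem_solenoidal_of_stream hψ hψ_supp hψL (fun i => (hL i).restrict slab)
    (fun i j => (hL' i j).restrict slab) hX hX'

/-! ### Extension by zero and approximation of solenoidal fields -/

lemma IsTest.exists_split_strip {a b : ℝ} (hab : a < b) {φ : ℝ × ℝ → ℝ} (hφ : IsTest univ φ) :
    ∃ φ₁ φ₂, IsTest (univ ×ˢ Iio b) φ₁ ∧ IsTest (univ ×ˢ Ioi a) φ₂ ∧
      φ = fun x => φ₁ x + φ₂ x := by
  set s : ℝ → ℝ := fun y => Real.smoothTransition (3 * (y - a) / (b - a) - 1)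
  have hs : ContDiff ℝ ∞ s := Real.smoothTransition.contDiff.comp (by fun_prop)
  have hs_zero : tsupport s ⊆ Ici ((2 * a + b) / 3) :=
    closure_minimal (fun y hy => not_lt.1 fun (h : y < _) => hy <|
      Real.smoothTransition.zero_of_nonpos <|
      sub_nonpos.2 <| (div_le_one (sub_pos.2 hab)).2 (by linarith)) isClosed_Ici
  have hs_one : tsupport (1 - s) ⊆ Iic ((a + 2 * b) / 3) :=
    closure_minimal (fun y hy => not_lt.1 fun (h : _ < y) => hy <| sub_eq_zero.2 <| Eq.symm <|
      Real.smoothTransition.one_of_one_le <| le_sub_iff_add_le.2 <|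
        (le_div_iff₀ (sub_pos.2 hab)).2 (by linarith)) isClosed_Iic
  have hs_zero' : Ici ((2 * a + b) / 3) ⊆ Ioi a := Ici_subset_Ioi.2 (by linarith)
  have hs_one' : Iic ((a + 2 * b) / 3) ⊆ Iio b := Iic_subset_Iio.2 (by linarith)
  refine ⟨fun x => (1 - s) x.2 * φ x, fun x => s x.2 * φ x, hφ.mul_left
    ((contDiff_const.sub hs).comp contDiff_snd) fun x hx => ⟨mem_univ _, hs_one' (hs_one ?_)⟩,
    hφ.mul_left (hs.comp contDiff_snd) fun x hx => ⟨mem_univ _, hs_zero' (hs_zero ?_)⟩, ?_⟩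
  · exact tsupport_comp_subset_preimage (1 - s) continuous_snd hx.2
  · exact tsupport_comp_subset_preimage s continuous_snd hx.2
  · ext x
    simp only [Pi.sub_apply, Pi.one_apply]
    ring

lemma boundaryTerm_add_right {U V W : Set (ℝ × ℝ)} {f φ θ : ℝ × ℝ → ℝ}
    (hf : LocallyIntegrable f (volume.restrict U))
    (hDf : LocallyIntegrable (weakPartial U 1 f) (volume.restrict U)) (hφ : IsTest V φ)
    (hθ : IsTest W θ) :
    boundaryTerm U f (fun x => φ x + θ x) = boundaryTerm U f φ + boundaryTerm U f θ := by
  have hpair : ∀ {g φ θ : ℝ × ℝ → ℝ}, LocallyIntegrable g (volume.restrict U) → IsTest V φ →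
      IsTest W θ → pair U g (fun x => φ x + θ x) = pair U g φ + pair U g θ := fun hg hφ hθ => by
    simp only [pair, mul_add]
    exact integral_add (hφ.integrable_mul hg) (hθ.integrable_mul hg)
  have hpartial : classicalPartial 1 (fun x => φ x + θ x)
      = fun x => classicalPartial 1 φ x + classicalPartial 1 θ x := funext fun x =>
    classicalPartial_add (hφ.smooth.differentiable (by simp) x)
      (hθ.smooth.differentiable (by simp) x) 1
  rw [boundaryTerm, hpartial, hpair hf (hφ.partial 1) (hθ.partial 1), hpair hDf hφ hθ,
    boundaryTerm, boundaryTerm]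
  ring

lemma boundaryTerm_eq_zero_of_trace_zero {a b : ℝ} (hab : a < b) {f φ : ℝ × ℝ → ℝ}
    (hl : HasLowerTrace a b f 0) (hu : HasUpperTrace a b f 0) (hφ : IsTest univ φ) :
    boundaryTerm (strip a b) f φ = 0 := by
  have hDf : LocallyIntegrable (weakPartial (strip a b) 1 f) (volume.restrict (strip a b)) := by
    obtain ⟨-, -, g, hg, hgl, -⟩ := hl
    exact hgl.congr (hg.weakPartial_ae (isOpen_strip a b)).symm
  obtain ⟨φ₁, φ₂, hφ₁, hφ₂, rfl⟩ := hφ.exists_split_strip hab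
  simp [boundaryTerm_add_right hl.2.1 hDf hφ₁ hφ₂, hl.boundaryTerm_eq hφ₁, hu.boundaryTerm_eq hφ₂]

lemma locallyIntegrable_indicator {X : Type*} [TopologicalSpace X] [MeasurableSpace X]
    {μ : Measure X} {U : Set X} (hU : MeasurableSet U) {f : X → ℝ}
    (hf : LocallyIntegrable f (μ.restrict U)) : LocallyIntegrable (U.indicator f) μ := fun x => by
  obtain ⟨N, hN, hfN⟩ := hf x
  refine ⟨N, hN, (integrable_indicator_iff hU).2 ?_⟩
  rwa [IntegrableOn, Measure.restrict_comm hU]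

lemma setIntegral_univ_indicator_mul {U : Set (ℝ × ℝ)} (hU : MeasurableSet U)
    (f φ : ℝ × ℝ → ℝ) : ∫ x in univ, U.indicator f x * φ x = pair U f φ := by
  rw [setIntegral_univ, pair, ← integral_indicator hU]
  simp only [indicator_mul_left]

lemma HasWeakPartial.indicator {a b : ℝ} (hab : a < b) {j : Fin 2} {f g : ℝ × ℝ → ℝ}
    (h : HasWeakPartial (strip a b) j f g)
    (hg : LocallyIntegrable g (volume.restrict (strip a b)))
    (hl : HasLowerTrace a b f 0) (hu : HasUpperTrace a b f 0) :
    HasWeakPartial univ j ((strip a b).indicator f) ((strip a b).indicator g) := by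
  have hm := measurableSet_strip a b
  refine ⟨(locallyIntegrable_indicator hm hl.2.1).locallyIntegrableOn _,
    (locallyIntegrable_indicator hm hg).locallyIntegrableOn _, fun φ hφ => ?_⟩
  rw [setIntegral_univ_indicator_mul hm, setIntegral_univ_indicator_mul hm]
  obtain rfl | rfl : j = 0 ∨ j = 1 := by fin_cases j <;> simp
  · exact h.integral_horizontal hab hl.2.1 hg hφ
  · have hzero := boundaryTerm_eq_zero_of_trace_zero hab hl hu hφ
    rw [boundaryTerm, pair_congr_left (h.weakPartial_ae (isOpen_strip a b))] at hzero
    exact eq_neg_of_add_eq_zero_left hzero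

lemma classicalPartial_comp_const_sub {f : ℝ × ℝ → ℝ} (hf : Differentiable ℝ f) (j : Fin 2)
    (x t : ℝ × ℝ) : classicalPartial j (fun t => f (x - t)) t = -classicalPartial j f (x - t) := by
  have h := (hf (x - t)).hasFDerivAt.comp t ((hasFDerivAt_id t).const_sub x)
  change fderiv ℝ (f ∘ fun t => x - t) t (dir j) = _
  rw [HasFDerivAt.fderiv h]
  simp [classicalPartial]

lemma classicalPartial_convolution {κ f : ℝ × ℝ → ℝ} (hκ : IsTest univ κ)
    (hf : LocallyIntegrable f) (j : Fin 2) (x : ℝ × ℝ) :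
    classicalPartial j (κ ⋆[ContinuousLinearMap.lsmul ℝ ℝ, volume] f) x
      = ∫ t, f t * classicalPartial j κ (x - t) := by
  have hκ1 : ContDiff ℝ 1 κ := hκ.smooth.of_le (by simp)
  have hexists := (hκ.compact.fderiv ℝ).convolutionExists_left
    ((ContinuousLinearMap.lsmul ℝ ℝ).precompL (ℝ × ℝ)) (hκ1.continuous_fderiv one_ne_zero) hf x
  rw [classicalPartial, (hκ.compact.hasFDerivAt_convolution_left _ hκ1 hf x).fderiv,
    convolution_def, ContinuousLinearMap.integral_apply hexists]
  simp only [mul_comm (f _)]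
  exact convolution_lsmul_swap (f := classicalPartial j κ)

lemma HasWeakPartial.classicalPartial_dilatedMollify {f g : ℝ × ℝ → ℝ} {j : Fin 2}
    (h : HasWeakPartial univ j f g) (ρ : ContDiffBump (0 : ℝ × ℝ)) (r : ℝ) :
    classicalPartial j (dilatedMollify ρ r f) = fun x => r * dilatedMollify ρ r g x := by
  have hκ : IsTest univ (ρ.normed volume) :=
    ⟨ρ.contDiff_normed, ρ.hasCompactSupport_normed, subset_univ _⟩
  refine (classicalPartial_comp_smul j _ r).trans (funext fun x => ?_)
  have hshift : IsTest univ fun t => ρ.normed volume (r • x - t) :=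
    ⟨hκ.smooth.comp (contDiff_const.sub contDiff_id),
      hκ.compact.comp_homeomorph (Homeomorph.subLeft (r • x)), subset_univ _⟩
  have hweak := h.2.2 _ hshift
  simp only [setIntegral_univ, mul_neg, integral_neg, neg_inj,
    classicalPartial_comp_const_sub (hκ.smooth.differentiable (by simp))] at hweak
  rw [classicalPartial_convolution hκ (locallyIntegrableOn_univ.1 h.1), hweak, dilatedMollify,
    convolution_lsmul_swap]
  simp only [smul_eq_mul, mul_comm]

lemma dilatedMollify_slab_eq_zero (ρ : ContDiffBump (0 : ℝ × ℝ)) {r : ℝ} (hr : 0 < r)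
    (f : ℝ × ℝ → ℝ) {x : ℝ × ℝ} (hx : (1 + ρ.rOut) / r ≤ |x.2|) :
    dilatedMollify ρ r (slab.indicator f) x = 0 := by
  refine dilatedMollify_eq_zero ρ fun y hy => indicator_of_notMem (fun hys => ?_) _
  have hy₁ : |y.2| < 1 := abs_lt.2 (mem_strip.1 hys)
  have hy₂ : |y.2 - r * x.2| < ρ.rOut :=
    (norm_snd_le (y - r • x)).trans_lt (by rwa [dist_eq_norm] at hy)
  have hrx : |r * x.2| ≤ |y.2| + |y.2 - r * x.2| := by
    simpa using abs_sub y.2 (y.2 - r * x.2)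
  rw [abs_mul, abs_of_pos hr, mul_comm] at hrx
  linarith [(div_le_iff₀ hr).1 hx]

lemma L2.memLp_indicator (f : L2) : MemLp (slab.indicator f) 2 volume :=
  (memLp_indicator_iff_restrict measurableSet_slab).2 (Lp.memLp f)

lemma L2.locallyIntegrable_indicator (f : L2) : LocallyIntegrable (slab.indicator f) :=
  f.memLp_indicator.locallyIntegrable one_le_two

lemma L2.measurable_indicator (f : L2) : Measurable (slab.indicator f) :=
  (Lp.stronglyMeasurable f).measurable.indicator measurableSet_slab

lemma memLp_dilatedMollify_indicator (ρ : ContDiffBump (0 : ℝ × ℝ)) {r : ℝ} (hr : 1 ≤ r)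
    (f : L2) : MemLp (dilatedMollify ρ r (slab.indicator f)) 2 volume :=
  ⟨(contDiff_dilatedMollify ρ r f.locallyIntegrable_indicator).continuous.aestronglyMeasurable,
    (eLpNorm_dilatedMollify_le ρ hr one_le_two ENNReal.ofNat_ne_top f.measurable_indicator
      f.locallyIntegrable_indicator).trans_lt f.memLp_indicator.2⟩

/-- The smooth approximation of `f ∈ L²(Ω)` obtained by mollifying its dilated extension by zero. -/
def regularize (ρ : ContDiffBump (0 : ℝ × ℝ)) {r : ℝ} (hr : 1 ≤ r) (f : L2) : L2 :=
  ((memLp_dilatedMollify_indicator ρ hr f).restrict slab).toLp _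

lemma coe_regularize (ρ : ContDiffBump (0 : ℝ × ℝ)) {r : ℝ} (hr : 1 ≤ r) (f : L2) :
    regularize ρ hr f =ᵐ[volume.restrict slab] dilatedMollify ρ r (slab.indicator f) :=
  MemLp.coeFn_toLp _

lemma tendsto_regularize {ρ : ℕ → ContDiffBump (0 : ℝ × ℝ)} {r : ℕ → ℝ}
    (hρ : Tendsto (fun n => (ρ n).rOut) atTop (𝓝 0)) (hρ₁ : ∀ n, (ρ n).rOut ≤ 1)
    (hr : Tendsto r atTop (𝓝 1)) (hr₁ : ∀ n, 1 ≤ r n) (f : L2) :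
    Tendsto (fun n => regularize (ρ n) (hr₁ n) f) atTop (𝓝 f) := by
  rw [Lp.tendsto_Lp_iff_tendsto_eLpNorm']
  refine tendsto_of_tendsto_of_tendsto_of_le_of_le tendsto_const_nhds
    (tendsto_dilatedMollify hρ hρ₁ hr hr₁ one_le_two ENNReal.ofNat_ne_top f.measurable_indicator
      f.memLp_indicator) (fun _ => zero_le) fun n => ?_
  refine (eLpNorm_congr_ae ?_).trans_le (eLpNorm_mono_measure _ Measure.restrict_le_self)
  filter_upwards [coe_regularize (ρ n) (hr₁ n) f, ae_restrict_mem measurableSet_slab] with x hx hxs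
  rw [Pi.sub_apply, hx, indicator_of_mem hxs]

lemma regularize_mem_solenoidal {X : GradField}
    (hX : ∀ i j, HasWeakPartial univ j (slab.indicator (X.1 i)) (slab.indicator (X.2 i j)))
    (hdiv : ∀ᵐ x ∂(volume.restrict slab), X.2 0 0 x + X.2 1 1 x = 0)
    (ρ : ContDiffBump (0 : ℝ × ℝ)) {r : ℝ} (hr : 1 ≤ r) (hρr : 1 + ρ.rOut < r) :
    (((fun i => regularize ρ hr (X.1 i)), fun i j => r • regularize ρ hr (X.2 i j)) : GradField)
      ∈ solenoidal := by
  have hr₀ : 0 < r := one_pos.trans_le hr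
  have hpartial := fun i j => (hX i j).classicalPartial_dilatedMollify ρ r
  have hsum : slab.indicator (X.2 0 0) + slab.indicator (X.2 1 1) =ᵐ[volume] 0 := by
    rw [← indicator_add']
    filter_upwards [(ae_restrict_iff' measurableSet_slab).1 hdiv] with x hx
    exact indicator_apply_eq_zero.2 hx
  have hdiv' : dilatedMollify ρ r (slab.indicator (X.2 0 0))
      + dilatedMollify ρ r (slab.indicator (X.2 1 1)) = 0 := by
    rw [← dilatedMollify_add ρ r (X.2 0 0).locallyIntegrable_indicator
      (X.2 1 1).locallyIntegrable_indicator, dilatedMollify_congr ρ r hsum]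
    exact funext fun x => dilatedMollify_eq_zero ρ fun _ _ => rfl
  refine mem_solenoidal_of_smooth (w := fun i => dilatedMollify ρ r (slab.indicator (X.1 i)))
    (fun i => contDiff_dilatedMollify ρ r (X.1 i).locallyIntegrable_indicator) (fun x => ?_)
    ((div_lt_one hr₀).2 hρr) (fun i x => dilatedMollify_slab_eq_zero ρ hr₀ _)
    (fun i => memLp_dilatedMollify_indicator ρ hr _) (fun i j => ?_)
    (fun i => coe_regularize ρ hr _) fun i j => ?_
  · simp only [hpartial, ← mul_add]
    exact mul_eq_zero_of_right r (congrFun hdiv' x)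
  · rw [hpartial]
    exact (memLp_dilatedMollify_indicator ρ hr _).const_mul r
  · rw [hpartial]
    filter_upwards [Lp.coeFn_smul r (regularize ρ hr (X.2 i j)), coe_regularize ρ hr (X.2 i j)]
      with x hx hx'
    rw [hx, Pi.smul_apply, hx', smul_eq_mul]

theorem mem_solenoidal {X : GradField} (hX : ∀ i j, HasWeakPartial slab j (X.1 i) (X.2 i j))
    (hdiv : ∀ᵐ x ∂(volume.restrict slab), X.2 0 0 x + X.2 1 1 x = 0)
    (hl : ∀ i, HasLowerTrace (-1) 1 (X.1 i) 0) (hu : ∀ i, HasUpperTrace (-1) 1 (X.1 i) 0) :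
    X ∈ solenoidal := by
  have hext : ∀ i j, HasWeakPartial univ j (slab.indicator (X.1 i)) (slab.indicator (X.2 i j)) :=
    fun i j => (hX i j).indicator (by norm_num) ((Lp.memLp _).locallyIntegrable one_le_two)
      (hl i) (hu i)
  set ε : ℕ → ℝ := fun n => 1 / ((n : ℝ) + 1)
  have hε_pos : ∀ n, 0 < ε n := fun n => Nat.one_div_pos_of_nat
  have hε_le : ∀ n, ε n ≤ 1 := fun n =>
    (div_le_one (by positivity)).2 (le_add_of_nonneg_left n.cast_nonneg)
  have hε : Tendsto ε atTop (𝓝 0) := tendsto_one_div_add_atTop_nhds_zero_nat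
  let ρ : ℕ → ContDiffBump (0 : ℝ × ℝ) := fun n =>
    ⟨ε n / 2, ε n, half_pos (hε_pos n), half_lt_self (hε_pos n)⟩
  have hr : ∀ n, 1 ≤ 1 + 2 * ε n := fun n => by linarith [hε_pos n]
  have hrlim : Tendsto (fun n => 1 + 2 * ε n) atTop (𝓝 1) := by
    simpa using (hε.const_mul 2).const_add 1
  have hlim := tendsto_regularize (ρ := ρ) hε hε_le hrlim hr
  have hlimX : Tendsto (fun n => (((fun i => regularize (ρ n) (hr n) (X.1 i)),
      fun i j => (1 + 2 * ε n) • regularize (ρ n) (hr n) (X.2 i j)) : GradField)) atTop (𝓝 X) :=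
    (Prod.tendsto_iff _ _).2 ⟨tendsto_pi_nhds.2 fun i => hlim _, tendsto_pi_nhds.2 fun i =>
      tendsto_pi_nhds.2 fun j => by simpa using hrlim.smul (hlim (X.2 i j))⟩
  exact isClosed_solenoidal.mem_of_tendsto hlimX (Eventually.of_forall fun n =>
    regularize_mem_solenoidal hext hdiv (ρ n) (hr n) (by
      change 1 + ε n < 1 + 2 * ε n
      linarith [hε_pos n]))

/-! ### Damped evolutions -/

section Paths

variable {E : Type*} [NormedAddCommGroup E] [NormedSpace ℝ E] {f f' : ℝ → E} {T t d : ℝ}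

lemma eq_of_hasDerivWithinAt_zero (hf : ∀ s ∈ Icc 0 T, HasDerivWithinAt f 0 (Icc 0 T) s)
    (ht : t ∈ Icc 0 T) : f t = f 0 := by
  have hdist := (convex_Icc 0 T).norm_image_sub_le_of_norm_hasDerivWithin_le (C := 0) hf
    (fun s _ => norm_zero.le) ⟨le_rfl, ht.1.trans ht.2⟩ ht
  rw [zero_mul] at hdist
  exact sub_eq_zero.1 (norm_le_zero_iff.1 hdist)

/-- The difference quotient in time with step `d`. -/
def diffQuot (d : ℝ) (f : ℝ → E) (t : ℝ) : E := d⁻¹ • (f (t + d) - f t)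

lemma map_diffQuot {F : Type*} [NormedAddCommGroup F] [NormedSpace ℝ F] (A : E →L[ℝ] F) (d : ℝ)
    (f : ℝ → E) (t : ℝ) : A (diffQuot d f t) = diffQuot d (fun s => A (f s)) t := by
  simp only [diffQuot, map_smul, map_sub]

lemma mapsTo_add_Icc (hd : 0 ≤ d) : MapsTo (fun t => t + d) (Icc 0 (T - d)) (Icc 0 T) :=
  fun _ ht => ⟨add_nonneg ht.1 hd, le_sub_iff_add_le.1 ht.2⟩

lemma Icc_sub_subset (hd : 0 ≤ d) : Icc 0 (T - d) ⊆ Icc 0 T :=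
  Icc_subset_Icc le_rfl (sub_le_self T hd)

lemma hasDerivWithinAt_diffQuot (hd : 0 ≤ d)
    (hf : ∀ s ∈ Icc 0 T, HasDerivWithinAt f (f' s) (Icc 0 T) s) (ht : t ∈ Icc 0 (T - d)) :
    HasDerivWithinAt (diffQuot d f) (diffQuot d f' t) (Icc 0 (T - d)) t := by
  have hshift := (hf _ (mapsTo_add_Icc hd ht)).scomp t
    (((hasDerivAt_id t).add_const d).hasDerivWithinAt) (mapsTo_add_Icc hd)
  rw [one_smul] at hshift
  exact (hshift.sub ((hf t (Icc_sub_subset hd ht)).mono (Icc_sub_subset hd))).const_smul d⁻¹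

lemma continuousOn_diffQuot (hd : 0 ≤ d) (hf : ContinuousOn f (Icc 0 T)) :
    ContinuousOn (diffQuot d f) (Icc 0 (T - d)) :=
  ((hf.comp (by fun_prop) (mapsTo_add_Icc hd)).sub (hf.mono (Icc_sub_subset hd))).const_smul d⁻¹

lemma tendsto_diffQuot_right {e : E} (hf : HasDerivWithinAt f e (Icc 0 T) t) (ht : t ∈ Ico 0 T) :
    Tendsto (fun d => diffQuot d f t) (𝓝[>] 0) (𝓝 e) := by
  have hslope := (hasDerivWithinAt_iff_tendsto_slope' self_notMem_Ioi).1
    (hf.mono_of_mem_nhdsWithin (Icc_mem_nhdsGT_of_mem ht))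
  have hright : Tendsto (fun d => t + d) (𝓝[>] 0) (𝓝[>] t) :=
    tendsto_nhdsWithin_iff.2 ⟨(((continuous_const_add t).tendsto' 0 t (add_zero t)).mono_left
      nhdsWithin_le_nhds), eventually_mem_nhdsWithin.mono fun d hd => lt_add_of_pos_right t hd⟩
  refine (hslope.comp hright).congr fun d => ?_
  simp only [Function.comp_apply, slope_def_module, add_sub_cancel_left, diffQuot]

lemma tendsto_diffQuot_left {e : E} (hf : HasDerivWithinAt f e (Icc 0 T) t) (ht : t ∈ Ioc 0 T) :
    Tendsto (fun d => diffQuot d f (t - d)) (𝓝[>] 0) (𝓝 e) := by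
  have hslope := (hasDerivWithinAt_iff_tendsto_slope' self_notMem_Iio).1
    (hf.mono_of_mem_nhdsWithin (Icc_mem_nhdsLT_of_mem ht))
  have hleft : Tendsto (fun d => t - d) (𝓝[>] 0) (𝓝[<] t) :=
    tendsto_nhdsWithin_iff.2 ⟨(((continuous_sub_left t).tendsto' 0 t (sub_zero t)).mono_left
      nhdsWithin_le_nhds), eventually_mem_nhdsWithin.mono fun d hd => sub_lt_self t hd⟩
  refine (hslope.comp hleft).congr fun d => ?_
  rw [Function.comp_apply, slope_comm]
  simp only [slope_def_module, sub_sub_cancel, diffQuot, sub_add_cancel]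

end Paths

section DampedEvolution

variable {H X G : Type*} [NormedAddCommGroup H] [NormedSpace ℝ H] [NormedAddCommGroup X]
  [NormedSpace ℝ X] [NormedAddCommGroup G] [NormedSpace ℝ G]

/-- The weak form `m(vₜ, ·) + a(V, ·) + k(N, ·) = 0` on `S`, with `∂ₜN = V`, of a second order
evolution equation with the damping form `a`. The form domain `X` is mapped to the space `H` of the
inertial form by `π`, and only `π V` is differentiated in time. -/
structure IsDampedEvolution (π : X →L[ℝ] H) (m : H →L[ℝ] H →L[ℝ] ℝ) (a k : X →L[ℝ] X →L[ℝ] ℝ)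
    (S : Submodule ℝ X) (T : ℝ) (V : ℝ → X) (vt : ℝ → H) (N : ℝ → X) : Prop where
  continuousOn_velocity : ContinuousOn V (Icc 0 T)
  deriv_velocity : ∀ t ∈ Icc 0 T, HasDerivWithinAt (fun s => π (V s)) (vt t) (Icc 0 T) t
  deriv_displacement : ∀ t ∈ Icc 0 T, HasDerivWithinAt N (V t) (Icc 0 T) t
  velocity_mem : ∀ t ∈ Icc 0 T, V t ∈ S
  weak_form : ∀ t ∈ Icc 0 T, ∀ x ∈ S, m (vt t) (π x) + a (V t) x + k (N t) x = 0

/-- The form `k` is controlled by the seminorm `x ↦ ‖L x‖`: it is coercive on `S` and bounded on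
the whole space. -/
structure IsCoerciveForm (k : X →L[ℝ] X →L[ℝ] ℝ) (S : Submodule ℝ X) (L : X →L[ℝ] G)
    (κ M : ℝ) : Prop where
  κ_pos : 0 < κ
  coercive : ∀ x ∈ S, κ * ‖L x‖ ^ 2 ≤ k x x
  bound : ∀ x y, |k x y| ≤ M * (‖L x‖ * ‖L y‖)

lemma two_mul_mul_le_of_pos {κ : ℝ} (hκ : 0 < κ) (M p q : ℝ) :
    2 * (M * (p * q)) ≤ κ / 2 * q ^ 2 + 2 * M ^ 2 / κ * p ^ 2 := by
  have hsq : κ / 2 * q ^ 2 + 2 * M ^ 2 / κ * p ^ 2 - 2 * (M * (p * q))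
      = (κ * q - 2 * M * p) ^ 2 / (2 * κ) := by
    field_simp
    ring
  have : 0 ≤ (κ * q - 2 * M * p) ^ 2 / (2 * κ) := by positivity
  linarith

lemma IsCoerciveForm.le_add {k : X →L[ℝ] X →L[ℝ] ℝ} {S : Submodule ℝ X} {L : X →L[ℝ] G} {κ M : ℝ}
    (hk : IsCoerciveForm k S L κ M) (hsymm : ∀ x y, k x y = k y x) (x : X) {z : X} (hz : z ∈ S) :
    κ / 4 * ‖L (x + z)‖ ^ 2 + k x x ≤ k (x + z) (x + z) + (2 * M ^ 2 / κ + κ / 2) * ‖L x‖ ^ 2 := by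
  have hκ := hk.κ_pos
  have hexpand : k (x + z) (x + z) = k x x + 2 * k x z + k z z := by
    simp only [map_add, add_apply, hsymm z x]
    ring
  have hcross := (abs_le.1 (hk.bound x z)).1
  have hyoung := two_mul_mul_le_of_pos hκ M ‖L x‖ ‖L z‖
  have hcoercive := hk.coercive z hz
  have hnorm : ‖L (x + z)‖ ^ 2 ≤ 2 * ‖L x‖ ^ 2 + 2 * ‖L z‖ ^ 2 := by
    rw [map_add, ← mul_add]
    exact (pow_le_pow_left₀ (norm_nonneg _) (norm_add_le _ _) 2).trans add_sq_le
  have := mul_le_mul_of_nonneg_left hnorm (by positivity : 0 ≤ κ / 4)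
  linarith

namespace IsDampedEvolution

variable {π : X →L[ℝ] H} {m : H →L[ℝ] H →L[ℝ] ℝ} {a k : X →L[ℝ] X →L[ℝ] ℝ} {S : Submodule ℝ X}
  {T : ℝ} {V : ℝ → X} {vt : ℝ → H} {N : ℝ → X}

lemma hasDerivWithinAt_energy (h : IsDampedEvolution π m a k S T V vt N)
    (hm : ∀ u w, m u w = m w u) (hk : ∀ x y, k x y = k y x) {t : ℝ} (ht : t ∈ Icc 0 T) :
    HasDerivWithinAt (fun s => m (π (V s)) (π (V s)) + k (N s) (N s)) (-(2 * a (V t) (V t)))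
      (Icc 0 T) t := by
  have hkin := (m.hasFDerivAt.comp_hasDerivWithinAt t (h.deriv_velocity t ht)).clm_apply
    (h.deriv_velocity t ht)
  have hpot := (k.hasFDerivAt.comp_hasDerivWithinAt t (h.deriv_displacement t ht)).clm_apply
    (h.deriv_displacement t ht)
  refine (hkin.add hpot).congr_deriv ?_
  have hweak := h.weak_form t ht _ (h.velocity_mem t ht)
  simp only [Function.comp_apply]
  rw [hm (π (V t)), hk (V t)]
  linarith

lemma continuousOn_damping (h : IsDampedEvolution π m a k S T V vt N) :
    ContinuousOn (fun t => a (V t) (V t)) (Icc 0 T) :=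
  (a.continuous.comp_continuousOn h.continuousOn_velocity).clm_apply h.continuousOn_velocity

lemma energy_identity (h : IsDampedEvolution π m a k S T V vt N)
    (hm : ∀ u w, m u w = m w u) (hk : ∀ x y, k x y = k y x) {t : ℝ} (ht : t ∈ Icc 0 T) :
    m (π (V t)) (π (V t)) + k (N t) (N t) + 2 * ∫ s in (0 : ℝ)..t, a (V s) (V s)
      = m (π (V 0)) (π (V 0)) + k (N 0) (N 0) := by
  have hsub : Icc 0 t ⊆ Icc 0 T := Icc_subset_Icc le_rfl ht.2
  have hderiv := fun s hs => h.hasDerivWithinAt_energy hm hk (t := s) (hsub hs)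
  have hFTC := intervalIntegral.integral_eq_sub_of_hasDerivAt_of_le ht.1
    (fun s hs => ((hderiv s hs).continuousWithinAt).mono hsub)
    (fun s hs => (hderiv s (Ioo_subset_Icc_self hs)).hasDerivAt
      (Icc_mem_nhds hs.1 (hs.2.trans_le ht.2)))
    (((h.continuousOn_damping.mono hsub).const_smul (2 : ℝ)).neg.intervalIntegrable_of_Icc ht.1)
  simp only [intervalIntegral.integral_neg, intervalIntegral.integral_const_mul] at hFTC
  linarith

lemma displacement_sub_mem (h : IsDampedEvolution π m a k S T V vt N)
    (hS : IsClosed (S : Set X)) {t : ℝ} (ht : t ∈ Icc 0 T) : N t - N 0 ∈ S := by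
  have hderiv : ∀ s ∈ Icc 0 T, HasDerivWithinAt (fun s => S.mkQL (N s)) 0 (Icc 0 T) s := by
    intro s hs
    have hq := S.mkQL.hasFDerivAt.comp_hasDerivWithinAt s (h.deriv_displacement s hs)
    rwa [show S.mkQL (V s) = 0 from (Submodule.Quotient.mk_eq_zero S).2 (h.velocity_mem s hs)] at hq
  have hconst : S.mkQL (N t) = S.mkQL (N 0) :=
    eq_of_hasDerivWithinAt_zero hderiv ht
  exact (Submodule.Quotient.eq S).1 hconst

lemma energy_le (h : IsDampedEvolution π m a k S T V vt N) (hS : IsClosed (S : Set X))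
    (hm : ∀ u w, m u w = m w u) (hk : ∀ x y, k x y = k y x) {L : X →L[ℝ] G} {κ M : ℝ}
    (hL : IsCoerciveForm k S L κ M) {t : ℝ} (ht : t ∈ Icc 0 T) :
    m (π (V t)) (π (V t)) + κ / 4 * ‖L (N t)‖ ^ 2 + 2 * ∫ s in (0 : ℝ)..t, a (V s) (V s)
      ≤ m (π (V 0)) (π (V 0)) + (2 * M ^ 2 / κ + κ / 2) * ‖L (N 0)‖ ^ 2 := by
  have hgrowth := hL.le_add hk (N 0) (h.displacement_sub_mem hS ht)
  rw [add_sub_cancel] at hgrowth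
  linarith [h.energy_identity hm hk ht]

protected lemma diffQuot (h : IsDampedEvolution π m a k S T V vt N) {d : ℝ} (hd : 0 ≤ d) :
    IsDampedEvolution π m a k S (T - d) (diffQuot d V) (diffQuot d vt) (diffQuot d N) where
  continuousOn_velocity := continuousOn_diffQuot hd h.continuousOn_velocity
  deriv_velocity t ht := by
    rw [funext (map_diffQuot π d V)]
    exact hasDerivWithinAt_diffQuot hd h.deriv_velocity ht
  deriv_displacement t ht := hasDerivWithinAt_diffQuot hd h.deriv_displacement ht
  velocity_mem t ht := S.smul_mem _ (S.sub_mem (h.velocity_mem _ (mapsTo_add_Icc hd ht))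
    (h.velocity_mem _ (Icc_sub_subset hd ht)))
  weak_form t ht x hx := by
    have hlater := h.weak_form _ (mapsTo_add_Icc hd ht) x hx
    have hnow := h.weak_form _ (Icc_sub_subset hd ht) x hx
    simp only [diffQuot, map_smul, map_sub, smul_apply, sub_apply, smul_eq_mul]
    linear_combination d⁻¹ * (hlater - hnow)

lemma tendsto_velocity_diffQuot_right (h : IsDampedEvolution π m a k S T V vt N) {t : ℝ}
    (ht : t ∈ Ico 0 T) : Tendsto (fun d => π (diffQuot d V t)) (𝓝[>] 0) (𝓝 (vt t)) := by
  simp only [map_diffQuot]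
  exact tendsto_diffQuot_right (h.deriv_velocity t (Ico_subset_Icc_self ht)) ht

lemma tendsto_velocity_diffQuot_left (h : IsDampedEvolution π m a k S T V vt N) {t : ℝ}
    (ht : t ∈ Ioc 0 T) : Tendsto (fun d => π (diffQuot d V (t - d))) (𝓝[>] 0) (𝓝 (vt t)) := by
  simp only [map_diffQuot]
  exact tendsto_diffQuot_left (h.deriv_velocity t (Ioc_subset_Icc_self ht)) ht

end IsDampedEvolution

end DampedEvolution

/-! ### Coercivity of the forms -/

/-- The map to `(L²)^ι`, with its Hilbert space norm, collecting the given linear functions of a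
field; it records which components enter the energies below. -/
def components {ι : Type*} [Fintype ι] (ℓ : ι → GradField →L[ℝ] L2) :
    GradField →L[ℝ] PiLp 2 (fun _ : ι => L2) :=
  (PiLp.continuousLinearEquiv 2 ℝ (fun _ : ι => L2)).symm.toContinuousLinearMap ∘L
    ContinuousLinearMap.pi ℓ

lemma norm_components_sq {ι : Type*} [Fintype ι] (ℓ : ι → GradField →L[ℝ] L2) (x : GradField) :
    ‖components ℓ x‖ ^ 2 = ∑ i, ‖ℓ i x‖ ^ 2 :=
  PiLp.norm_sq_eq_of_L2 _ _

lemma norm_mul_norm_le_components {ι : Type*} [Fintype ι] (ℓ : ι → GradField →L[ℝ] L2)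
    (x y : GradField) (i j : ι) : ‖ℓ i x‖ * ‖ℓ j y‖ ≤ ‖components ℓ x‖ * ‖components ℓ y‖ :=
  mul_le_mul (PiLp.norm_apply_le (components ℓ x) i) (PiLp.norm_apply_le (components ℓ y) j)
    (norm_nonneg _) (norm_nonneg _)

/-- The components `u₁, u₂, ∂₂u₁, ∂₂u₂`, which control the potential for a vertical field. -/
def verticalPart : GradField →L[ℝ] PiLp 2 (fun _ : Fin 4 => L2) :=
  components ![fieldValue 0, fieldValue 1, fieldPartial 0 1, fieldPartial 1 1]

/-- The components `∂₁u₁, u₂, ∂₁u₂, ∂₂u₂`, which control the potential for a horizontal field. -/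
def horizontalPart : GradField →L[ℝ] PiLp 2 (fun _ : Fin 4 => L2) :=
  components ![fieldPartial 0 0, fieldValue 1, fieldPartial 1 0, fieldPartial 1 1]

lemma norm_verticalPart_sq (x : GradField) : ‖verticalPart x‖ ^ 2
    = ‖x.1 0‖ ^ 2 + ‖x.1 1‖ ^ 2 + ‖x.2 0 1‖ ^ 2 + ‖x.2 1 1‖ ^ 2 := by
  rw [verticalPart, norm_components_sq, Fin.sum_univ_four]
  rfl

lemma norm_horizontalPart_sq (x : GradField) : ‖horizontalPart x‖ ^ 2
    = ‖x.2 0 0‖ ^ 2 + ‖x.1 1‖ ^ 2 + ‖x.2 1 0‖ ^ 2 + ‖x.2 1 1‖ ^ 2 := by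
  rw [horizontalPart, norm_components_sq, Fin.sum_univ_four]
  rfl

lemma potential_vertical (c : Coeffs) (B : ℝ) (x y : GradField) : potential c ![0, B] x y
    = B ^ 2 * (inner ℝ (x.2 0 1) (y.2 0 1) + inner ℝ (x.2 1 1) (y.2 1 1))
      + c.gJump * (pairCLM upper (x.1 1) (y.2 1 1) + pairCLM upper (x.2 1 1) (y.1 1)) := by
  rw [potential_apply]
  simp only [Fin.sum_univ_two, Matrix.cons_val_zero, Matrix.cons_val_one, zero_mul, mul_zero,
    zero_add]
  ring

lemma potential_horizontal (c : Coeffs) (B : ℝ) (x y : GradField) : potential c ![B, 0] x y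
    = B ^ 2 * (inner ℝ (x.2 0 0) (y.2 0 0) + inner ℝ (x.2 1 0) (y.2 1 0))
      + c.gJump * (pairCLM upper (x.1 1) (y.2 1 1) + pairCLM upper (x.2 1 1) (y.1 1)) := by
  rw [potential_apply]
  simp only [Fin.sum_univ_two, Matrix.cons_val_zero, Matrix.cons_val_one, zero_mul, mul_zero,
    add_zero]
  ring

lemma le_jump_term {c : Coeffs} {x : GradField} (hx : x ∈ solenoidal) :
    -(c.gJump / 2 * ‖x.2 1 1‖ ^ 2)
      ≤ c.gJump * (pairCLM upper (x.1 1) (x.2 1 1) + pairCLM upper (x.2 1 1) (x.1 1)) := by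
  rw [pairCLM_comm upper (x.2 1 1)]
  linarith [mul_le_mul_of_nonneg_left (solenoidal_trace hx) c.gJump_pos.le]

lemma abs_two_pairings_le {β γ a₁ a₂ a₃ a₄ P : ℝ} (hβ : 0 ≤ β) (hγ : 0 ≤ γ) (h₁ : |a₁| ≤ P)
    (h₂ : |a₂| ≤ P) (h₃ : |a₃| ≤ P) (h₄ : |a₄| ≤ P) :
    |β * (a₁ + a₂) + γ * (a₃ + a₄)| ≤ (2 * β + 2 * γ) * P := by
  calc |β * (a₁ + a₂) + γ * (a₃ + a₄)| ≤ β * (|a₁| + |a₂|) + γ * (|a₃| + |a₄|) := by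
        refine (abs_add_le _ _).trans ?_
        rw [abs_mul, abs_mul, abs_of_nonneg hβ, abs_of_nonneg hγ]
        gcongr <;> exact abs_add_le _ _
    _ ≤ β * (P + P) + γ * (P + P) := by gcongr
    _ = (2 * β + 2 * γ) * P := by ring

lemma isCoerciveForm_vertical {c : Coeffs} {B : ℝ} (hB : c.gJump / 2 < B ^ 2) :
    IsCoerciveForm (potential c ![0, B]) solenoidal verticalPart ((B ^ 2 - c.gJump / 2) / 5)
      (2 * B ^ 2 + 2 * c.gJump) where
  κ_pos := by linarith
  coercive x hx := by
    have hgap := sub_pos.2 hB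
    rw [potential_vertical, norm_verticalPart_sq, real_inner_self_eq_norm_sq,
      real_inner_self_eq_norm_sq]
    have hpoincare := mul_le_mul_of_nonneg_left
      (add_le_add (solenoidal_poincare hx 0) (solenoidal_poincare hx 1)) hgap.le
    have hjump := le_jump_term (c := c) hx
    have := mul_nonneg c.gJump_pos.le (sq_nonneg ‖x.2 0 1‖)
    linarith
  bound x y := by
    have hle := norm_mul_norm_le_components
      ![fieldValue 0, fieldValue 1, fieldPartial 0 1, fieldPartial 1 1] x y
    rw [potential_vertical]
    exact abs_two_pairings_le (sq_nonneg B) c.gJump_pos.le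
      ((abs_real_inner_le_norm _ _).trans (hle 2 2)) ((abs_real_inner_le_norm _ _).trans (hle 3 3))
      ((abs_pairCLM_le _ _ _).trans (hle 1 3)) ((abs_pairCLM_le _ _ _).trans (hle 3 1))

lemma isCoerciveForm_horizontal {c : Coeffs} {B : ℝ} (hB : c.gJump / 2 < B ^ 2) :
    IsCoerciveForm (potential c ![B, 0]) solenoidal horizontalPart ((B ^ 2 - c.gJump / 2) / 6)
      (2 * B ^ 2 + 2 * c.gJump) where
  κ_pos := by linarith
  coercive x hx := by
    have hgap := sub_pos.2 hB
    have hdiv : ‖x.2 0 0‖ = ‖x.2 1 1‖ := by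
      rw [eq_neg_of_add_eq_zero_left (solenoidal_div hx), norm_neg]
    rw [potential_horizontal, norm_horizontalPart_sq, real_inner_self_eq_norm_sq,
      real_inner_self_eq_norm_sq, hdiv]
    have hpoincare := mul_le_mul_of_nonneg_left (solenoidal_poincare hx 1) hgap.le
    have hjump := le_jump_term (c := c) hx
    have := mul_nonneg c.gJump_pos.le (sq_nonneg ‖x.2 1 0‖)
    have := mul_nonneg hgap.le (sq_nonneg ‖x.2 1 0‖)
    linarith
  bound x y := by
    have hle := norm_mul_norm_le_components
      ![fieldPartial 0 0, fieldValue 1, fieldPartial 1 0, fieldPartial 1 1] x y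
    rw [potential_horizontal]
    exact abs_two_pairings_le (sq_nonneg B) c.gJump_pos.le
      ((abs_real_inner_le_norm _ _).trans (hle 0 0)) ((abs_real_inner_le_norm _ _).trans (hle 2 2))
      ((abs_pairCLM_le _ _ _).trans (hle 1 3)) ((abs_pairCLM_le _ _ _).trans (hle 3 1))

/-- The squared `H¹` norm of a field. -/
def h1NormSq (x : GradField) : ℝ := ∑ i, (‖x.1 i‖ ^ 2 + ∑ j, ‖x.2 i j‖ ^ 2)

lemma continuous_h1NormSq : Continuous h1NormSq := by
  unfold h1NormSq
  fun_prop

lemma h1NormSq_nonneg (x : GradField) : 0 ≤ h1NormSq x := by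
  unfold h1NormSq
  positivity

lemma viscous_coercive (c : Coeffs) {x : GradField} (hx : x ∈ solenoidal) :
    min c.μp c.μm / 5 * h1NormSq x ≤ viscous c x x := by
  have hμ : 0 < min c.μp c.μm := lt_min c.μp_pos c.μm_pos
  refine le_trans ?_ (korn c hx)
  rw [div_mul_eq_mul_div, mul_div_assoc]
  refine mul_le_mul_of_nonneg_left ?_ hμ.le
  simp only [h1NormSq, Fin.sum_univ_two]
  linarith [solenoidal_poincare hx 0, solenoidal_poincare hx 1, sq_nonneg ‖x.2 0 0‖,
    sq_nonneg ‖x.2 1 0‖]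

/-! ### Weak derivatives of square integrable functions -/

lemma isOpen_slab : IsOpen slab := isOpen_strip _ _

lemma inner_toL2 {V : Set (ℝ × ℝ)} (f : L2) {φ : ℝ × ℝ → ℝ} (hφ : IsTest V φ) :
    inner ℝ f hφ.toL2 = ∫ x in slab, f x * φ x := by
  rw [← pairCLM_slab, pairCLM_toL2_right measurableSet_slab le_rfl, pair]

lemma hasWeakPartial_iff_inner {j : Fin 2} {f g : L2} :
    HasWeakPartial slab j f g ↔ ∀ φ (hφ : IsTest slab φ),
      inner ℝ f (hφ.partial j).toL2 = -inner ℝ g hφ.toL2 := by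
  have hloc : ∀ u : L2, LocallyIntegrableOn u slab := fun u =>
    locallyIntegrableOn_of_restrict isOpen_slab ((Lp.memLp u).locallyIntegrable one_le_two)
  simp only [inner_toL2]
  exact ⟨fun h => h.2.2, fun h => ⟨hloc f, hloc g, h⟩⟩

/-- The field `x` consists of a vector field and its weak gradient on `Ω`. -/
def HasWeakGradient (x : GradField) : Prop := ∀ i j, HasWeakPartial slab j (x.1 i) (x.2 i j)

lemma isClosed_hasWeakGradient : IsClosed {x | HasWeakGradient x} := by
  simp only [HasWeakGradient, hasWeakPartial_iff_inner, ofPred_forall]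
  exact isClosed_iInter fun i => isClosed_iInter fun j => isClosed_iInter fun φ =>
    isClosed_iInter fun hφ => isClosed_eq (by fun_prop) (by fun_prop)

lemma hasWeakGradient_streamField {ψ : ℝ × ℝ → ℝ} (hψ : IsTest slab ψ) :
    HasWeakGradient (streamField ⟨ψ, hψ⟩) := fun i j =>
  hasWeakPartial_iff_inner.2 fun φ hφ => by
    rw [streamField_value, streamField_partial, ← pairCLM_slab, ← pairCLM_slab,
      pairCLM_toL2 measurableSet_slab le_rfl, pairCLM_toL2 measurableSet_slab le_rfl,
      (hψ.curl i).pair_eq_integral, ((hψ.curl i).partial j).pair_eq_integral]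
    exact (hψ.curl i).integral_by_parts hφ j

lemma hasWeakGradient_of_mem_solenoidal {x : GradField} (hx : x ∈ solenoidal) :
    HasWeakGradient x :=
  solenoidal_induction isClosed_hasWeakGradient (fun _ hψ => hasWeakGradient_streamField hψ) hx

lemma l2Sq_coe (f : L2) : l2Sq f = ENNReal.ofReal (‖f‖ ^ 2) := by
  rw [l2Sq, ENNReal.ofReal_pow (norm_nonneg _), Lp.norm_def,
    ENNReal.ofReal_toReal (Lp.eLpNorm_ne_top f)]

lemma HasWeakPartial.partialSq_eq {j : Fin 2} {f g : L2} (h : HasWeakPartial slab j f g) :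
    partialSq j f = ENNReal.ofReal (‖g‖ ^ 2) := by
  rw [partialSq, if_pos ⟨_, h⟩, ← l2Sq_coe, l2Sq, l2Sq,
    eLpNorm_congr_ae (h.weakPartial_ae isOpen_slab)]

-- The set is the projection of a closed subset of the product of `L²(Ω)` with a closed ball of its
-- dual, which is weak-* compact.
lemma isClosed_exists_hasWeakPartial (j : Fin 2) (R : ℝ) :
    IsClosed {f : L2 | ∃ g : L2, HasWeakPartial slab j f g ∧ ‖g‖ ≤ R} := by
  set K : Set (WeakDual ℝ L2) := WeakDual.toStrongDual ⁻¹' Metric.closedBall 0 R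
  have : CompactSpace K := isCompact_iff_compactSpace.1 (WeakDual.isCompact_closedBall 0 R)
  have hgraph : IsClosed {p : L2 × K | ∀ φ (hφ : IsTest slab φ),
      inner ℝ p.1 (hφ.partial j).toL2 = -p.2.1 hφ.toL2} := by
    simp only [ofPred_forall]
    exact isClosed_iInter fun φ => isClosed_iInter fun hφ => isClosed_eq (by fun_prop)
      (((WeakDual.eval_continuous _).comp (continuous_subtype_val.comp continuous_snd)).neg)
  convert isClosedMap_fst_of_compactSpace _ hgraph using 1
  ext f
  simp only [mem_ofPred_eq, mem_image, Prod.exists, exists_and_right, exists_eq_right]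
  constructor
  · rintro ⟨g, hg, hgR⟩
    refine ⟨⟨StrongDual.toWeakDual (InnerProductSpace.toDual ℝ L2 g), ?_⟩,
      hasWeakPartial_iff_inner.1 hg⟩
    simpa [K] using hgR
  · rintro ⟨⟨y, hy⟩, hfy⟩
    refine ⟨(InnerProductSpace.toDual ℝ L2).symm (WeakDual.toStrongDual y),
      hasWeakPartial_iff_inner.2 fun φ hφ => ?_, ?_⟩
    · rw [InnerProductSpace.toDual_symm_apply]
      exact hfy φ hφ
    · rw [LinearIsometryEquiv.norm_map]
      simpa [K] using hy

lemma partialSq_le_iff {j : Fin 2} {f : L2} {b : ℝ≥0} :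
    partialSq j f ≤ b ↔ ∃ g : L2, HasWeakPartial slab j f g ∧ ‖g‖ ≤ √b := by
  have hle : ∀ g : L2, HasWeakPartial slab j f g → (partialSq j f ≤ b ↔ ‖g‖ ≤ √b) := fun g hg => by
    rw [hg.partialSq_eq, ENNReal.ofReal_le_iff_le_toReal ENNReal.coe_ne_top, ENNReal.coe_toReal,
      Real.le_sqrt (norm_nonneg g) b.coe_nonneg]
  refine ⟨fun h => ?_, fun ⟨g, hg, hgb⟩ => (hle g hg).2 hgb⟩
  have hex : ∃ g, HasWeakPartial slab j f g := by
    by_contra hnex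
    rw [partialSq, if_neg hnex] at h
    exact ENNReal.coe_ne_top (top_le_iff.1 h)
  have hweak := hex.choose_spec.spec
  have hL2 : MemLp (weakPartial slab j f) 2 (volume.restrict slab) := by
    refine ⟨hweak.2.1.aestronglyMeasurable, ?_⟩
    rw [partialSq, if_pos hex, l2Sq] at h
    exact ENNReal.pow_lt_top_iff.1 (h.trans_lt ENNReal.coe_lt_top) |>.resolve_right two_ne_zero
  have hg : HasWeakPartial slab j f (hL2.toLp _) := hweak.congr .rfl hL2.coeFn_toLp.symm
  exact ⟨_, hg, (hle _ hg).1 h⟩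

lemma lowerSemicontinuous_partialSq (j : Fin 2) :
    LowerSemicontinuous fun f : L2 => partialSq j f := by
  refine lowerSemicontinuous_iff_isClosed_preimage.2 fun b => ?_
  induction b with
  | top => simp
  | coe b =>
    simp only [preimage, mem_Iic, partialSq_le_iff]
    exact isClosed_exists_hasWeakPartial j _

lemma lowerSemicontinuous_sum_h1Sq :
    LowerSemicontinuous fun w : Fin 2 → L2 => ∑ i, h1Sq (w i) := by
  have hl2 : Continuous fun f : L2 => l2Sq f := by
    simp only [l2Sq_coe]
    exact ENNReal.continuous_ofReal.comp (by fun_prop)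
  have hh1 : LowerSemicontinuous fun f : L2 => h1Sq f :=
    hl2.lowerSemicontinuous.add (lowerSemicontinuous_sum fun j _ => lowerSemicontinuous_partialSq j)
  exact lowerSemicontinuous_sum fun i _ => hh1.comp (continuous_apply i)

lemma sum_h1Sq_eq {x : GradField} (hx : HasWeakGradient x) :
    ∑ i, h1Sq (x.1 i) = ENNReal.ofReal (h1NormSq x) := by
  simp only [h1Sq, l2Sq_coe, fun i j => (hx i j).partialSq_eq, h1NormSq]
  rw [ENNReal.ofReal_sum_of_nonneg fun i _ => by positivity]
  refine Finset.sum_congr rfl fun i _ => ?_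
  rw [ENNReal.ofReal_add (by positivity) (by positivity),
    ENNReal.ofReal_sum_of_nonneg fun j _ => by positivity]

/-- The energy `‖w‖² + ‖L x‖²`. The energies of the vertical and horizontal problems are obtained
from `L = verticalPart` and `L = horizontalPart`. -/
def energy {G : Type*} [NormedAddCommGroup G] [NormedSpace ℝ G] (L : GradField →L[ℝ] G)
    (w : Fin 2 → L2) (x : GradField) : ℝ :=
  ∑ i, ‖w i‖ ^ 2 + ‖L x‖ ^ 2

lemma verticalEnergy_eq (w : Fin 2 → L2) {x : GradField} (hx : HasWeakGradient x) :
    verticalEnergy w x.1 = ENNReal.ofReal (energy verticalPart w x) := by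
  simp only [verticalEnergy, energy, l2Sq_coe, fun i j => (hx i j).partialSq_eq,
    norm_verticalPart_sq, Fin.sum_univ_two]
  repeat rw [ENNReal.ofReal_add (by positivity) (by positivity)]
  simp only [add_assoc]

lemma horizontalEnergy_eq (w : Fin 2 → L2) {x : GradField} (hx : HasWeakGradient x) :
    horizontalEnergy w x.1 = ENNReal.ofReal (energy horizontalPart w x) := by
  simp only [horizontalEnergy, energy, h1Sq, l2Sq_coe, fun i j => (hx i j).partialSq_eq,
    norm_horizontalPart_sq, Fin.sum_univ_two]
  repeat rw [ENNReal.ofReal_add (by positivity) (by positivity)]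
  simp only [add_assoc]

lemma liminf_add_liminf_le (a b : ℕ → ℝ≥0∞) :
    liminf a atTop + liminf b atTop ≤ liminf (fun n => a n + b n) atTop := by
  simp only [liminf_eq_iSup_iInf_of_nat]
  rw [ENNReal.iSup_add_iSup_of_monotone
    (fun _ _ hnm => biInf_mono fun _ hk => le_trans hnm hk)
    (fun _ _ hnm => biInf_mono fun _ hk => le_trans hnm hk)]
  exact iSup_mono fun n => le_iInf₂ fun k hk => add_le_add (iInf₂_le k hk) (iInf₂_le k hk)

lemma dissipation_le_liminf {t : ℝ} {τ : ℕ → ℝ} {w : ℕ → ℝ → Fin 2 → L2} {u : ℝ → Fin 2 → L2}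
    (hτ : Tendsto τ atTop (𝓝 t)) (hw : ∀ n, ContinuousOn (w n) (Icc 0 (τ n)))
    (hlim : ∀ s ∈ Ico 0 t, Tendsto (fun n => w n s) atTop (𝓝 (u s))) :
    dissipation u t ≤ liminf (fun n => dissipation (w n) (τ n)) atTop := by
  set F : ℕ → ℝ → ℝ≥0∞ := fun n => (Icc 0 (τ n)).indicator fun s => ∑ i, h1Sq (w n s i)
  have hF : ∀ n, AEMeasurable (F n) := fun n => by
    rw [aemeasurable_indicator_iff measurableSet_Icc,
      aemeasurable_restrict_iff_comap_subtype measurableSet_Icc]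
    exact (lowerSemicontinuous_sum_h1Sq.comp
      (continuousOn_iff_continuous_domRestrict.1 (hw n))).measurable.aemeasurable
  calc dissipation u t = ∫⁻ s in Ico 0 t, ∑ i, h1Sq (u s i) := setLIntegral_congr Ico_ae_eq_Icc.symm
    _ ≤ ∫⁻ s in Ico 0 t, liminf (fun n => F n s) atTop := by
        refine setLIntegral_mono' measurableSet_Ico fun s hs => ?_
        refine ((lowerSemicontinuous_sum_h1Sq.le_liminf (u s)).trans
          (hlim s hs).liminf_le_liminf_comp).trans_eq (liminf_congr ?_)
        filter_upwards [hτ.eventually_const_lt hs.2] with n hn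
        exact (indicator_of_mem (show s ∈ Icc 0 (τ n) from ⟨hs.1, hn.le⟩)
          fun s => ∑ i, h1Sq (w n s i)).symm
    _ ≤ ∫⁻ s, liminf (fun n => F n s) atTop := setLIntegral_le_lintegral _ _
    _ ≤ liminf (fun n => ∫⁻ s, F n s) atTop := lintegral_liminf_le' hF
    _ = liminf (fun n => dissipation (w n) (τ n)) atTop := by
        simp only [F, lintegral_indicator measurableSet_Icc, dissipation]

/-! ### Stability -/

section Stability

variable {G : Type*} [NormedAddCommGroup G] [NormedSpace ℝ G] {L : GradField →L[ℝ] G}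

lemma energy_nonneg (L : GradField →L[ℝ] G) (w : Fin 2 → L2) (x : GradField) :
    0 ≤ energy L w x := by
  unfold energy
  positivity

lemma tendsto_ofReal_energy {α : Type*} {l : Filter α} {W : α → Fin 2 → L2} {X : α → GradField}
    {w : Fin 2 → L2} {x : GradField} (hW : Tendsto W l (𝓝 w)) (hX : Tendsto X l (𝓝 x)) :
    Tendsto (fun a => ENNReal.ofReal (energy L (W a) (X a))) l
      (𝓝 (ENNReal.ofReal (energy L w x))) :=
  ENNReal.tendsto_ofReal ((tendsto_finsetSum _ fun i _ => (hW.apply_nhds i).norm.pow 2).add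
    (((L.continuous.tendsto x).comp hX).norm.pow 2))

/-- The weak form of the linearized system, for the velocity and the displacement together with
their gradients; `vt` is the acceleration. -/
abbrev IsEvolution (c : Coeffs) (B : Fin 2 → ℝ) (T : ℝ) (V : ℝ → GradField) (vt : ℝ → Fin 2 → L2)
    (N : ℝ → GradField) : Prop :=
  IsDampedEvolution (ContinuousLinearMap.fst ℝ _ _) (inertia c) (viscous c) (potential c B)
    solenoidal T V vt N

/-- Every evolution satisfies the stability estimate for the energy given by `L` with the
constant `C`, which does not depend on the length of the time interval. -/
def StabilityBound (c : Coeffs) (B : Fin 2 → ℝ) (L : GradField →L[ℝ] G) (C : ℝ) : Prop :=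
  ∀ ⦃T : ℝ⦄ ⦃V : ℝ → GradField⦄ ⦃vt : ℝ → Fin 2 → L2⦄ ⦃N : ℝ → GradField⦄,
    IsEvolution c B T V vt N → ∀ t ∈ Icc 0 T,
      energy L (V t).1 (N t) + ∫ s in (0 : ℝ)..t, h1NormSq (V s) ≤ C * energy L (V 0).1 (N 0)

lemma StabilityBound.mono {c : Coeffs} {B : Fin 2 → ℝ} {C C' : ℝ} (h : StabilityBound c B L C)
    (hC : C ≤ C') : StabilityBound c B L C' := fun _ _ _ _ hev t ht =>
  (h hev t ht).trans (mul_le_mul_of_nonneg_right hC (energy_nonneg _ _ _))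

lemma stabilityBound_div {c : Coeffs} {B : Fin 2 → ℝ} {κ M : ℝ}
    (hL : IsCoerciveForm (potential c B) solenoidal L κ M) :
    StabilityBound c B L (max c.ρp (2 * M ^ 2 / κ + κ / 2)
      / min (min c.ρm (κ / 4)) (2 * (min c.μp c.μm / 5))) := by
  intro T V vt N h t ht
  set α := min (min c.ρm (κ / 4)) (2 * (min c.μp c.μm / 5))
  set β := max c.ρp (2 * M ^ 2 / κ + κ / 2)
  have hsub : Icc 0 t ⊆ Icc 0 T := Icc_subset_Icc le_rfl ht.2
  have hα : 0 < α := by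
    have := hL.κ_pos
    have := c.ρm_pos
    have := c.μp_pos
    have := c.μm_pos
    positivity
  have hdamping : α * ∫ s in (0 : ℝ)..t, h1NormSq (V s)
      ≤ 2 * ∫ s in (0 : ℝ)..t, viscous c (V s) (V s) := by
    rw [← intervalIntegral.integral_const_mul, ← intervalIntegral.integral_const_mul]
    refine intervalIntegral.integral_mono_on ht.1
      ((continuous_h1NormSq.comp_continuousOn
        (h.continuousOn_velocity.mono hsub)).const_smul α |>.intervalIntegrable_of_Icc ht.1)
      ((h.continuousOn_damping.mono hsub).const_smul (2 : ℝ) |>.intervalIntegrable_of_Icc ht.1)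
      fun s hs => ?_
    have := mul_le_mul_of_nonneg_right (min_le_right _ _ : α ≤ _) (h1NormSq_nonneg (V s))
    linarith [viscous_coercive c (h.velocity_mem s (hsub hs))]
  have henergy := h.energy_le isClosed_solenoidal (inertia_comm c) (potential_comm c B) hL ht
  simp only [ContinuousLinearMap.coe_fst'] at henergy
  have hlower : α * energy L (V t).1 (N t)
      ≤ inertia c (V t).1 (V t).1 + κ / 4 * ‖L (N t)‖ ^ 2 := by
    refine (mul_add _ _ _).trans_le (add_le_add (le_trans ?_ (le_inertia_self c _)) ?_)
    · exact mul_le_mul_of_nonneg_right ((min_le_left _ _).trans (min_le_left _ _)) (by positivity)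
    · exact mul_le_mul_of_nonneg_right ((min_le_left _ _).trans (min_le_right _ _)) (sq_nonneg _)
  have hupper : inertia c (V 0).1 (V 0).1 + (2 * M ^ 2 / κ + κ / 2) * ‖L (N 0)‖ ^ 2
      ≤ β * energy L (V 0).1 (N 0) := by
    refine (add_le_add ((inertia_self_le c _).trans ?_) ?_).trans_eq (mul_add _ _ _).symm
    · exact mul_le_mul_of_nonneg_right (le_max_left _ _) (by positivity)
    · exact mul_le_mul_of_nonneg_right (le_max_right _ _) (sq_nonneg _)
  rw [div_mul_eq_mul_div, le_div_iff₀' hα, mul_add]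
  linarith

lemma exists_stabilityBound {c : Coeffs} {B : Fin 2 → ℝ} {κ M : ℝ}
    (hL : IsCoerciveForm (potential c B) solenoidal L κ M) :
    ∃ C : ℝ≥0, 1 ≤ C ∧ StabilityBound c B L C :=
  ⟨max 1 (Real.toNNReal _), le_max_left _ _, (stabilityBound_div hL).mono
    ((Real.le_coe_toNNReal _).trans (NNReal.coe_le_coe.2 (le_max_right _ _)))⟩

namespace IsEvolution

variable {c : Coeffs} {B : Fin 2 → ℝ} {T t : ℝ} {V : ℝ → GradField} {vt : ℝ → Fin 2 → L2}
  {N : ℝ → GradField} {C : ℝ≥0}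

lemma dissipation_eq (h : IsEvolution c B T V vt N) (ht : t ∈ Icc 0 T) :
    dissipation (fun s => (V s).1) t = ENNReal.ofReal (∫ s in (0 : ℝ)..t, h1NormSq (V s)) := by
  have hsub : Icc 0 t ⊆ Icc 0 T := Icc_subset_Icc le_rfl ht.2
  have hcont : ContinuousOn (fun s => h1NormSq (V s)) (Icc 0 t) :=
    continuous_h1NormSq.comp_continuousOn (h.continuousOn_velocity.mono hsub)
  rw [intervalIntegral.integral_of_le ht.1, ← integral_Icc_eq_integral_Ioc,
    ofReal_integral_eq_lintegral_ofReal (hcont.integrableOn_compact isCompact_Icc)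
      (Eventually.of_forall fun s => h1NormSq_nonneg _)]
  exact setLIntegral_congr_fun measurableSet_Icc fun s hs =>
    sum_h1Sq_eq (hasWeakGradient_of_mem_solenoidal (h.velocity_mem s (hsub hs)))

lemma energy_add_dissipation_le (h : IsEvolution c B T V vt N) (hC : StabilityBound c B L C)
    (ht : t ∈ Icc 0 T) :
    ENNReal.ofReal (energy L (V t).1 (N t)) + dissipation (fun s => (V s).1) t
      ≤ C * ENNReal.ofReal (energy L (V 0).1 (N 0)) := by
  rw [h.dissipation_eq ht, ← ENNReal.ofReal_add (energy_nonneg _ _ _)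
    (intervalIntegral.integral_nonneg ht.1 fun s _ => h1NormSq_nonneg _),
    ← ENNReal.ofReal_coe_nnreal, ← ENNReal.ofReal_mul C.coe_nonneg]
  exact ENNReal.ofReal_le_ofReal (hC h t ht)

lemma tendsto_energy_diffQuot_right (h : IsEvolution c B T V vt N) (ht : t ∈ Ico 0 T) :
    Tendsto (fun d => ENNReal.ofReal (energy L (diffQuot d V t).1 (diffQuot d N t))) (𝓝[>] 0)
      (𝓝 (ENNReal.ofReal (energy L (vt t) (V t)))) :=
  tendsto_ofReal_energy (h.tendsto_velocity_diffQuot_right ht)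
    (tendsto_diffQuot_right (h.deriv_displacement t (Ico_subset_Icc_self ht)) ht)

lemma tendsto_energy_diffQuot_left (h : IsEvolution c B T V vt N) (ht : t ∈ Ioc 0 T) :
    Tendsto (fun d => ENNReal.ofReal (energy L (diffQuot d V (t - d)).1 (diffQuot d N (t - d))))
      (𝓝[>] 0) (𝓝 (ENNReal.ofReal (energy L (vt t) (V t)))) :=
  tendsto_ofReal_energy (h.tendsto_velocity_diffQuot_left ht)
    (tendsto_diffQuot_left (h.deriv_displacement t (Ioc_subset_Icc_self ht)) ht)

-- The difference quotients of an evolution are again evolutions, and their estimate passes to the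
-- limit by lower semicontinuity of the dissipation.
lemma deriv_energy_add_dissipation_le (h : IsEvolution c B T V vt N)
    (hC : StabilityBound c B L C) (hC₁ : 1 ≤ C) (ht : t ∈ Icc 0 T) :
    ENNReal.ofReal (energy L (vt t) (V t)) + dissipation vt t
      ≤ C * ENNReal.ofReal (energy L (vt 0) (V 0)) := by
  rcases ht.1.eq_or_lt with rfl | ht₀
  · have hzero : dissipation vt 0 = 0 := by simp [dissipation]
    rw [hzero, add_zero]
    exact le_mul_of_one_le_left zero_le (ENNReal.one_le_coe_iff.2 hC₁)
  obtain ⟨d, -, hd, hd_lim⟩ := exists_seq_strictAnti_tendsto' ht₀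
  have hd_right : Tendsto d atTop (𝓝[>] 0) :=
    tendsto_nhdsWithin_iff.2 ⟨hd_lim, Eventually.of_forall fun n => (hd n).1⟩
  have hquot := fun n => h.diffQuot (hd n).1.le
  have hmem : ∀ n, t - d n ∈ Icc 0 (T - d n) := fun n =>
    ⟨(sub_pos.2 (hd n).2).le, sub_le_sub_right ht.2 _⟩
  have hfinal := (tendsto_energy_diffQuot_left (L := L) h ⟨ht₀, ht.2⟩).comp hd_right
  have hinitial := ENNReal.Tendsto.const_mul (a := (C : ℝ≥0∞))
    ((tendsto_energy_diffQuot_right (L := L) h ⟨le_rfl, ht₀.trans_le ht.2⟩).comp hd_right)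
    (Or.inr ENNReal.coe_ne_top)
  have hdissipation := dissipation_le_liminf (u := vt) (w := fun n s => (diffQuot (d n) V s).1)
    (by simpa only [sub_zero] using hd_lim.const_sub t)
    (fun n => continuous_fst.comp_continuousOn
      ((hquot n).continuousOn_velocity.mono (Icc_subset_Icc le_rfl (hmem n).2)))
    fun s hs =>
      (h.tendsto_velocity_diffQuot_right ⟨hs.1, hs.2.trans_le ht.2⟩).comp hd_right
  exact (add_le_add hfinal.liminf_eq.ge hdissipation).trans <| (liminf_add_liminf_le _ _).trans <|
    (liminf_le_liminf (Eventually.of_forall fun n =>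
      energy_add_dissipation_le (hquot n) hC (hmem n))).trans_eq hinitial.liminf_eq

end IsEvolution

end Stability

/-! ### Solutions as evolutions -/

lemma exists_path_hasWeakPartial {T : ℝ} (hT : 0 ≤ T) {j : Fin 2} {n u D : ℝ → L2} {G₀ : L2}
    (hn : ∀ t ∈ Icc 0 T, HasDerivWithinAt n (u t) (Icc 0 T) t) (hD : ContinuousOn D (Icc 0 T))
    (hu : ∀ t ∈ Icc 0 T, HasWeakPartial slab j (u t) (D t))
    (h₀ : HasWeakPartial slab j (n 0) G₀) :
    ∃ G : ℝ → L2, (∀ t ∈ Icc 0 T, HasDerivWithinAt G (D t) (Icc 0 T) t) ∧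
      ∀ t ∈ Icc 0 T, HasWeakPartial slab j (n t) (G t) := by
  have hcont : Continuous fun s => D (projIcc 0 T hT s) :=
    (continuousOn_iff_continuous_domRestrict.1 hD).comp continuous_projIcc
  set G : ℝ → L2 := fun t => G₀ + ∫ s in (0 : ℝ)..t, D (projIcc 0 T hT s) with hG
  have hderiv : ∀ t ∈ Icc 0 T, HasDerivWithinAt G (D t) (Icc 0 T) t := fun t ht => by
    simpa only [projIcc_of_mem hT ht] using
      ((hcont.integral_hasStrictDerivAt 0 t).hasDerivAt.const_add G₀).hasDerivWithinAt
  refine ⟨G, hderiv, fun t ht => hasWeakPartial_iff_inner.2 fun φ hφ => ?_⟩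
  have hconst : ∀ s ∈ Icc 0 T, HasDerivWithinAt
      (fun s => inner ℝ (n s) (hφ.partial j).toL2 + inner ℝ (G s) hφ.toL2) 0 (Icc 0 T) s := by
    intro s hs
    refine (((hn s hs).inner ℝ (hasDerivWithinAt_const s _ (hφ.partial j).toL2)).add
      ((hderiv s hs).inner ℝ (hasDerivWithinAt_const s _ hφ.toL2))).congr_deriv ?_
    simp only [inner_zero_right, zero_add, hasWeakPartial_iff_inner.1 (hu s hs) φ hφ,
      neg_add_cancel]
  refine eq_neg_of_add_eq_zero_left ((eq_of_hasDerivWithinAt_zero hconst ht).trans ?_)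
  simp only [hG, intervalIntegral.integral_same, add_zero, hasWeakPartial_iff_inner.1 h₀ φ hφ,
    neg_add_cancel]

lemma MemH1.exists_hasWeakPartial_L2 {f : L2} (h : MemH1 slab f) (j : Fin 2) :
    ∃ G : L2, HasWeakPartial slab j f G := by
  obtain ⟨g, hg, hgL2⟩ := h.2 j
  exact ⟨hgL2.toLp g, hg.congr .rfl hgL2.coeFn_toLp.symm⟩

section Solutions

variable {c : Coeffs} {B : Fin 2 → ℝ} {T t : ℝ} {v vt η : ℝ → Fin 2 → L2} {q : ℝ → ℝ × ℝ → ℝ}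

lemma IsSolution.weak_form (h : IsSolution c B T v vt η q) (ht : t ∈ Icc 0 T)
    {DV DN : Fin 2 → Fin 2 → L2} (hDV : HasWeakGradient (v t, DV))
    (hDN : HasWeakGradient (η t, DN)) (hdiv : ∀ᵐ x ∂(volume.restrict slab), DV 0 0 x + DV 1 1 x = 0)
    {x : GradField} (hx : x ∈ solenoidal) :
    inertia c (vt t) x.1 + viscous c (v t, DV) x + potential c B (η t, DN) x = 0 := by
  obtain ⟨_, _, hstress⟩ := h.jump_stress t ht
  obtain ⟨_, _, _, _, hupper, hlower, _⟩ := hstress 1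
  exact weak_form_solenoidal hDN hDV
    (.of_slab (isOpen_strip _ _) upper_subset_slab hDV hdiv (fun i => (h.v_H2 i t ht).1)
      (fun i => (h.η_H2 i t ht).1)
      (locallyIntegrable_pressure (U := upper) (v := fun i => v t i) (isOpen_strip _ _)
        (h.v_H2 1 t ht).1.1 hupper.2.1)
      (fun j => (h.grad_q j t ht).1) (h.momentum t ht).1)
    (.of_slab (isOpen_strip _ _) lower_subset_slab hDV hdiv (fun i => (h.v_H2 i t ht).2)
      (fun i => (h.η_H2 i t ht).2)
      (locallyIntegrable_pressure (U := lower) (v := fun i => v t i) (isOpen_strip _ _)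
        (h.v_H2 1 t ht).2.1 hlower.2.1)
      (fun j => (h.grad_q j t ht).2) (h.momentum t ht).2)
    (h.jump_stress t ht) hx

theorem IsSolution.exists_evolution (h : IsSolution c B T v vt η q) (hT : 0 ≤ T) :
    ∃ DV DN : ℝ → Fin 2 → Fin 2 → L2,
      IsEvolution c B T (fun t => (v t, DV t)) vt (fun t => (η t, DN t)) ∧
      ∀ t ∈ Icc 0 T, HasWeakGradient (η t, DN t) := by
  have h₀ : (0 : ℝ) ∈ Icc 0 T := ⟨le_rfl, hT⟩
  choose D hD_cont hD using h.grad_v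
  choose G₀ hG₀ using fun i j => (h.η_H1 i 0 h₀).exists_hasWeakPartial_L2 j
  choose G hG_deriv hG using fun i j =>
    exists_path_hasWeakPartial hT (h.deriv_η i) (hD_cont i j) (hD i j) (hG₀ i j)
  have hv : ∀ t ∈ Icc 0 T, HasDerivWithinAt v (vt t) (Icc 0 T) t := fun t ht =>
    hasDerivWithinAt_pi.2 fun i => h.deriv_v i t ht
  have hdiv : ∀ t ∈ Icc 0 T, ∀ᵐ x ∂(volume.restrict slab), D 0 0 t x + D 1 1 t x = 0 :=
    fun t ht => by
      filter_upwards [h.div_v t ht, (hD 0 0 t ht).weakPartial_ae isOpen_slab,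
        (hD 1 1 t ht).weakPartial_ae isOpen_slab] with x hx h₀₀ h₁₁
      rw [← h₀₀, ← h₁₁, hx]
  refine ⟨fun t i j => D i j t, fun t i j => G i j t, ?_, fun t ht i j => hG i j t ht⟩
  exact
    { continuousOn_velocity := ContinuousOn.prodMk (fun t ht => (hv t ht).continuousWithinAt)
        (continuousOn_pi.2 fun i => continuousOn_pi.2 fun j => hD_cont i j)
      deriv_velocity := hv
      deriv_displacement := fun t ht =>
        (hasDerivWithinAt_pi.2 fun i => h.deriv_η i t ht).prodMk
          (hasDerivWithinAt_pi.2 fun i => hasDerivWithinAt_pi.2 fun j => hG_deriv i j t ht)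
      velocity_mem := fun t ht => mem_solenoidal (fun i j => hD i j t ht) (hdiv t ht)
        (fun i => (h.no_slip i t ht).1) fun i => (h.no_slip i t ht).2
      weak_form := fun t ht x hx => h.weak_form ht (fun i j => hD i j t ht)
        (fun i j => hG i j t ht) (hdiv t ht) hx }

theorem IsSolution.stability {G : Type*} [NormedAddCommGroup G] [NormedSpace ℝ G]
    {L : GradField →L[ℝ] G} {C : ℝ≥0} (h : IsSolution c B T v vt η q)
    (hC : StabilityBound c B L C) (hC₁ : 1 ≤ C) {E : (Fin 2 → L2) → (Fin 2 → L2) → ℝ≥0∞}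
    (hE : ∀ w x, HasWeakGradient x → E w x.1 = ENNReal.ofReal (energy L w x)) (hT : 0 ≤ T) :
    (∀ t ∈ Icc 0 T, E (vt t) (v t) + dissipation vt t ≤ C * E (vt 0) (v 0)) ∧
      ∀ t ∈ Icc 0 T, E (v t) (η t) + dissipation v t ≤ C * E (v 0) (η 0) := by
  obtain ⟨DV, DN, hev, hDN⟩ := h.exists_evolution hT
  have h₀ : (0 : ℝ) ∈ Icc 0 T := ⟨le_rfl, hT⟩
  have hDV : ∀ t ∈ Icc 0 T, HasWeakGradient (v t, DV t) := fun t ht =>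
    hasWeakGradient_of_mem_solenoidal (hev.velocity_mem t ht)
  refine ⟨fun t ht => ?_, fun t ht => ?_⟩
  · rw [hE _ _ (hDV t ht), hE _ _ (hDV 0 h₀)]
    exact hev.deriv_energy_add_dissipation_le hC hC₁ ht
  · rw [hE _ _ (hDN t ht), hE _ _ (hDN 0 h₀)]
    exact hev.energy_add_dissipation_le hC ht

end Solutions

end RayleighTaylorMHD

end

theorem theorem2p4_general (c : RayleighTaylorMHD.Coeffs) (B : ℝ)
    (hB : RayleighTaylorMHD.criticalNumber c < |B|) :
    ∃ C : NNReal,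
      (∀ (T : ℝ) (v vt η : ℝ → Fin 2 → RayleighTaylorMHD.L2) (q : ℝ → ℝ × ℝ → ℝ), 0 < T →
        RayleighTaylorMHD.IsSolution c ![0, B] T v vt η q →
        (∀ t ∈ Set.Icc 0 T,
          RayleighTaylorMHD.verticalEnergy (vt t) (v t) + RayleighTaylorMHD.dissipation vt t
            ≤ C * RayleighTaylorMHD.verticalEnergy (vt 0) (v 0)) ∧
        ∀ t ∈ Set.Icc 0 T,
          RayleighTaylorMHD.verticalEnergy (v t) (η t) + RayleighTaylorMHD.dissipation v t
            ≤ C * RayleighTaylorMHD.verticalEnergy (v 0) (η 0)) ∧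
      (∀ (T : ℝ) (v vt η : ℝ → Fin 2 → RayleighTaylorMHD.L2) (q : ℝ → ℝ × ℝ → ℝ), 0 < T →
        RayleighTaylorMHD.IsSolution c ![B, 0] T v vt η q →
        (∀ t ∈ Set.Icc 0 T,
          RayleighTaylorMHD.horizontalEnergy (vt t) (v t) + RayleighTaylorMHD.dissipation vt t
            ≤ C * RayleighTaylorMHD.horizontalEnergy (vt 0) (v 0)) ∧
        ∀ t ∈ Set.Icc 0 T,
          RayleighTaylorMHD.horizontalEnergy (v t) (η t) + RayleighTaylorMHD.dissipation v t
            ≤ C * RayleighTaylorMHD.horizontalEnergy (v 0) (η 0)) := by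
  have hB' := RayleighTaylorMHD.half_gJump_lt_sq hB
  obtain ⟨C₁, hC₁, hvert⟩ :=
    RayleighTaylorMHD.exists_stabilityBound (RayleighTaylorMHD.isCoerciveForm_vertical hB')
  obtain ⟨C₂, hC₂, hhor⟩ :=
    RayleighTaylorMHD.exists_stabilityBound (RayleighTaylorMHD.isCoerciveForm_horizontal hB')
  refine ⟨max C₁ C₂, fun T v vt η q hT h => ?_, fun T v vt η q hT h => ?_⟩
  · exact h.stability (hvert.mono (NNReal.coe_le_coe.2 (le_max_left C₁ C₂)))
      (hC₁.trans (le_max_left C₁ C₂))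
      (fun w _ hx => RayleighTaylorMHD.verticalEnergy_eq w hx) hT.le
  · exact h.stability (hhor.mono (NNReal.coe_le_coe.2 (le_max_right C₁ C₂)))
      (hC₂.trans (le_max_right C₁ C₂))
      (fun w _ hx => RayleighTaylorMHD.horizontalEnergy_eq w hx) hT.le

theorem theorem2p4 (c : RayleighTaylorMHD.Coeffs) (B : ℝ)
    (hB : RayleighTaylorMHD.criticalNumber c < |B|) :
    ∃ C : NNReal,
      -- vertical magnetic vector
      (∀ (T : ℝ) (v vt η : ℝ → Fin 2 → RayleighTaylorMHD.L2) (q : ℝ → ℝ × ℝ → ℝ), 0 < T →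
        RayleighTaylorMHD.IsSolution c ![0, B] T v vt η q →
        (∀ t ∈ Set.Icc 0 T,
          RayleighTaylorMHD.verticalEnergy (vt t) (v t) + RayleighTaylorMHD.dissipation vt t
            ≤ C * RayleighTaylorMHD.verticalEnergy (vt 0) (v 0)) ∧
        ((∀ i, RayleighTaylorMHD.HasLowerTrace (-1) 1 (η 0 i) 0 ∧
            RayleighTaylorMHD.HasUpperTrace (-1) 1 (η 0 i) 0) →
          ∀ t ∈ Set.Icc 0 T,
            RayleighTaylorMHD.verticalEnergy (v t) (η t) + RayleighTaylorMHD.dissipation v t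
              ≤ C * RayleighTaylorMHD.verticalEnergy (v 0) (η 0))) ∧
      -- horizontal magnetic vector
      (∀ (T : ℝ) (v vt η : ℝ → Fin 2 → RayleighTaylorMHD.L2) (q : ℝ → ℝ × ℝ → ℝ), 0 < T →
        RayleighTaylorMHD.IsSolution c ![B, 0] T v vt η q →
        (∀ t ∈ Set.Icc 0 T,
          RayleighTaylorMHD.horizontalEnergy (vt t) (v t) + RayleighTaylorMHD.dissipation vt t
            ≤ C * RayleighTaylorMHD.horizontalEnergy (vt 0) (v 0)) ∧
        ((∀ᵐ x ∂(MeasureTheory.volume.restrict RayleighTaylorMHD.slab),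
            RayleighTaylorMHD.weakPartial RayleighTaylorMHD.slab 0 (η 0 0) x
              + RayleighTaylorMHD.weakPartial RayleighTaylorMHD.slab 1 (η 0 1) x = 0) →
          ∀ t ∈ Set.Icc 0 T,
            RayleighTaylorMHD.horizontalEnergy (v t) (η t) + RayleighTaylorMHD.dissipation v t
              ≤ C * RayleighTaylorMHD.horizontalEnergy (v 0) (η 0))) := by
  obtain ⟨C, hvert, hhor⟩ := theorem2p4_general c B hB
  exact ⟨C, fun T v vt η q hT h => (hvert T v vt η q hT h).imp_right fun h' _ => h',
    fun T v vt η q hT h => (hhor T v vt η q hT h).imp_right fun h' _ => h'⟩
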